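/- Let $E$ be a finite-dimensional complex Hilbert space, $F$ a finite-dimensional real Hilbert space with dual $F'$ and complexification $F_{\mathbb C}$, and let $\Phi\colon E\times E\to F_{\mathbb C}$ be a hermitian map (linear in the first variable, with $\Phi(\zeta',\zeta)=\overline{\Phi(\zeta,\zeta')}$). Let $\mathcal N=E\times F$ be the quadratic CR manifold associated with $\Phi$, i.e. the group with product $(\zeta,x)(\zeta',x')=(\zeta+\zeta',x+x'+2\operatorname{Im}\Phi(\zeta,\zeta'))$, endowed with Lebesgue measure. For $w\in E$ let $Z_w$ be the left-invariant vector field on $\mathcal N$ that agrees with $\frac12(\partial_w-i\partial_{iw})$ at the origin, i.e. $$Z_w f(\zeta,x)=\tfrac12(\partial_w-i\partial_{iw})f(\zeta,x)+i\,\partial_{\operatorname{Re}\Phi(w,\zeta)}f(\zeta,x)-\partial_{\operatorname{Im}\Phi(w,\zeta)}f(\zeta,x);$$ a $C^1$ function $f$ is CR if $\overline{Z_w}f=0$ for every $w\in E$. For a compact set $K\subseteq F'$, let $\mathcal O_K(\mathcal N)$ be the space of CR functions $f\in C^\infty(\mathcal N)\cap\mathcal S'(\mathcal N)$ such that for every $\zeta\in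 E$ the function $f(\zeta,\cdot)$ is a tempered distribution on $F$ whose Fourier transform $\mathcal F_F[f(\zeta,\cdot)]$ (with kernel $e^{-i\langle\lambda,x\rangle}$) is supported in $K$. A function $f$ in $L^p(\mathcal N)$ has bounded spectrum if $f\in\mathcal O_K(\mathcal N)$ for some compact $K\subseteq F'$, and then its spectrum is $$\operatorname{Sp}(f)=\bigcap\{K : K\subseteq F' \text{ compact},\ f\in\mathcal O_K(\mathcal N)\}.$$ For a complex polynomial $P$ on $F'$, written $P(\lambda)=\sum_\alpha c_\alpha\prod_j\langle\lambda,b_j\rangle^{\alpha_j}$ in terms of a basis $(b_j)$ of $F$, put $P(-i\partial_F)=\sum_\alpha c_\alpha\prod_j(-i\partial_{b_j})^{\alpha_j}$, the derivatives being taken in the variable $x\in F$ of $(\zeta,x)\in\mathcal N$. **Proposition (real Paley–Wiener theorem).** Let $p\in(0,\infty]$, let $f\in L^p(\mathcal N)$ have bounded spectrum, and let $P$ be a complex polynomial on $F'$. Then $$\lim_{k\to\infty}\|P(-i\partial_F)^k f\|_{L^p(\mathcal N)}^{1/k}=\max_{\operatorname{Sp}(f)}|P|,$$ where the maximum is attained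 if $f\neq0$, and is read as $0$ if $f=0$ (in which case $\operatorname{Sp}(f)=\emptyset$). -/

import Mathlib

open MeasureTheory Filter Topology
open scoped ENNReal ContDiff TensorProduct ComplexConjugate SchwartzMap FourierTransform

namespace QuadraticCR

noncomputable section

/-- The real part `F_ℂ → F` on the complexification `F_ℂ = ℂ ⊗[ℝ] F` of a real vector space `F`. -/
def rePart {F : Type*} [AddCommGroup F] [Module ℝ F] : ℂ ⊗[ℝ] F →ₗ[ℝ] F :=
  (TensorProduct.lid ℝ F).toLinearMap ∘ₗ LinearMap.rTensor F Complex.reLm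

/-- The imaginary part `F_ℂ → F` on the complexification `F_ℂ = ℂ ⊗[ℝ] F`. -/
def imPart {F : Type*} [AddCommGroup F] [Module ℝ F] : ℂ ⊗[ℝ] F →ₗ[ℝ] F :=
  (TensorProduct.lid ℝ F).toLinearMap ∘ₗ LinearMap.rTensor F Complex.imLm

/-- A sesquilinear map `Φ : E × E → F_ℂ` (linear in the first variable, antilinear in the second)
is hermitian if `Φ(ζ', ζ)` is the complex conjugate of `Φ(ζ, ζ')`. -/
def IsHermitianMap {E F : Type*} [AddCommGroup E] [Module ℂ E] [AddCommGroup F] [Module ℝ F]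
    (Φ : E →ₗ[ℂ] E →ₗ⋆[ℂ] (ℂ ⊗[ℝ] F)) : Prop :=
  ∀ ζ ζ' : E, rePart (Φ ζ' ζ) = rePart (Φ ζ ζ') ∧ imPart (Φ ζ' ζ) = - imPart (Φ ζ ζ')

/-- `T` is the tempered distribution defined by the (locally integrable) function `g` and the
measure `μ`: the two agree on compactly supported smooth test functions, which are dense in the
Schwartz space. -/
def Represents {V : Type*} [NormedAddCommGroup V] [NormedSpace ℝ V] [MeasurableSpace V]
    (μ : Measure V) (T : 𝓢'(V, ℂ)) (g : V → ℂ) : Prop :=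
  ∀ φ : 𝓢(V, ℂ), HasCompactSupport (φ : V → ℂ) → T φ = ∫ v, φ v * g v ∂μ

section Fourier

variable {F : Type*} [NormedAddCommGroup F] [InnerProductSpace ℝ F] [FiniteDimensional ℝ F]
  [MeasurableSpace F] [BorelSpace F]

/-- The support, in the dual space `F'`, of the Fourier transform
`u ↦ ∫ u(x) exp(-i ⟨λ, x⟩) dx` of a tempered distribution `u` on `F`. Mathlib's Fourier transform
`𝓕` has the kernel `exp(-2 π i ⟪ξ, x⟫)`, `ξ ∈ F`, so that the frequency `ξ` corresponds to
`λ = ⟪2 π ξ, ·⟫ ∈ F'`. -/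
def fourierSupport (u : 𝓢'(F, ℂ)) : Set (StrongDual ℝ F) :=
  (fun ξ : F => InnerProductSpace.toDual ℝ F ((2 * Real.pi) • ξ)) ''
    Distribution.dsupport (𝓕 u : 𝓢'(F, ℂ))

end Fourier

/-- Lebesgue measure on the complex Hilbert space `E`, that is, Lebesgue measure of the underlying
real Hilbert space, with inner product `Re ⟪·, ·⟫`. -/
def lebesgueComplex (E : Type*) [NormedAddCommGroup E] [InnerProductSpace ℂ E]
    [FiniteDimensional ℂ E] [MeasurableSpace E] [BorelSpace E] : Measure E :=
  letI : InnerProductSpace ℝ E := InnerProductSpace.complexToReal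
  volume

/-- Lebesgue (Haar) measure on `𝒩 = E × F`. -/
def lebesgueN (E F : Type*) [NormedAddCommGroup E] [InnerProductSpace ℂ E]
    [FiniteDimensional ℂ E] [MeasurableSpace E] [BorelSpace E] [NormedAddCommGroup F]
    [InnerProductSpace ℝ F] [FiniteDimensional ℝ F] [MeasurableSpace F] [BorelSpace F] :
    Measure (E × F) :=
  (lebesgueComplex E).prod volume

section CR

variable {E F : Type*} [NormedAddCommGroup E] [InnerProductSpace ℂ E]
  [NormedAddCommGroup F] [InnerProductSpace ℝ F]

/-- The conjugate `Z̄_w` of the vector field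
`Z_w = ½ (∂_w - i ∂_{iw}) + i ∂_{Re Φ(w, ζ)} - ∂_{Im Φ(w, ζ)}` on `𝒩 = E × F`, which is the
left-invariant vector field, for the product
`(ζ, x) (ζ', x') = (ζ + ζ', x + x' + 2 Im Φ(ζ, ζ'))`, that agrees with the Wirtinger derivative
`½ (∂_w - i ∂_{iw})` at the origin. -/
def conjZ (Φ : E →ₗ[ℂ] E →ₗ⋆[ℂ] (ℂ ⊗[ℝ] F)) (w : E) (f : E × F → ℂ) (q : E × F) : ℂ :=
  (1 / 2 : ℂ) * (fderiv ℝ f q (w, 0) + Complex.I * fderiv ℝ f q (Complex.I • w, 0))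
    - Complex.I * fderiv ℝ f q (0, rePart (Φ w q.1)) - fderiv ℝ f q (0, imPart (Φ w q.1))

/-- A `C¹` function on `𝒩` is CR if it is annihilated by all the `Z̄_w`. -/
def IsCR (Φ : E →ₗ[ℂ] E →ₗ⋆[ℂ] (ℂ ⊗[ℝ] F)) (f : E × F → ℂ) : Prop :=
  ∀ (w : E) (q : E × F), conjZ Φ w f q = 0

/-- The operator `P(-i ∂_F)` on functions on `𝒩 = E × F`, where `P = ∑_α c_α λ^α` is a polynomial in
the coordinates `λ_j = ⟨λ, b_j⟩` of `λ ∈ F'` relative to a basis `b` of `F`: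
`P(-i ∂_F) f = ∑_α c_α (-i ∂_{b_0})^{α_0} ⋯ (-i ∂_{b_{m-1}})^{α_{m-1}} f`. -/
def polyDiffOp {m : ℕ} (b : Module.Basis (Fin m) ℝ F) (P : MvPolynomial (Fin m) ℂ)
    (f : E × F → ℂ) : E × F → ℂ := fun q =>
  ∑ α ∈ P.support, P.coeff α *
    ((List.finRange m).foldr
      (fun j g => (fun (h : E × F → ℂ) (r : E × F) => -Complex.I * fderiv ℝ h r (0, b j))^[α j] g)
      f) q

/-- The value at `λ ∈ F'` of the polynomial `P` in the coordinates `λ_j = ⟨λ, b_j⟩`. -/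
def polyEval {m : ℕ} (b : Module.Basis (Fin m) ℝ F) (P : MvPolynomial (Fin m) ℂ)
    (l : StrongDual ℝ F) : ℂ :=
  MvPolynomial.eval (fun j => ((l (b j) : ℝ) : ℂ)) P

end CR

section Spectrum

variable {E F : Type*} [NormedAddCommGroup E] [InnerProductSpace ℂ E] [FiniteDimensional ℂ E]
  [MeasurableSpace E] [BorelSpace E]
  [NormedAddCommGroup F] [InnerProductSpace ℝ F] [FiniteDimensional ℝ F]
  [MeasurableSpace F] [BorelSpace F]

/-- The space `𝒪_K(𝒩)`, for `K ⊆ F'`: smooth CR functions on `𝒩` which are tempered distributions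
and all of whose restrictions `f(ζ, ·)`, `ζ ∈ E`, are tempered distributions on `F` with Fourier
transform supported in `K`. -/
structure MemO (Φ : E →ₗ[ℂ] E →ₗ⋆[ℂ] (ℂ ⊗[ℝ] F)) (K : Set (StrongDual ℝ F))
    (f : E × F → ℂ) : Prop where
  smooth : ContDiff ℝ ∞ f
  tempered : ∃ T : 𝓢'(E × F, ℂ), Represents (lebesgueN E F) T f
  cr : IsCR Φ f
  slice : ∀ ζ : E, ∃ u : 𝓢'(F, ℂ),
    Represents volume u (fun x => f (ζ, x)) ∧ fourierSupport u ⊆ K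

/-- `f` has bounded spectrum if it belongs to `𝒪_K(𝒩)` for some compact subset `K` of `F'`. -/
def HasBoundedSpectrum (Φ : E →ₗ[ℂ] E →ₗ⋆[ℂ] (ℂ ⊗[ℝ] F)) (f : E × F → ℂ) : Prop :=
  ∃ K : Set (StrongDual ℝ F), IsCompact K ∧ MemO Φ K f

/-- The spectrum of `f`: the intersection of all compact subsets `K` of `F'` with `f ∈ 𝒪_K(𝒩)`. -/
def Sp (Φ : E →ₗ[ℂ] E →ₗ⋆[ℂ] (ℂ ⊗[ℝ] F)) (f : E × F → ℂ) : Set (StrongDual ℝ F) :=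
  ⋂₀ {K | IsCompact K ∧ MemO Φ K f}

end Spectrum

end

end QuadraticCR

namespace QuadraticCR

/-! ### Bumps, seminorm estimates and smooth families in the Schwartz space -/

section SchwartzTools

variable {V : Type*} [NormedAddCommGroup V] [NormedSpace ℝ V]

/-! Write `S ζ` for the Fourier transform of `f(ζ, ·)`. All the `S ζ` live on one compact set of
frequencies, the spectrum, on which `P(-i∂_F)` acts as multiplication by `P`. Both halves of the
limit are then estimates for Fourier multipliers in the variable `x`, whose constants grow in `k`
like a polynomial times an exponential; the `k`-th root keeps only the exponential.

Upper bound (`eLpNorm_iterate_le`). If `|P| < A` on the spectrum, choose a cutoff `ψ` equal to `1`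
near the spectrum and supported where `|P| < A`. Then `P(-i∂_F)^k f` is a convolution of `f` in `x`
with a kernel obtained from `ψ P^k`. Derivatives of `P^k` cost only powers of `k`, so the kernel
decays to any order with constant `C (1 + k)^L A^k`. Convolution with it is bounded on `L^p`: for `p
> 1` by Hölder, for `p ≤ 1` by Nikolskii's inequality, which applies because only functions with
Fourier transform in a fixed compact set occur (`eLpNorm_le_of_band`).

Lower bound (`le_eLpNorm_iterate`). Let `|P(ξ₀)| > B` at a point `ξ₀` of the spectrum. By minimality
of the spectrum (`exists_band`) some test function `θ` supported where `|P| > B` has `S ζ₀ θ ≠ 0`.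
Writing `θ = P^k (θ P^{-k})`, the number `S ζ θ` is a pairing of `P(-i∂_F)^k f(ζ, ·)` with a kernel
of size `C (1 + k)^L B^{-k}`, so it is controlled by the `L^p` norm of that slice. To reach the norm
on the whole group, `S ζ θ` must stay away from `0` on a set of `ζ` of positive measure, and this
follows from continuity in `ζ`.

That continuity (`continuous_slice_apply`) is the one place where the CR equations enter. Each slice
has polynomial growth, but a priori not locally uniformly in `ζ`. The CR equations give a mean value
property: the mean of `f` over the circle `{e^{iθ} w}`, group-translated to `(ζ, x)`, is the value
of the entire extension of `f(ζ, ·)` at `x + i Φ(w, w)` (`integral_circle_eq`, resting on the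
uniqueness statement `eq_entire_of_boundary`). Hence averaging `f` against a rotation-invariant bump
multiplies `S ζ` by a function of `ξ` independent of `ζ`, which can be made nonzero near the
spectrum. The average is the tempered distribution `f` tested on translates of a smooth family, so
it does grow locally uniformly; dividing by the multiplier and applying dominated convergence
finishes the argument. -/

theorem exists_smooth_bump [FiniteDimensional ℝ V] {K U : Set V} (hK : IsCompact K)
    (hU : IsOpen U) (hKU : K ⊆ U) :
    ∃ ψ : V → ℝ, ContDiff ℝ ∞ ψ ∧ HasCompactSupport ψ ∧ tsupport ψ ⊆ U ∧
      (∃ O, IsOpen O ∧ K ⊆ O ∧ ∀ x ∈ O, ψ x = 1) ∧ ∀ x, ψ x ∈ Set.Icc (0 : ℝ) 1 := by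
  obtain ⟨K', hK', hKK', hK'U⟩ := exists_compact_between hK hU hKU
  obtain ⟨K'', hK'', hKK'', hK''U⟩ := exists_compact_between hK isOpen_interior hKK'
  obtain ⟨f, h1, h2, h3⟩ := exists_contMDiffMap_zero_one_nhds_of_isClosed
    (n := (⊤ : ℕ∞)) (modelWithCornersSelf ℝ V) (s := (interior K')ᶜ) (t := K'')
    isOpen_interior.isClosed_compl hK''.isClosed
    (Set.disjoint_left.2 fun x hx hx' => hx (hK''U hx'))
  have hz : ∀ x ∉ K', f x = 0 := fun x hx =>
    h1.self_of_nhdsSet x (fun h => hx (interior_subset h))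
  have hts : tsupport f ⊆ K' := by
    refine closure_minimal (fun x hx => ?_) hK'.isClosed
    by_contra h
    exact hx (hz x h)
  refine ⟨f, f.contMDiff.contDiff, hK'.of_isClosed_subset (isClosed_tsupport _) hts,
    hts.trans hK'U, ⟨interior K'', isOpen_interior, hKK'', fun x hx => ?_⟩, h3⟩
  exact h2.self_of_nhdsSet x (interior_subset hx)

/-- Finitely many Schwartz seminorms control `q`; they are packed into one order `N` and one number
`B`, so that later bounds depending on `k` can be fed in as `B`. -/
theorem schwartz_seminorm_le_of_continuous (q : Seminorm ℂ 𝓢(V, ℂ)) (hq : Continuous q) :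
    ∃ C : ℝ, 0 ≤ C ∧ ∃ N : ℕ, ∀ (φ : 𝓢(V, ℂ)) (B : ℝ), 0 ≤ B →
      (∀ k ≤ N, ∀ l ≤ N, ∀ x, ‖x‖ ^ k * ‖iteratedFDeriv ℝ l φ x‖ ≤ B) → q φ ≤ C * B := by
  obtain ⟨s, C, -, hC⟩ := Seminorm.bound_of_continuous (schwartz_withSeminorms ℂ V ℂ) q hq
  refine ⟨C, C.2, s.sup (fun p => max p.1 p.2), fun φ B hB h => (hC φ).trans ?_⟩
  change (C : ℝ) * _ ≤ _
  refine mul_le_mul_of_nonneg_left ?_ C.2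
  refine Seminorm.finset_sup_apply_le hB fun p hp => ?_
  have h1 : max p.1 p.2 ≤ s.sup (fun p => max p.1 p.2) :=
    Finset.le_sup (f := fun p : ℕ × ℕ => max p.1 p.2) hp
  exact SchwartzMap.seminorm_le_bound ℂ p.1 p.2 φ hB
    (h p.1 ((le_max_left _ _).trans h1) p.2 ((le_max_right _ _).trans h1))

theorem temperedDistribution_bound (T : 𝓢'(V, ℂ)) :
    ∃ C : ℝ, 0 ≤ C ∧ ∃ N : ℕ, ∀ (φ : 𝓢(V, ℂ)) (B : ℝ), 0 ≤ B →
      (∀ k ≤ N, ∀ l ≤ N, ∀ x, ‖x‖ ^ k * ‖iteratedFDeriv ℝ l φ x‖ ≤ B) → ‖T φ‖ ≤ C * B :=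
  schwartz_seminorm_le_of_continuous
    ((normSeminorm ℂ ℂ).comp (T : 𝓢(V, ℂ) →L[ℂ] ℂ).toLinearMap)
    (continuous_norm.comp (T : 𝓢(V, ℂ) →L[ℂ] ℂ).continuous)

theorem schwartz_tendsto {ι : Type*} {l : Filter ι} {A : ι → 𝓢(V, ℂ)} {a : 𝓢(V, ℂ)}
    (h : ∀ k n : ℕ, ∀ ε > 0, ∀ᶠ i in l, ∀ x, ‖x‖ ^ k * ‖iteratedFDeriv ℝ n (A i - a) x‖ ≤ ε) :
    Tendsto A l (𝓝 a) := by
  rw [(schwartz_withSeminorms ℂ V ℂ).tendsto_nhds]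
  intro p ε hε
  filter_upwards [h p.1 p.2 (ε / 2) (by positivity)] with i hi
  exact lt_of_le_of_lt (SchwartzMap.seminorm_le_bound ℂ p.1 p.2 _ (by positivity) hi)
    (by linarith)

theorem iteratedFDeriv_prodMk_right {Z : Type*} [NormedAddCommGroup Z] [NormedSpace ℝ Z]
    {a : Z × V → ℂ} (ha : ContDiff ℝ ∞ a) (z : Z) (n : ℕ) (ξ : V) :
    iteratedFDeriv ℝ n (fun ξ => a (z, ξ)) ξ =
      (iteratedFDeriv ℝ n a (z, ξ)).compContinuousLinearMap
        fun _ => ContinuousLinearMap.inr ℝ Z V := by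
  have h1 : (fun ξ => a (z, ξ)) =
      (fun q => a ((z, 0) + q)) ∘ (ContinuousLinearMap.inr ℝ Z V) := by
    ext ξ; simp
  have h2 : ContDiff ℝ ∞ (fun q => a ((z, 0) + q)) := ha.comp (contDiff_const.add contDiff_id)
  rw [h1, ContinuousLinearMap.iteratedFDeriv_comp_right _ h2 _ (by exact_mod_cast le_top),
    iteratedFDeriv_comp_add_left]
  simp

/-- A jointly smooth family of functions supported in a fixed compact set depends continuously
on the parameter, as a family of Schwartz functions. -/
theorem continuous_schwartz_of_contDiff {Z : Type*} [NormedAddCommGroup Z] [NormedSpace ℝ Z]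
    {a : Z × V → ℂ} (ha : ContDiff ℝ ∞ a) {K : Set V} (hK : IsCompact K)
    (hs : ∀ z, ∀ ξ ∉ K, a (z, ξ) = 0) {A : Z → 𝓢(V, ℂ)} (hA : ∀ z ξ, A z ξ = a (z, ξ)) :
    Continuous A := by
  refine continuous_iff_continuousAt.2 fun z₀ => schwartz_tendsto fun k n ε hε => ?_
  have hAz : ∀ z, (A z : V → ℂ) = fun ξ => a (z, ξ) := fun z => funext (hA z)
  set D : Z × V → _ := fun p => iteratedFDeriv ℝ n (A p.1) p.2
  have hD : Continuous D := by
    have : D = fun p => (ContinuousMultilinearMap.compContinuousLinearMapL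
        (fun _ : Fin n => ContinuousLinearMap.inr ℝ Z V)) (iteratedFDeriv ℝ n a p) := by
      ext1 p
      simp only [D]
      rw [hAz, iteratedFDeriv_prodMk_right ha]
      rfl
    rw [this]
    exact (ContinuousLinearMap.continuous _).comp
      (ha.continuous_iteratedFDeriv (by exact_mod_cast le_top))
  have hsub : ∀ z ξ, iteratedFDeriv ℝ n (A z - A z₀) ξ = D (z, ξ) - D (z₀, ξ) := by
    intro z ξ
    have h1 : ((A z - A z₀ : 𝓢(V, ℂ)) : V → ℂ) = (A z : V → ℂ) - (A z₀ : V → ℂ) := rfl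
    rw [h1, iteratedFDeriv_sub_apply ((A z).smooth n).contDiffAt ((A z₀).smooth n).contDiffAt]
  -- Compactness of `K` turns joint continuity of the derivatives into uniformity in `ξ`.
  have key : ∀ᶠ z in 𝓝 z₀, ∀ ξ ∈ K, ‖ξ‖ ^ k * ‖D (z, ξ) - D (z₀, ξ)‖ < ε := by
    refine hK.eventually_forall_of_forall_eventually fun ξ _ => ?_
    have hc : Continuous fun p : Z × V => ‖p.2‖ ^ k * ‖D (p.1, p.2) - D (z₀, p.2)‖ := by
      fun_prop
    have := hc.tendsto (z₀, ξ)
    simp only [sub_self, norm_zero, mul_zero] at this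
    exact this.eventually (gt_mem_nhds hε)
  filter_upwards [key] with z hz ξ
  rw [hsub]
  by_cases hξ : ξ ∈ K
  · exact (hz ξ hξ).le
  · have h0 : ∀ z, D (z, ξ) = 0 := by
      intro z
      have hts : tsupport (A z) ⊆ K := by
        refine closure_minimal (fun x hx => ?_) hK.isClosed
        by_contra h
        exact hx (by rw [hA, hs z x h])
      have := support_iteratedFDeriv_subset (𝕜 := ℝ) (f := A z) n
      by_contra h
      exact hξ (hts (this h))
    rw [h0, h0]
    simp [hε.le]

end SchwartzTools

end QuadraticCR

namespace QuadraticCR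

/-! ### Density of compactly supported functions, and translates of test functions -/

section Cutoff

variable {V : Type*} [NormedAddCommGroup V] [NormedSpace ℝ V]

/-- Compactly supported smooth functions are dense in the Schwartz space. -/
theorem exists_tendsto_cutoff [FiniteDimensional ℝ V] (φ : 𝓢(V, ℂ)) :
    ∃ A : ℕ → 𝓢(V, ℂ), (∀ n, HasCompactSupport (A n)) ∧ (∀ n, tsupport (A n) ⊆ tsupport φ) ∧
      (∀ n x, ‖A n x‖ ≤ ‖φ x‖) ∧ (∀ x, Tendsto (fun n => A n x) atTop (𝓝 (φ x))) ∧
      Tendsto A atTop (𝓝 φ) := by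
  obtain ⟨c, hc, hcs, -, ⟨O, hO, hKO, hO1⟩, hc01⟩ :=
    exists_smooth_bump (isCompact_closedBall (0 : V) 1) isOpen_univ (Set.subset_univ _)
  have hc1 : ∀ x, ‖x‖ ≤ 1 → c x = 1 := fun x hx => hO1 x (hKO (by simpa using hx))
  set r : ℕ → ℝ := fun n => ((n : ℝ) + 1)⁻¹
  have hr : ∀ n, 0 < r n := fun n => by positivity
  have hr1 : ∀ n, r n ≤ 1 := fun n => inv_le_one_of_one_le₀ (by simp)
  set b : V → ℂ := fun x => (c x : ℂ) - 1
  have hbc : ContDiff ℝ ∞ (fun x => (c x : ℂ)) := Complex.ofRealCLM.contDiff.comp hc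
  have hb : ContDiff ℝ ∞ b := hbc.sub contDiff_const
  set m : ℕ → V → ℂ := fun n x => (c (r n • x) : ℂ)
  have hm : ∀ n, ContDiff ℝ ∞ (m n) := fun n => hbc.comp (contDiff_const_smul _)
  have hsupp : ∀ n, HasCompactSupport (m n) := by
    intro n
    have : HasCompactSupport (fun x => (c x : ℂ)) :=
      hcs.comp_left (g := fun t : ℝ => (t : ℂ)) (by simp)
    exact this.comp_homeomorph (Homeomorph.smulOfNeZero (r n) (hr n).ne')
  have hprod : ∀ n, ContDiff ℝ ∞ (fun x => m n x * φ x) := fun n => (hm n).mul (φ.smooth ⊤)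
  let A : ℕ → 𝓢(V, ℂ) := fun n =>
    ((hsupp n).mul_right (f' := φ)).toSchwartzMap (hprod n)
  have hA : ∀ n x, A n x = m n x * φ x := fun n x => rfl
  refine ⟨A, fun n => (hsupp n).mul_right, fun n => closure_mono fun x hx => ?_, fun n x => ?_,
    fun x => ?_, ?_⟩
  · simp only [Function.mem_support, hA, ne_eq, mul_eq_zero, not_or] at hx
    exact hx.2
  · rw [hA, norm_mul]
    refine mul_le_of_le_one_left (norm_nonneg _) ?_
    simp only [m, Complex.norm_real, Real.norm_eq_abs]
    rw [abs_of_nonneg (hc01 _).1]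
    exact (hc01 _).2
  · refine tendsto_const_nhds.congr' ?_
    filter_upwards [eventually_ge_atTop ⌈‖x‖⌉₊] with n hn
    rw [hA]
    have : ‖r n • x‖ ≤ 1 := by
      rw [norm_smul, Real.norm_of_nonneg (hr n).le, inv_mul_le_iff₀ (by positivity)]
      have := (Nat.ceil_le.1 hn)
      linarith
    simp [m, hc1 _ this]
  · have hbound : ∀ i : ℕ, ∃ M, 0 ≤ M ∧ ∀ x, ‖iteratedFDeriv ℝ i b x‖ ≤ M := by
      intro i
      have hcs' : HasCompactSupport (iteratedFDeriv ℝ i (fun x => (c x : ℂ))) :=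
        (hcs.comp_left (g := fun t : ℝ => (t : ℂ)) (by simp)).iteratedFDeriv i
      obtain ⟨M, hM⟩ := hcs'.exists_bound_of_continuous
        (hbc.continuous_iteratedFDeriv (by exact_mod_cast le_top))
      refine ⟨M + 1, by linarith [(norm_nonneg _).trans (hM 0)], fun x => ?_⟩
      have : b = (fun x => (c x : ℂ)) - (fun _ => (1 : ℂ)) := rfl
      rw [this, iteratedFDeriv_sub_apply
        (hbc.of_le (by exact_mod_cast le_top)).contDiffAt contDiff_const.contDiffAt]
      refine (norm_sub_le _ _).trans (add_le_add (hM x) ?_)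
      rcases Nat.eq_zero_or_pos i with rfl | hi
      · simp
      · rw [iteratedFDeriv_const_of_ne hi.ne']; simp
    choose M hM0 hM using hbound
    refine schwartz_tendsto fun k l ε hε => ?_
    set S : ℝ := ∑ i ∈ Finset.range (l + 1),
      (l.choose i : ℝ) * M i * SchwartzMap.seminorm ℂ (k + 1) (l - i) φ
    have hS : 0 ≤ S := Finset.sum_nonneg fun i _ => by
      have := hM0 i
      have := apply_nonneg (SchwartzMap.seminorm ℂ (k + 1) (l - i)) φ
      positivity
    have hlim : Tendsto (fun n => r n * S) atTop (𝓝 0) := by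
      have := (tendsto_one_div_add_atTop_nhds_zero_nat (𝕜 := ℝ)).mul_const S
      simpa [r] using this
    filter_upwards [hlim.eventually (ge_mem_nhds hε)] with n hn x
    refine le_trans ?_ hn
    have hfun : ((A n - φ : 𝓢(V, ℂ)) : V → ℂ) = fun x => b (r n • x) * φ x := by
      ext x
      change m n x * φ x - φ x = _
      simp only [m, b]; ring
    rw [hfun]
    by_cases hx : ‖r n • x‖ < 1
    · have h0 : (fun x => b (r n • x) * φ x) =ᶠ[𝓝 x] fun _ => 0 := by
        have : ∀ᶠ y in 𝓝 x, ‖r n • y‖ < 1 :=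
          (continuous_norm.comp (continuous_const_smul (r n))).continuousAt.eventually
            (gt_mem_nhds hx)
        filter_upwards [this] with y hy
        simp [b, hc1 _ hy.le]
      rw [(h0.iteratedFDeriv ℝ l).eq_of_nhds]
      have : iteratedFDeriv ℝ l (fun _ : V => (0 : ℂ)) x = 0 := by
        have := iteratedFDeriv_fun_zero (𝕜 := ℝ) (E := V) (F := ℂ) (n := l)
        exact congrFun this x
      rw [this]
      have := hr n
      simpa using by positivity
    -- Where the dilated cutoff differs from `1` the factor `r n * ‖x‖` is at least `1` and can be
    -- inserted for free: one more weight `‖x‖` on `φ` buys the small factor `r n`.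
    · have hx1 : 1 ≤ r n * ‖x‖ := by
        have := not_lt.1 hx
        rwa [norm_smul, Real.norm_of_nonneg (hr n).le] at this
      have hbr : ContDiff ℝ ∞ (fun x => b (r n • x)) := hb.comp (contDiff_const_smul _)
      have h1 := norm_iteratedFDeriv_mul_le hbr (φ.smooth ⊤) x (n := l)
        (by exact_mod_cast le_top)
      have h2 : ∀ i, ‖iteratedFDeriv ℝ i (fun x => b (r n • x)) x‖ ≤ M i := by
        intro i
        have hbi : ContDiff ℝ i b := hb.of_le (by exact_mod_cast le_top)
        rw [congrFun (iteratedFDeriv_comp_const_smul (r n) hbi) x]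
        simp only [norm_smul, norm_pow, Real.norm_of_nonneg (hr n).le]
        calc r n ^ i * _ ≤ 1 * M i :=
              mul_le_mul (pow_le_one₀ (hr n).le (hr1 n)) (hM i _) (norm_nonneg _) zero_le_one
          _ = M i := one_mul _
      calc ‖x‖ ^ k * _ ≤ (r n * ‖x‖) * (‖x‖ ^ k * _) :=
            le_mul_of_one_le_left (by positivity) hx1
        _ = r n * (‖x‖ ^ (k + 1) * ‖iteratedFDeriv ℝ l (fun x => b (r n • x) * φ x) x‖) := by
            ring
        _ ≤ r n * S := by
            have := (hr n).le
            refine mul_le_mul_of_nonneg_left ?_ this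
            refine (mul_le_mul_of_nonneg_left h1 (by positivity)).trans ?_
            rw [Finset.mul_sum]
            refine Finset.sum_le_sum fun i _ => ?_
            calc _ = (l.choose i : ℝ) * ‖iteratedFDeriv ℝ i (fun x => b (r n • x)) x‖ *
                  (‖x‖ ^ (k + 1) * ‖iteratedFDeriv ℝ (l - i) φ x‖) := by ring
              _ ≤ _ := by
                have := hM0 i
                gcongr
                · exact h2 i
                · exact SchwartzMap.le_seminorm ℂ _ _ _ _

theorem one_add_norm_le_mul {V : Type*} [NormedAddCommGroup V] (x y : V) : 1 + ‖x‖ ≤ (1 + ‖y‖) * (1 + ‖x - y‖) := by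
  have := norm_add_le y (x - y)
  rw [add_sub_cancel] at this
  nlinarith [norm_nonneg y, norm_nonneg (x - y)]

/-- Translation by `x` enlarges the weights by at most a power of `1 + ‖x‖`. Since multiplying by a
character translates the Fourier transform, this is the source of polynomial growth for band-limited
functions. -/
theorem temperedDistribution_translate_bound (T : 𝓢'(V, ℂ)) (φ : 𝓢(V, ℂ)) :
    ∃ C : ℝ, 0 ≤ C ∧ ∃ N : ℕ, ∀ x, ‖T (φ.compSubConstCLM ℂ x)‖ ≤ C * (1 + ‖x‖) ^ N := by
  obtain ⟨C, hC, N, h⟩ := temperedDistribution_bound T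
  set B : ℝ := 2 ^ N * (Finset.Iic (N, N)).sup (fun m => SchwartzMap.seminorm ℂ m.1 m.2) φ
  have hB : 0 ≤ B := by positivity
  refine ⟨C * B, by positivity, N, fun x => ?_⟩
  have := h (φ.compSubConstCLM ℂ x) (B * (1 + ‖x‖) ^ N) (by positivity) ?_
  · linarith
  intro k hk l hl y
  have h1 : (φ.compSubConstCLM ℂ x : V → ℂ) = fun y => φ (y - x) := rfl
  rw [h1, iteratedFDeriv_comp_sub]
  have h2 := SchwartzMap.one_add_le_sup_seminorm_apply (𝕜 := ℂ) (m := (N, N)) hk hl φ (y - x)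
  have h3 : ‖y‖ ^ k ≤ (1 + ‖x‖) ^ N * (1 + ‖y - x‖) ^ k := by
    calc ‖y‖ ^ k ≤ (1 + ‖y‖) ^ k := by gcongr; linarith
      _ ≤ ((1 + ‖x‖) * (1 + ‖y - x‖)) ^ k := by gcongr; exact one_add_norm_le_mul _ _
      _ ≤ _ := by
        rw [mul_pow]; gcongr; linarith [norm_nonneg x]
  calc _ ≤ (1 + ‖x‖) ^ N * (1 + ‖y - x‖) ^ k * ‖iteratedFDeriv ℝ l φ (y - x)‖ := by gcongr
    _ = (1 + ‖x‖) ^ N * ((1 + ‖y - x‖) ^ k * ‖iteratedFDeriv ℝ l φ (y - x)‖) := by ring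
    _ ≤ (1 + ‖x‖) ^ N * B := by gcongr
    _ = _ := by ring

end Cutoff

/-! ### Derivatives of `k`-th powers -/

section Growth

variable {V : Type*} [NormedAddCommGroup V] [NormedSpace ℝ V]

/-- Each differentiation of `R ^ k` brings down a factor of order `k` and replaces one `R` by one of
its derivatives. The exponential rate `A ^ k` is therefore untouched, and the loss is polynomial in
`k`. -/
theorem norm_iteratedFDeriv_pow_le {R : V → ℂ} (hR : ContDiff ℝ ∞ R) {S : Set V}
    (hS : IsCompact S) {A : ℝ} (hA : 0 < A) (hRA : ∀ ξ ∈ S, ‖R ξ‖ ≤ A) (l : ℕ) :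
    ∃ C : ℝ, 0 ≤ C ∧ ∀ (k : ℕ), ∀ ξ ∈ S,
      ‖iteratedFDeriv ℝ l (fun ξ => R ξ ^ k) ξ‖ ≤ C * (1 + k) ^ l * A ^ k := by
  induction l using Nat.strong_induction_on with
  | _ l ih =>
  rcases l with _ | l
  · refine ⟨1, zero_le_one, fun k ξ hξ => ?_⟩
    simp only [norm_iteratedFDeriv_zero, norm_pow, pow_zero, one_mul]
    gcongr
    exact hRA ξ hξ
  · have hM : ∀ i : ℕ, ∃ M, 0 ≤ M ∧ ∀ ξ ∈ S, ‖iteratedFDeriv ℝ i (fderiv ℝ R) ξ‖ ≤ M := by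
      intro i
      have hc : Continuous (iteratedFDeriv ℝ i (fderiv ℝ R)) :=
        (hR.fderiv_right (m := ∞) (by simp)).continuous_iteratedFDeriv
          (by exact_mod_cast le_top)
      obtain ⟨M, hM⟩ := hS.exists_bound_of_continuousOn hc.continuousOn
      exact ⟨max M 0, le_max_right _ _, fun ξ hξ => (hM ξ hξ).trans (le_max_left _ _)⟩
    choose M hM0 hM using hM
    have ih' : ∀ i : ℕ, ∃ C : ℝ, 0 ≤ C ∧ (i ≤ l → ∀ (k : ℕ), ∀ ξ ∈ S,
        ‖iteratedFDeriv ℝ i (fun ξ => R ξ ^ k) ξ‖ ≤ C * (1 + k) ^ i * A ^ k) := by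
      intro i
      by_cases hi : i ≤ l
      · obtain ⟨C, h1, h2⟩ := ih i (by omega)
        exact ⟨C, h1, fun _ => h2⟩
      · exact ⟨0, le_rfl, fun h => absurd h hi⟩
    choose C hC0 hC using ih'
    -- Leibniz applied to `D(R ^ (k + 1)) = (k + 1) R ^ k DR`. Only `k` powers of `R` are left, and
    -- the factor `A⁻¹` makes up for the missing one.
    refine ⟨∑ i ∈ Finset.range (l + 1), (l.choose i : ℝ) * C i * M (l - i) * A⁻¹,
      Finset.sum_nonneg fun i _ => by
        have := hC0 i
        have := hM0 (l - i)
        positivity, fun k ξ hξ => ?_⟩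
    rcases k with _ | k
    · simp only [pow_zero]
      rw [iteratedFDeriv_const_of_ne (by omega)]
      have : 0 ≤ ∑ i ∈ Finset.range (l + 1), (l.choose i : ℝ) * C i * M (l - i) * A⁻¹ :=
        Finset.sum_nonneg fun i _ => by
          have := hC0 i
          have := hM0 (l - i)
          positivity
      simpa using this
    rw [← norm_iteratedFDeriv_fderiv]
    have hd : fderiv ℝ (fun ξ => R ξ ^ (k + 1)) =
        fun ξ => (((k : ℂ) + 1) • R ξ ^ k) • fderiv ℝ R ξ := by
      ext1 ξ
      have := ((hR.differentiable (by simp)) ξ).hasFDerivAt.pow (k + 1)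
      rw [this.fderiv]
      simp
    rw [hd]
    have hRk : ContDiff ℝ ∞ (fun ξ => R ξ ^ k) := hR.pow k
    have h1 := norm_iteratedFDeriv_smul_le (f := fun ξ => ((k : ℂ) + 1) • R ξ ^ k)
      (hRk.const_smul _)
      (hR.fderiv_right (m := ∞) (by simp)) ξ (n := l) (by exact_mod_cast le_top)
    refine h1.trans ?_
    rw [Finset.sum_mul, Finset.sum_mul]
    refine Finset.sum_le_sum fun i hi => ?_
    have hil : i ≤ l := by simpa [Nat.lt_succ_iff] using hi
    rw [iteratedFDeriv_const_smul_apply' (hRk.of_le (by exact_mod_cast le_top)).contDiffAt,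
      norm_smul]
    have hk1 : ‖(k : ℂ) + 1‖ = (k : ℝ) + 1 := by
      have : ((k : ℂ) + 1) = ((k + 1 : ℕ) : ℂ) := by push_cast; ring
      rw [this, Complex.norm_natCast]; push_cast; ring
    rw [hk1]
    have hCi := hC i hil k ξ hξ
    have hMi := hM (l - i) ξ hξ
    have := hC0 i
    have := hM0 (l - i)
    calc _ ≤ (l.choose i : ℝ) * (((k : ℝ) + 1) * (C i * (1 + k) ^ i * A ^ k)) * M (l - i) := by
          gcongr
      _ ≤ (l.choose i : ℝ) * (((k : ℝ) + 1) * (C i * (1 + k) ^ l * A ^ k)) * M (l - i) := by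
          gcongr
          linarith [(Nat.cast_nonneg k : (0 : ℝ) ≤ k)]
      _ = (l.choose i : ℝ) * C i * M (l - i) * A⁻¹ * (1 + k) ^ (l + 1) * A ^ (k + 1) := by
          field_simp
          ring
      _ ≤ _ := by
          gcongr
          linarith

theorem norm_iteratedFDeriv_mul_pow_le {R θ : V → ℂ} (hR : ContDiff ℝ ∞ R)
    (hθ : ContDiff ℝ ∞ θ) (hθs : HasCompactSupport θ) {A : ℝ} (hA : 0 < A)
    (hRA : ∀ ξ ∈ tsupport θ, ‖R ξ‖ ≤ A) (l : ℕ) :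
    ∃ C : ℝ, 0 ≤ C ∧ ∀ (k : ℕ), ∀ ξ,
      ‖iteratedFDeriv ℝ l (fun ξ => θ ξ * R ξ ^ k) ξ‖ ≤ C * (1 + k) ^ l * A ^ k := by
  have hM : ∀ i : ℕ, ∃ M, 0 ≤ M ∧ ∀ ξ, ‖iteratedFDeriv ℝ i θ ξ‖ ≤ M := by
    intro i
    obtain ⟨M, hM⟩ := (hθs.iteratedFDeriv (𝕜 := ℝ) i).exists_bound_of_continuous
      (hθ.continuous_iteratedFDeriv (by exact_mod_cast le_top))
    exact ⟨M, (norm_nonneg _).trans (hM 0), hM⟩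
  choose M hM0 hM using hM
  choose C hC0 hC using fun i => norm_iteratedFDeriv_pow_le hR hθs.isCompact hA hRA i
  have hnn : 0 ≤ ∑ i ∈ Finset.range (l + 1), (l.choose i : ℝ) * M i * C (l - i) :=
    Finset.sum_nonneg fun i _ => by
      have := hC0 (l - i)
      have := hM0 i
      positivity
  refine ⟨_, hnn, fun k ξ => ?_⟩
  by_cases hξ : ξ ∈ tsupport θ
  · refine (norm_iteratedFDeriv_mul_le hθ (hR.pow k) ξ (n := l)
      (by exact_mod_cast le_top)).trans ?_
    rw [Finset.sum_mul, Finset.sum_mul]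
    refine Finset.sum_le_sum fun i hi => ?_
    have := hC0 (l - i)
    have := hM0 i
    calc _ ≤ (l.choose i : ℝ) * M i * (C (l - i) * (1 + k) ^ (l - i) * A ^ k) := by
          gcongr
          · exact hM i ξ
          · exact hC _ k ξ hξ
      _ ≤ (l.choose i : ℝ) * M i * (C (l - i) * (1 + k) ^ l * A ^ k) := by
          gcongr
          · linarith [(Nat.cast_nonneg k : (0 : ℝ) ≤ k)]
          · omega
      _ = _ := by ring
  · have : iteratedFDeriv ℝ l (fun ξ => θ ξ * R ξ ^ k) ξ = 0 := by
      by_contra h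
      have h1 := support_iteratedFDeriv_subset (𝕜 := ℝ) (f := fun ξ => θ ξ * R ξ ^ k) l h
      exact hξ (closure_mono (Function.support_mul_subset_left _ _) h1)
    rw [this, norm_zero]
    positivity

end Growth

/-! ### Quantitative decay of Fourier transforms -/

section FourierDecay

variable {F : Type*} [NormedAddCommGroup F] [InnerProductSpace ℝ F] [FiniteDimensional ℝ F]
  [MeasurableSpace F] [BorelSpace F]

/-- Continuity of the Fourier transform on the Schwartz space, with constants independent of `φ`;
the weight `(1 + ‖t‖) ^ N` is at most `2 ^ N (1 + ‖t‖ ^ N)`, so orders `0` and `N` suffice. -/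
theorem fourier_decay_bound (N : ℕ) :
    ∃ C : ℝ, 0 ≤ C ∧ ∃ M : ℕ, ∀ (φ : 𝓢(F, ℂ)) (B : ℝ), 0 ≤ B →
      (∀ k ≤ M, ∀ l ≤ M, ∀ x, ‖x‖ ^ k * ‖iteratedFDeriv ℝ l φ x‖ ≤ B) →
      ∀ t, (1 + ‖t‖) ^ N * ‖𝓕 (φ : F → ℂ) t‖ ≤ C * B := by
  have key : ∀ k : ℕ, ∃ C : ℝ, 0 ≤ C ∧ ∃ M : ℕ, ∀ (φ : 𝓢(F, ℂ)) (B : ℝ), 0 ≤ B →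
      (∀ k ≤ M, ∀ l ≤ M, ∀ x, ‖x‖ ^ k * ‖iteratedFDeriv ℝ l φ x‖ ≤ B) →
      ∀ t, ‖t‖ ^ k * ‖𝓕 (φ : F → ℂ) t‖ ≤ C * B := by
    intro k
    have hc : Continuous ((SchwartzMap.seminorm ℂ k 0).comp
        (SchwartzMap.fourierTransformCLM ℂ : 𝓢(F, ℂ) →L[ℂ] 𝓢(F, ℂ)).toLinearMap) :=
      (((schwartz_withSeminorms ℂ F ℂ).continuous_seminorm (k, 0)).comp
        (SchwartzMap.fourierTransformCLM ℂ : 𝓢(F, ℂ) →L[ℂ] 𝓢(F, ℂ)).continuous)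
    obtain ⟨C, hC, M, h⟩ := schwartz_seminorm_le_of_continuous _ hc
    refine ⟨C, hC, M, fun φ B hB hφ t => ?_⟩
    have h1 := SchwartzMap.le_seminorm ℂ k 0 (𝓕 φ) t
    rw [norm_iteratedFDeriv_zero] at h1
    exact h1.trans (h φ B hB hφ)
  obtain ⟨C₀, hC₀, M₀, h₀⟩ := key 0
  obtain ⟨C₁, hC₁, M₁, h₁⟩ := key N
  refine ⟨2 ^ N * (C₀ + C₁), by positivity, max M₀ M₁, fun φ B hB hφ t => ?_⟩
  have e0 := h₀ φ B hB (fun k hk l hl => hφ k (hk.trans (le_max_left _ _)) l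
    (hl.trans (le_max_left _ _))) t
  have e1 := h₁ φ B hB (fun k hk l hl => hφ k (hk.trans (le_max_right _ _)) l
    (hl.trans (le_max_right _ _))) t
  rw [pow_zero, one_mul] at e0
  have h2 : (1 + ‖t‖) ^ N ≤ 2 ^ N * (1 + ‖t‖ ^ N) := by
    calc (1 + ‖t‖) ^ N ≤ (2 * max 1 ‖t‖) ^ N := by
          gcongr
          linarith [le_max_left 1 ‖t‖, le_max_right 1 ‖t‖]
      _ = 2 ^ N * (max 1 ‖t‖) ^ N := mul_pow _ _ _
      _ ≤ _ := by
          gcongr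
          rcases max_cases 1 ‖t‖ with ⟨h, -⟩ | ⟨h, -⟩ <;> rw [h]
          · simp
          · linarith
  calc _ ≤ 2 ^ N * (1 + ‖t‖ ^ N) * ‖𝓕 (φ : F → ℂ) t‖ := by gcongr
    _ = 2 ^ N * (‖𝓕 (φ : F → ℂ) t‖ + ‖t‖ ^ N * ‖𝓕 (φ : F → ℂ) t‖) := by ring
    _ ≤ 2 ^ N * (C₀ * B + C₁ * B) := by gcongr
    _ = _ := by ring

end FourierDecay

end QuadraticCR

namespace QuadraticCR

noncomputable section

set_option linter.unusedSectionVars false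

/-! ### Band-limited functions and their Fourier transforms -/

section Band

variable {F : Type*} [NormedAddCommGroup F] [InnerProductSpace ℝ F]

/-- The character `ξ ↦ exp (2 π i ⟪ξ, x⟫)`. -/
def eChar (x ξ : F) : ℂ := Complex.exp (((2 * Real.pi * inner ℝ ξ x : ℝ) : ℂ) * Complex.I)

theorem eChar_comm (x ξ : F) : eChar x ξ = eChar ξ x := by
  simp [eChar, real_inner_comm]

theorem norm_eChar (x ξ : F) : ‖eChar x ξ‖ = 1 := Complex.norm_exp_ofReal_mul_I _

theorem eChar_add (x y ξ : F) : eChar (x + y) ξ = eChar x ξ * eChar y ξ := by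
  simp only [eChar, ← Complex.exp_add, inner_add_right]
  congr 1; push_cast; ring

theorem eChar_zero (ξ : F) : eChar 0 ξ = 1 := by simp [eChar]

theorem contDiff_eChar_uncurry : ContDiff ℝ ∞ (fun q : F × F => eChar q.1 q.2) := by
  unfold eChar
  refine ContDiff.cexp (ContDiff.mul (Complex.ofRealCLM.contDiff.comp ?_) contDiff_const)
  exact contDiff_const.mul (contDiff_snd.inner ℝ contDiff_fst)

theorem contDiff_eChar (x : F) : ContDiff ℝ ∞ (eChar x) :=
  contDiff_eChar_uncurry.comp (contDiff_const.prodMk contDiff_id)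

theorem continuous_eChar_uncurry : Continuous (fun q : F × F => eChar q.1 q.2) :=
  contDiff_eChar_uncurry.continuous

variable [FiniteDimensional ℝ F] [MeasurableSpace F] [BorelSpace F]

theorem fourier_eq_integral_eChar (a : F → ℂ) (t : F) : 𝓕 a t = ∫ ξ, eChar (-t) ξ * a ξ := by
  rw [Real.fourier_eq']
  congr 1; ext ξ
  simp only [eChar, inner_neg_right, smul_eq_mul]
  congr 3; push_cast; ring

theorem fourierInv_eq_integral_eChar (a : F → ℂ) (t : F) : 𝓕⁻ a t = ∫ ξ, eChar t ξ * a ξ := by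
  rw [Real.fourierInv_eq']
  rfl

theorem fourier_eChar_mul (a : F → ℂ) (x t : F) :
    𝓕 (fun ξ => eChar x ξ * a ξ) t = 𝓕 a (t - x) := by
  simp only [fourier_eq_integral_eChar, ← mul_assoc, ← eChar_add]
  congr 2; ext ξ; congr 2; abel

theorem fourier_mul_eChar (a : F → ℂ) (x t : F) :
    𝓕 (fun ξ => a ξ * eChar x ξ) t = 𝓕 a (t - x) := by
  rw [← fourier_eChar_mul]; simp only [mul_comm]

theorem integrable_inv_one_add_norm_pow {N : ℕ} (hN : Module.finrank ℝ F < N) :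
    Integrable (fun x : F => ((1 + ‖x‖) ^ N)⁻¹) := by
  have := integrable_one_add_norm (μ := (volume : Measure F)) (r := (N : ℝ))
    (by exact_mod_cast hN)
  refine this.congr (ae_of_all _ fun x => ?_)
  simp only
  rw [Real.rpow_neg (by positivity), Real.rpow_natCast]

theorem integrable_mul_of_decay {g k : F → ℂ} (hg : Continuous g) (hk : Continuous k)
    {C B : ℝ} {M N : ℕ} (hgC : ∀ x, ‖g x‖ ≤ C * (1 + ‖x‖) ^ M)
    (hkB : ∀ x, (1 + ‖x‖) ^ N * ‖k x‖ ≤ B) (hN : M + Module.finrank ℝ F < N) :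
    Integrable (fun x => g x * k x) := by
  refine ((integrable_inv_one_add_norm_pow (F := F) (N := N - M) (by omega)).const_mul
    (C * B)).mono' (hg.mul hk).aestronglyMeasurable (ae_of_all _ fun x => ?_)
  have h1 : 0 < 1 + ‖x‖ := by positivity
  rw [norm_mul]
  have hB : 0 ≤ B := le_trans (by positivity) (hkB x)
  have hk' : ‖k x‖ ≤ B * ((1 + ‖x‖) ^ N)⁻¹ := by
    rw [← div_eq_mul_inv, le_div_iff₀ (by positivity), mul_comm]; exact hkB x
  have hC : 0 ≤ C := by
    have := (norm_nonneg _).trans (hgC x)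
    by_contra h
    have : C * (1 + ‖x‖) ^ M < 0 := mul_neg_of_neg_of_pos (not_le.1 h) (by positivity)
    linarith
  calc ‖g x‖ * ‖k x‖ ≤ C * (1 + ‖x‖) ^ M * (B * ((1 + ‖x‖) ^ N)⁻¹) := by
        gcongr; exact hgC x
    _ = C * B * ((1 + ‖x‖) ^ (N - M))⁻¹ := by
        have : (1 + ‖x‖) ^ N = (1 + ‖x‖) ^ M * (1 + ‖x‖) ^ (N - M) := by
          rw [← pow_add]; congr 1; omega
        rw [this]; field_simp

theorem schwartz_one_add_decay (φ : 𝓢(F, ℂ)) (N : ℕ) :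
    ∃ B, 0 ≤ B ∧ ∀ x, (1 + ‖x‖) ^ N * ‖φ x‖ ≤ B := by
  refine ⟨2 ^ N * (Finset.Iic (N, 0)).sup (fun m => SchwartzMap.seminorm ℂ m.1 m.2) φ,
    by positivity, fun x => ?_⟩
  have := SchwartzMap.one_add_le_sup_seminorm_apply (𝕜 := ℂ) (m := (N, 0)) le_rfl le_rfl φ x
  rwa [norm_iteratedFDeriv_zero] at this

theorem integrable_mul_schwartz {g : F → ℂ} (hg : Continuous g) {C : ℝ} {M : ℕ}
    (hgC : ∀ x, ‖g x‖ ≤ C * (1 + ‖x‖) ^ M) (φ : 𝓢(F, ℂ)) :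
    Integrable (fun x => g x * φ x) := by
  obtain ⟨B, -, hB⟩ := schwartz_one_add_decay φ (M + Module.finrank ℝ F + 1)
  exact integrable_mul_of_decay hg φ.continuous hgC hB (by omega)

/-- `g` is a continuous function of polynomial growth whose Fourier transform is the tempered
distribution `S`, supported in `K`. -/
structure Band (K : Set F) (g : F → ℂ) (S : 𝓢'(F, ℂ)) : Prop where
  cont : Continuous g
  growth : ∃ C : ℝ, 0 ≤ C ∧ ∃ M : ℕ, ∀ x, ‖g x‖ ≤ C * (1 + ‖x‖) ^ M
  pair : ∀ a : 𝓢(F, ℂ), S a = ∫ t, g t * 𝓕 (a : F → ℂ) t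
  supp : ∀ a : 𝓢(F, ℂ), Disjoint (tsupport a) K → S a = 0
  repr : ∀ a : 𝓢(F, ℂ), ∀ x : F, (∃ O, IsOpen O ∧ K ⊆ O ∧ ∀ ξ ∈ O, a ξ = eChar x ξ) → g x = S a

/-- The difference vanishes on `O`, so its closed support misses `K`. This is what allows cutoffs
equal to `1` near `K` to be inserted and removed. -/
theorem eq_of_eqOn_nhds {S : 𝓢'(F, ℂ)} {K O : Set F}
    (supp : ∀ a : 𝓢(F, ℂ), Disjoint (tsupport a) K → S a = 0) {a b : 𝓢(F, ℂ)}
    (hO : IsOpen O) (hKO : K ⊆ O) (h : ∀ ξ ∈ O, a ξ = b ξ) : S a = S b := by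
  have h1 : S (a - b) = 0 := by
    refine supp _ (Set.disjoint_left.2 fun ξ hξ hK => ?_)
    have : tsupport (a - b : 𝓢(F, ℂ)) ⊆ Oᶜ := by
      refine closure_minimal (fun y hy hyO => hy ?_) hO.isClosed_compl
      change a y - b y = 0
      rw [h y hyO, sub_self]
    exact this hξ (hKO hK)
  rwa [map_sub, sub_eq_zero] at h1

/-- The support only provides a vanishing neighbourhood of each point outside it. A partition of
unity glues these for compactly supported `a`, and density of such functions does the rest. -/
theorem eq_zero_of_disjoint_dsupport {S : 𝓢'(F, ℂ)} (a : 𝓢(F, ℂ))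
    (h : Disjoint (tsupport a) (Distribution.dsupport S)) : S a = 0 := by
  have hcs : ∀ a : 𝓢(F, ℂ), HasCompactSupport a →
      Disjoint (tsupport a) (Distribution.dsupport S) → S a = 0 := by
    intro a ha hd
    have h1 : ∀ x : F, ∃ U : Set F, IsOpen U ∧ Distribution.IsVanishingOn S U ∧
        (x ∈ tsupport a → x ∈ U) := by
      intro x
      by_cases hx : x ∈ tsupport a
      · obtain ⟨U, h1, h2, h3⟩ :=
          (Distribution.notMem_dsupport_iff x).1 (Set.disjoint_left.1 hd hx)
        exact ⟨U, h2, h1, fun _ => h3⟩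
      · refine ⟨∅, isOpen_empty, fun u hu => ?_, fun h => absurd h hx⟩
        have : u = 0 := by
          ext y
          exact image_eq_zero_of_notMem_tsupport fun hy => hu hy
        rw [this, map_zero]
    choose U hUo hUv hU using h1
    obtain ⟨t, -, ht⟩ := ha.isCompact.elim_nhds_subcover U
      fun x hx => (hUo x).mem_nhds (hU x hx)
    obtain ⟨ρ, hρ⟩ := SmoothPartitionOfUnity.exists_isSubordinate
      (modelWithCornersSelf ℝ F) (isClosed_tsupport a) (fun i : t => U i) (fun i => hUo i)
      (by simpa [Set.iUnion_subtype] using ht)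
    have hρs : ∀ i : t, ContDiff ℝ ∞ (fun x => ((ρ i x : ℝ) : ℂ)) := fun i =>
      Complex.ofRealCLM.contDiff.comp (ρ i).contMDiff.contDiff
    let A : t → 𝓢(F, ℂ) := fun i =>
      (ha.mul_left (f := fun x => ((ρ i x : ℝ) : ℂ))).toSchwartzMap
        ((hρs i).mul (a.smooth ⊤))
    have hA : ∀ i x, A i x = ((ρ i x : ℝ) : ℂ) * a x := fun i x => rfl
    have hsum : a = ∑ i, A i := by
      ext x
      rw [sum_apply]
      simp only [hA, ← Finset.sum_mul]
      by_cases hx : x ∈ tsupport a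
      · have := ρ.sum_eq_one hx
        rw [finsum_eq_sum_of_fintype] at this
        rw [← Complex.ofReal_sum, this]; simp
      · rw [image_eq_zero_of_notMem_tsupport hx, mul_zero]
    rw [hsum, map_sum]
    refine Finset.sum_eq_zero fun i _ => hUv i _ ?_
    refine (closure_mono fun x hx => ?_).trans (hρ i)
    simp only [Function.mem_support, hA, ne_eq, mul_eq_zero, not_or] at hx
    exact fun h => hx.1 (by simp [h])
  obtain ⟨A, h1, h2, -, -, h5⟩ := exists_tendsto_cutoff a
  have h6 : Tendsto (fun n => S (A n)) atTop (𝓝 (S a)) :=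
    ((S : 𝓢(F, ℂ) →L[ℂ] ℂ).continuous.tendsto a).comp h5
  have h7 : ∀ n, S (A n) = 0 := fun n => hcs _ (h1 n) (h.mono_left (h2 n))
  simp only [h7] at h6
  exact (tendsto_nhds_unique h6 tendsto_const_nhds)

theorem integral_eq_smul_integral_comp (f : F → ℂ) (x : F) {ε : ℝ} (hε : 0 < ε) :
    ∫ y, f y = ((ε ^ Module.finrank ℝ F : ℝ) : ℂ) * ∫ y, f (x + ε • y) := by
  have h1 := Measure.integral_comp_smul_of_nonneg (volume : Measure F) (fun y => f (x + y)) ε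
    (hR := hε.le)
  rw [h1, integral_add_left_eq_self f x, Complex.real_smul, ← mul_assoc, ← Complex.ofReal_mul,
    mul_inv_cancel₀ (by positivity)]
  simp

/-- Test `u` on a bump concentrated at `x` at scale `ε`. On the function side this tends to a
multiple of `g x`. On the Fourier side the bump is the character at `x` times a dilated Schwartz
function which flattens as `ε → 0`; the cutoff `ψ` makes the convergence take place in the Schwartz
space. -/
theorem repr_of_represents {u : 𝓢'(F, ℂ)} {g : F → ℂ} (hg : Continuous g)
    (hu : Represents volume u g) {K : Set F}
    (supp : ∀ a : 𝓢(F, ℂ), Disjoint (tsupport a) K → (𝓕 u : 𝓢'(F, ℂ)) a = 0)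
    {ψ : F → ℂ} (hψ : ContDiff ℝ ∞ ψ) (hψs : HasCompactSupport ψ)
    (hψ1 : ∃ O, IsOpen O ∧ K ⊆ O ∧ ∀ ξ ∈ O, ψ ξ = 1) (a : 𝓢(F, ℂ)) (x : F)
    (ha : ∀ ξ, a ξ = ψ ξ * eChar x ξ) : g x = (𝓕 u : 𝓢'(F, ℂ)) a := by
  obtain ⟨O, hO, hKO, hO1⟩ := hψ1
  obtain ⟨c, hc, hcs, -, ⟨O', hO', hKO', hO1'⟩, hc01⟩ :=
    exists_smooth_bump (isCompact_singleton (x := (0 : F))) isOpen_univ (Set.subset_univ _)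
  have hcc : ContDiff ℝ ∞ (fun x => (c x : ℂ)) := Complex.ofRealCLM.contDiff.comp hc
  have hccs : HasCompactSupport (fun x => (c x : ℂ)) :=
    hcs.comp_left (g := fun t : ℝ => (t : ℂ)) (by simp)
  let φ : 𝓢(F, ℂ) := hccs.toSchwartzMap hcc
  have hφ : ∀ y, φ y = (c y : ℂ) := fun y => rfl
  have hint : ∫ y, φ y ≠ 0 := by
    simp only [hφ]
    rw [integral_complex_ofReal]
    have : 0 < ∫ y, c y := hc.continuous.integral_pos_of_hasCompactSupport_nonneg_nonzero hcs
      (fun y => (hc01 y).1) (x := 0) (by rw [hO1' 0 (hKO' rfl)]; exact one_ne_zero)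
    exact_mod_cast this.ne'
  have hsm : ContDiff ℝ ∞ (fun q : ℝ × F =>
      ψ q.2 * eChar x q.2 * (𝓕⁻ φ : 𝓢(F, ℂ)) (q.1 • q.2)) := by
    refine ContDiff.mul (ContDiff.mul ?_ ?_) ?_
    · exact hψ.comp contDiff_snd
    · exact (contDiff_eChar x).comp contDiff_snd
    · exact ((𝓕⁻ φ : 𝓢(F, ℂ)).smooth ⊤).comp (contDiff_fst.smul contDiff_snd)
  let A : ℝ → 𝓢(F, ℂ) := fun ε =>
    HasCompactSupport.toSchwartzMap
      (f := fun ξ => ψ ξ * eChar x ξ * (𝓕⁻ φ : 𝓢(F, ℂ)) (ε • ξ))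
      ((hψs.mul_right).mul_right) (hsm.comp (contDiff_const.prodMk contDiff_id))
  have hA : ∀ ε ξ, A ε ξ = ψ ξ * eChar x ξ * (𝓕⁻ φ : 𝓢(F, ℂ)) (ε • ξ) := fun _ _ => rfl
  have hAc : Continuous A := continuous_schwartz_of_contDiff hsm hψs.isCompact
    (fun z ξ hξ => by simp [image_eq_zero_of_notMem_tsupport hξ]) hA
  have hSc : Continuous fun ε => (𝓕 u : 𝓢'(F, ℂ)) (A ε) :=
    ((𝓕 u : 𝓢'(F, ℂ)) : 𝓢(F, ℂ) →L[ℂ] ℂ).continuous.comp hAc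
  have hGc : Continuous fun ε : ℝ => ∫ y, φ y * g (x + ε • y) := by
    have h1 : ∀ ε : ℝ, ∫ y, φ y * g (x + ε • y) =
        ∫ y in tsupport φ, φ y * g (x + ε • y) := fun ε => by
      rw [setIntegral_eq_integral_of_forall_compl_eq_zero]
      intro y hy
      rw [image_eq_zero_of_notMem_tsupport hy, zero_mul]
    simp only [h1]
    refine continuous_parametric_integral_of_continuous (f := fun (ε : ℝ) y =>
      φ y * g (x + ε • y)) ?_ hccs.isCompact
    have := φ.continuous
    simp only [Function.uncurry_def]
    fun_prop
  have hpos : ∀ ε : ℝ, 0 < ε → ∫ y, φ y * g (x + ε • y) = (𝓕 u : 𝓢'(F, ℂ)) (A ε) := by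
    intro ε hε
    have hcε : ContDiff ℝ ∞ (fun y => (c (ε⁻¹ • (y - x)) : ℂ)) :=
      hcc.comp (contDiff_const.smul (contDiff_id.sub contDiff_const))
    have hcεs : HasCompactSupport (fun y => (c (ε⁻¹ • (y - x)) : ℂ)) :=
      hccs.comp_homeomorph
        ((Homeomorph.subRight x).trans (Homeomorph.smulOfNeZero ε⁻¹ (inv_pos.2 hε).ne'))
    let B : 𝓢(F, ℂ) := hcεs.toSchwartzMap hcε
    have hB : ∀ y, B (x + ε • y) = φ y := by
      intro y
      change ((c (ε⁻¹ • (x + ε • y - x)) : ℝ) : ℂ) = c y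
      rw [add_sub_cancel_left, smul_smul, inv_mul_cancel₀ hε.ne', one_smul]
    set J : ℂ := ((ε ^ Module.finrank ℝ F : ℝ) : ℂ)
    have hJ : J ≠ 0 := by
      simp only [J, ne_eq, Complex.ofReal_eq_zero]; positivity
    have h1 : u B = J * ∫ y, φ y * g (x + ε • y) := by
      rw [hu B hcεs, integral_eq_smul_integral_comp _ x hε]
      simp only [hB, J]
    have h2 : ∀ ξ, (𝓕⁻ B : 𝓢(F, ℂ)) ξ = J * (eChar x ξ * (𝓕⁻ φ : 𝓢(F, ℂ)) (ε • ξ)) := by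
      intro ξ
      rw [SchwartzMap.fourierInv_coe, SchwartzMap.fourierInv_coe, fourierInv_eq_integral_eChar,
        fourierInv_eq_integral_eChar, integral_eq_smul_integral_comp _ x hε,
        ← integral_const_mul (eChar x ξ)]
      simp only [hB, J]
      congr 2; ext y
      have : eChar ξ (ε • y) = eChar (ε • ξ) y := by
        simp [eChar, real_inner_smul_left, real_inner_smul_right]
      rw [eChar_comm ξ, eChar_add, eChar_comm (ε • y) ξ, this]
      ring
    have h3 : u B = J * (𝓕 u : 𝓢'(F, ℂ)) (A ε) := by
      have h4 : u B = (𝓕 u : 𝓢'(F, ℂ)) (𝓕⁻ B) := by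
        rw [TemperedDistribution.fourier_apply, FourierTransform.fourier_fourierInv_eq]
      have h5 : J * (𝓕 u : 𝓢'(F, ℂ)) (A ε) = (𝓕 u : 𝓢'(F, ℂ)) (J • A ε) := by
        rw [map_smul, smul_eq_mul]
      rw [h4, h5]
      refine eq_of_eqOn_nhds supp hO hKO fun ξ hξ => ?_
      rw [h2]
      change _ = J * A ε ξ
      rw [hA, hO1 ξ hξ]; ring
    exact mul_left_cancel₀ hJ (h1.symm.trans h3)
  -- Both sides are continuous in `ε` on the whole line, so the identity for `ε > 0` extends to `ε =
  -- 0`.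
  have h0 : ∫ y, φ y * g (x + (0 : ℝ) • y) = (𝓕 u : 𝓢'(F, ℂ)) (A 0) := by
    have hcl : (0 : ℝ) ∈ closure (Set.Ioi (0 : ℝ)) := by simp
    exact Set.EqOn.closure (s := Set.Ioi (0 : ℝ)) (fun ε hε => hpos ε hε) hGc hSc hcl
  have hA0 : A 0 = (∫ y, φ y) • a := by
    ext ξ
    rw [hA]
    change _ = (∫ y, φ y) * a ξ
    rw [ha, zero_smul, SchwartzMap.fourierInv_coe, fourierInv_eq_integral_eChar]
    simp only [eChar_zero, one_mul]
    ring
  rw [hA0, map_smul, smul_eq_mul] at h0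
  simp only [zero_smul, add_zero] at h0
  rw [integral_mul_const] at h0
  exact mul_left_cancel₀ hint h0

theorem fourier_translate (a b : 𝓢(F, ℂ)) (x : F) (h : ∀ ξ, b ξ = a ξ * eChar x ξ) :
    (𝓕 b : 𝓢(F, ℂ)) = (𝓕 a : 𝓢(F, ℂ)).compSubConstCLM ℂ x := by
  ext t
  rw [SchwartzMap.compSubConstCLM_apply, SchwartzMap.fourier_coe, SchwartzMap.fourier_coe,
    ← fourier_mul_eChar, ← (funext h : (b : F → ℂ) = fun ξ => a ξ * eChar x ξ)]

/-- By `repr_of_represents`, `g x` is `u` evaluated on a translate of one fixed Schwartz function,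
hence grows polynomially. Dominated convergence then extends the integral formula from compactly
supported to all test functions. -/
theorem band_of_represents {u : 𝓢'(F, ℂ)} {g : F → ℂ} (hg : Continuous g)
    (hu : Represents volume u g) {K : Set F} (hK : IsCompact K)
    (hsub : Distribution.dsupport (𝓕 u : 𝓢'(F, ℂ)) ⊆ K) :
    Band K g (𝓕 u : 𝓢'(F, ℂ)) ∧ ∀ φ : 𝓢(F, ℂ), u φ = ∫ x, φ x * g x := by
  have supp : ∀ a : 𝓢(F, ℂ), Disjoint (tsupport a) K → (𝓕 u : 𝓢'(F, ℂ)) a = 0 :=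
    fun a ha => eq_zero_of_disjoint_dsupport a (ha.mono_right hsub)
  obtain ⟨ψ₀, hψ₀, hψ₀s, -, hψ1, -⟩ := exists_smooth_bump hK isOpen_univ (Set.subset_univ _)
  have hψ : ContDiff ℝ ∞ (fun x => (ψ₀ x : ℂ)) := Complex.ofRealCLM.contDiff.comp hψ₀
  have hψs : HasCompactSupport (fun x => (ψ₀ x : ℂ)) :=
    hψ₀s.comp_left (g := fun t : ℝ => (t : ℂ)) (by simp)
  have hψ1' : ∃ O, IsOpen O ∧ K ⊆ O ∧ ∀ ξ ∈ O, (ψ₀ ξ : ℂ) = 1 := by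
    obtain ⟨O, h1, h2, h3⟩ := hψ1
    exact ⟨O, h1, h2, fun ξ hξ => by rw [h3 ξ hξ]; simp⟩
  let ψ : 𝓢(F, ℂ) := hψs.toSchwartzMap hψ
  let A : F → 𝓢(F, ℂ) := fun x => HasCompactSupport.toSchwartzMap
    (f := fun ξ => (ψ₀ ξ : ℂ) * eChar x ξ) hψs.mul_right (hψ.mul (contDiff_eChar x))
  have hA : ∀ x ξ, A x ξ = (ψ₀ ξ : ℂ) * eChar x ξ := fun _ _ => rfl
  have hgA : ∀ x, g x = (𝓕 u : 𝓢'(F, ℂ)) (A x) := fun x =>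
    repr_of_represents hg hu supp hψ hψs hψ1' (A x) x (hA x)
  have growth : ∃ C : ℝ, 0 ≤ C ∧ ∃ M : ℕ, ∀ x, ‖g x‖ ≤ C * (1 + ‖x‖) ^ M := by
    obtain ⟨C, hC, M, h⟩ := temperedDistribution_translate_bound u (𝓕 ψ)
    refine ⟨C, hC, M, fun x => ?_⟩
    rw [hgA, TemperedDistribution.fourier_apply, fourier_translate ψ (A x) x (hA x)]
    exact h x
  obtain ⟨C, hC, M, hgC⟩ := growth
  have hall : ∀ φ : 𝓢(F, ℂ), u φ = ∫ x, φ x * g x := by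
    intro φ
    obtain ⟨A, h1, -, h3, h4, h5⟩ := exists_tendsto_cutoff φ
    have h6 : Tendsto (fun n => u (A n)) atTop (𝓝 (u φ)) :=
      ((u : 𝓢(F, ℂ) →L[ℂ] ℂ).continuous.tendsto φ).comp h5
    have h7 : Tendsto (fun n => ∫ x, A n x * g x) atTop (𝓝 (∫ x, φ x * g x)) := by
      refine tendsto_integral_of_dominated_convergence (fun x => ‖g x * φ x‖) (fun n => ?_)
        (integrable_mul_schwartz hg hgC φ).norm (fun n => ae_of_all _ fun x => ?_)
        (ae_of_all _ fun x => (h4 x).mul_const _)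
      · exact ((A n).continuous.mul hg).aestronglyMeasurable
      · rw [norm_mul, norm_mul, mul_comm]
        gcongr
        exact h3 n x
    have h8 : (fun n => u (A n)) = fun n => ∫ x, A n x * g x := funext fun n => hu _ (h1 n)
    rw [h8] at h6
    exact tendsto_nhds_unique h6 h7
  refine ⟨⟨hg, ⟨C, hC, M, hgC⟩, fun a => ?_, supp, fun a x ha => ?_⟩, hall⟩
  · rw [TemperedDistribution.fourier_apply, hall]
    simp only [mul_comm]
    rfl
  · obtain ⟨O, hO, hKO, h⟩ := ha
    obtain ⟨O', hO', hKO', h'⟩ := hψ1'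
    rw [hgA]
    refine eq_of_eqOn_nhds supp (hO.inter hO') (Set.subset_inter hKO hKO') fun ξ hξ => ?_
    rw [hA, h ξ hξ.1, h' ξ hξ.2, one_mul]

end Band

end

end QuadraticCR

namespace QuadraticCR

noncomputable section

open scoped Pointwise

set_option linter.unusedSectionVars false

/-! ### Weighted `L^p` estimates on a single slice -/

section LpBound

variable {F : Type*} [NormedAddCommGroup F] [InnerProductSpace ℝ F] [FiniteDimensional ℝ F]
  [MeasurableSpace F] [BorelSpace F]

/-- The weight `(1 + ‖t‖)⁻ᴺ`. -/
def decayWeight (N : ℕ) (t : F) : ℝ≥0∞ := ENNReal.ofReal (((1 + ‖t‖) ^ N)⁻¹)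

theorem measurable_decayWeight (N : ℕ) : Measurable (decayWeight N : F → ℝ≥0∞) := by
  unfold decayWeight; fun_prop

theorem decayWeight_le_one (N : ℕ) (t : F) : decayWeight N t ≤ 1 := by
  unfold decayWeight
  rw [← ENNReal.ofReal_one]
  exact ENNReal.ofReal_le_ofReal (inv_le_one_of_one_le₀ (one_le_pow₀ (by simp)))

theorem lintegral_decayWeight_ne_top {N : ℕ} (hN : Module.finrank ℝ F < N) :
    ∫⁻ t : F, decayWeight N t ≠ ⊤ := by
  have := (integrable_inv_one_add_norm_pow (F := F) hN).lintegral_lt_top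
  exact this.ne

theorem lintegral_decayWeight_rpow_ne_top {N : ℕ} {s : ℝ} (hs : 0 < s)
    (hN : (Module.finrank ℝ F : ℝ) < N * s) :
    ∫⁻ t : F, decayWeight N t ^ s ≠ ⊤ := by
  have h := (integrable_one_add_norm (μ := (volume : Measure F)) hN).lintegral_lt_top
  convert h.ne using 3 with t
  unfold decayWeight
  rw [ENNReal.ofReal_rpow_of_nonneg (by positivity) hs.le, Real.inv_rpow (by positivity),
    ← Real.rpow_natCast, ← Real.rpow_mul (by positivity), Real.rpow_neg (by positivity)]

theorem enorm_fourier_le_decayWeight {a : F → ℂ} {B : ℝ} {N : ℕ}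
    (h : ∀ t, (1 + ‖t‖) ^ N * ‖𝓕 a t‖ ≤ B) (t : F) :
    ‖𝓕 a t‖ₑ ≤ ENNReal.ofReal B * decayWeight N t := by
  have hB : 0 ≤ B := le_trans (by positivity) (h 0)
  rw [decayWeight, ← ENNReal.ofReal_mul hB, ← ofReal_norm]
  refine ENNReal.ofReal_le_ofReal ?_
  rw [← div_eq_mul_inv, le_div_iff₀ (by positivity), mul_comm]
  exact h t

/-- Fourier inversion: `𝓕 G` is bounded by the `L¹` norm of `G` and lives on `Q`. -/
theorem norm_le_volume_mul_integral_of_fourier_support {G : F → ℂ} (hG : Continuous G)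
    (hGi : Integrable G) {Q : Set F} (hQ : IsCompact Q) (hs : ∀ η ∉ Q, 𝓕 G η = 0) (t : F) :
    ‖G t‖ₑ ≤ volume Q * ∫⁻ s, ‖G s‖ₑ := by
  have hc : Continuous (𝓕 G) := by
    have := VectorFourier.fourierIntegral_continuous (e := Real.fourierChar) (μ := volume)
      (L := innerₗ F) Real.continuous_fourierChar (by exact continuous_inner) hGi
    exact this
  have hcs : HasCompactSupport (𝓕 G) := HasCompactSupport.intro hQ hs
  have hi : Integrable (𝓕 G) := hc.integrable_of_hasCompactSupport hcs
  have h1 : 𝓕⁻ (𝓕 G) = G := hG.fourierInv_fourier_eq hGi hi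
  have hle : ∀ η, ‖𝓕 G η‖ₑ ≤ ∫⁻ s, ‖G s‖ₑ := by
    intro η
    rw [fourier_eq_integral_eChar]
    refine (enorm_integral_le_lintegral_enorm _).trans (lintegral_mono fun s => ?_)
    rw [enorm_mul, ← ofReal_norm (eChar _ _), norm_eChar]
    simp
  calc ‖G t‖ₑ = ‖∫ ξ, eChar t ξ * 𝓕 G ξ‖ₑ := by
        conv_lhs => rw [← h1, fourierInv_eq_integral_eChar]
    _ ≤ ∫⁻ ξ, ‖𝓕 G ξ‖ₑ := by
        refine (enorm_integral_le_lintegral_enorm _).trans (lintegral_mono fun s => ?_)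
        rw [enorm_mul, ← ofReal_norm (eChar _ _), norm_eChar]
        simp
    _ = ∫⁻ ξ in Q, ‖𝓕 G ξ‖ₑ := by
        rw [setLIntegral_eq_of_support_subset]
        intro ξ hξ
        by_contra h
        exact hξ (by simp [hs ξ h])
    _ ≤ ∫⁻ ξ in Q, ∫⁻ s, ‖G s‖ₑ := lintegral_mono fun ξ => hle ξ
    _ = _ := by rw [lintegral_const, Measure.restrict_apply_univ, mul_comm]

/-- Nikolskii's inequality for functions with compactly supported Fourier transform. -/
theorem lintegral_rpow_le_of_fourier_support {G : F → ℂ} (hG : Continuous G)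
    (hGi : Integrable G) {Q : Set F} (hQ : IsCompact Q) (hs : ∀ η ∉ Q, 𝓕 G η = 0)
    {p : ℝ} (hp0 : 0 < p) (hp1 : p ≤ 1) :
    (∫⁻ s, ‖G s‖ₑ) ^ p ≤ volume Q ^ (1 - p) * ∫⁻ s, ‖G s‖ₑ ^ p := by
  set J := ∫⁻ s, ‖G s‖ₑ with hJ
  have hJt : J ≠ ⊤ := hGi.2.ne
  by_cases hJ0 : J = 0
  · rw [hJ0, ENNReal.zero_rpow_of_pos hp0]; exact zero_le
  have hsup := norm_le_volume_mul_integral_of_fourier_support hG hGi hQ hs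
  -- Split `|G| = |G|^(1-p) |G|^p` and use the sup bound on the first factor; `J ^ (1 - p)`, finite
  -- and nonzero, is then cancelled.
  have h1 : J ≤ (volume Q * J) ^ (1 - p) * ∫⁻ s, ‖G s‖ₑ ^ p := by
    rw [← lintegral_const_mul' _ _ (ENNReal.rpow_ne_top_of_nonneg (by linarith)
      (ENNReal.mul_ne_top hQ.measure_lt_top.ne hJt))]
    refine lintegral_mono fun s => ?_
    calc ‖G s‖ₑ = ‖G s‖ₑ ^ (1 - p) * ‖G s‖ₑ ^ p := by
          rw [← ENNReal.rpow_add_of_nonneg _ _ (by linarith) hp0.le]; simp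
      _ ≤ _ := by
          gcongr
          exact hsup s
  rw [ENNReal.mul_rpow_of_nonneg _ _ (by linarith)] at h1
  have h2 : J = J ^ (1 - p) * J ^ p := by
    rw [← ENNReal.rpow_add_of_nonneg _ _ (by linarith) hp0.le]; simp
  have hJp0 : J ^ (1 - p) ≠ 0 := by
    simp [ENNReal.rpow_eq_zero_iff, hJ0, hJt]
  have hJpt : J ^ (1 - p) ≠ ⊤ := ENNReal.rpow_ne_top_of_nonneg (by linarith) hJt
  rw [← ENNReal.mul_le_mul_iff_right hJp0 hJpt, ← h2]
  calc J ≤ _ := h1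
    _ = _ := by ring

theorem Band.apply_eq_integral {K : Set F} {g : F → ℂ} {S : 𝓢'(F, ℂ)} (h : Band K g S)
    {a b : 𝓢(F, ℂ)} {x : F} (hab : ∀ ξ, b ξ = a ξ * eChar x ξ) :
    S b = ∫ t, g t * 𝓕 (a : F → ℂ) (t - x) := by
  rw [h.pair, (funext hab : (b : F → ℂ) = fun ξ => a ξ * eChar x ξ)]
  simp only [fourier_mul_eChar]

theorem Band.enorm_apply_le {K : Set F} {g : F → ℂ} {S : 𝓢'(F, ℂ)} (h : Band K g S)
    {a b : 𝓢(F, ℂ)} {x : F} (hab : ∀ ξ, b ξ = a ξ * eChar x ξ) :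
    ‖S b‖ₑ ≤ ∫⁻ t, ‖g t * 𝓕 (a : F → ℂ) (t - x)‖ₑ := by
  rw [h.apply_eq_integral hab]
  exact enorm_integral_le_lintegral_enorm _

/-- The value at `η` is `S` tested on the translate of `b` by `η`, whose support meets `K` only if
`η` is a difference of a point of `K` and one of `K'`. -/
theorem Band.fourier_mul_eq_zero {K K' : Set F} {g : F → ℂ} {S : 𝓢'(F, ℂ)} (h : Band K g S)
    {b : 𝓢(F, ℂ)} (hb : tsupport b ⊆ K') (hK' : IsClosed K') (η : F) (hη : η ∉ K - K') :
    𝓕 (fun t => g t * 𝓕 (b : F → ℂ) t) η = 0 := by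
  set c : 𝓢(F, ℂ) := b.compSubConstCLM ℂ η
  have hc : ∀ ξ, c ξ = b (ξ - η) := fun ξ => rfl
  have h1 : ∀ t, 𝓕 (c : F → ℂ) t = eChar (-η) t * 𝓕 (b : F → ℂ) t := by
    intro t
    rw [fourier_eq_integral_eChar, fourier_eq_integral_eChar,
      ← integral_add_right_eq_self _ η, ← integral_const_mul]
    congr 1; ext ξ
    rw [hc, add_sub_cancel_right, eChar_comm, eChar_add, eChar_comm ξ, ← mul_assoc,
      mul_comm (eChar (-t) ξ)]
    congr 2
    simp [eChar, real_inner_comm]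
  have h2 : S c = 0 := by
    refine h.supp c (Set.disjoint_left.2 fun ξ hξ hξK => hη ?_)
    have hsub : tsupport c ⊆ (fun ξ => ξ - η) ⁻¹' K' := by
      refine closure_minimal (fun ξ hξ => hb (subset_tsupport _ ?_))
        (hK'.preimage (by fun_prop))
      exact hξ
    exact ⟨ξ, hξK, ξ - η, hsub hξ, by simp⟩
  rw [h.pair] at h2
  rw [fourier_eq_integral_eChar, ← h2]
  congr 1; ext t
  rw [h1]; ring

/-- `S b` is the integral of `g` against the translate by `x` of `𝓕 a`. For `p ≤ 1` Nikolskii's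
inequality moves the power `p` inside the integral, for `p > 1` Hölder does. A power of the weight
is kept in the integrand so that the estimate can later be integrated in `x`, and `W` does not
depend on `a`, `g` or `S`. -/
theorem Band.rpow_enorm_apply_le {K K' : Set F} (hK : IsCompact K) (hK' : IsCompact K')
    {p : ℝ} (hp : 0 < p) {N : ℕ} (hN : Module.finrank ℝ F < N) :
    ∃ W : ℝ≥0∞, W ≠ ⊤ ∧ ∀ (g : F → ℂ) (S : 𝓢'(F, ℂ)), Band K g S → ∀ (a b : 𝓢(F, ℂ)) (x : F),
      tsupport a ⊆ K' → (∀ ξ, b ξ = a ξ * eChar x ξ) → ∀ B : ℝ,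
      (∀ t, (1 + ‖t‖) ^ N * ‖𝓕 (a : F → ℂ) t‖ ≤ B) →
      ‖S b‖ₑ ^ p ≤ W * ENNReal.ofReal B ^ p *
        ∫⁻ t, ‖g t‖ₑ ^ p * decayWeight N (t - x) ^ (min p 1) := by
  have hQ : IsCompact (K - K') := by
    rw [sub_eq_add_neg]; exact hK.add hK'.neg
  set I : ℝ≥0∞ := ∫⁻ t : F, decayWeight N t
  have hI : I ≠ ⊤ := lintegral_decayWeight_ne_top hN
  rcases le_or_gt p 1 with hp1 | hp1
  · refine ⟨volume (K - K') ^ (1 - p),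
      ENNReal.rpow_ne_top_of_nonneg (by linarith) hQ.measure_lt_top.ne,
      fun g S h a b x ha hab B hB => ?_⟩
    have hb : tsupport b ⊆ K' := by
      refine (closure_mono fun ξ hξ => ?_).trans ha
      simp only [Function.mem_support, hab, ne_eq, mul_eq_zero, not_or] at hξ
      exact hξ.1
    have hFb : ∀ t, 𝓕 (b : F → ℂ) t = 𝓕 (a : F → ℂ) (t - x) := fun t => by
      rw [(funext hab : (b : F → ℂ) = fun ξ => a ξ * eChar x ξ), fourier_mul_eChar]
    have hcont : Continuous (fun t => g t * 𝓕 (b : F → ℂ) t) :=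
      h.cont.mul (𝓕 b : 𝓢(F, ℂ)).continuous
    have hint : Integrable (fun t => g t * 𝓕 (b : F → ℂ) t) := by
      obtain ⟨C, -, M, hg⟩ := h.growth
      exact integrable_mul_schwartz h.cont hg (𝓕 b)
    have h1 := lintegral_rpow_le_of_fourier_support hcont hint hQ
      (fun η hη => h.fourier_mul_eq_zero hb hK'.isClosed η hη) hp hp1
    have h2 := h.enorm_apply_le hab
    simp only [← hFb] at h2
    refine (ENNReal.rpow_le_rpow h2 hp.le).trans (h1.trans ?_)
    rw [mul_assoc, ← lintegral_const_mul' _ _ (ENNReal.rpow_ne_top_of_nonneg hp.le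
      ENNReal.ofReal_ne_top)]
    refine mul_le_mul_right (lintegral_mono fun t => ?_) _
    rw [min_eq_left hp1, hFb, enorm_mul, ENNReal.mul_rpow_of_nonneg _ _ hp.le, mul_left_comm]
    exact mul_le_mul_right ((ENNReal.rpow_le_rpow (enorm_fourier_le_decayWeight hB _)
      hp.le).trans_eq (ENNReal.mul_rpow_of_nonneg _ _ hp.le)) _
  · set q := p / (p - 1)
    have hpq : p.HolderConjugate q := Real.HolderConjugate.conjExponent hp1
    refine ⟨I ^ (1 / q * p), ENNReal.rpow_ne_top_of_nonneg
      (by have := hpq.symm.pos; positivity) hI, fun g S h a b x ha hab B hB => ?_⟩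
    have hmeas : Measurable fun t : F => decayWeight N (t - x) :=
      (measurable_decayWeight N).comp (measurable_id.sub_const x)
    have h1 : ‖S b‖ₑ ≤ ENNReal.ofReal B * ∫⁻ t, ‖g t‖ₑ * decayWeight N (t - x) := by
      refine (h.enorm_apply_le hab).trans ?_
      rw [← lintegral_const_mul' _ _ ENNReal.ofReal_ne_top]
      refine lintegral_mono fun t => ?_
      rw [enorm_mul, mul_left_comm]
      gcongr
      exact enorm_fourier_le_decayWeight hB _
    -- Hölder with the weight split as its `1/p` and `1/q` powers: one part stays with `g`, the
    -- other integrates to a constant.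
    have h2 : ∫⁻ t, ‖g t‖ₑ * decayWeight N (t - x) ≤
        (∫⁻ t, ‖g t‖ₑ ^ p * decayWeight N (t - x)) ^ (1 / p) * I ^ (1 / q) := by
      have hH := ENNReal.lintegral_mul_le_Lp_mul_Lq (volume : Measure F) hpq
        (f := fun t => ‖g t‖ₑ * decayWeight N (t - x) ^ (1 / p))
        (g := fun t => decayWeight N (t - x) ^ (1 / q))
        (h.cont.enorm.measurable.mul (hmeas.pow_const _)).aemeasurable
        (hmeas.pow_const _).aemeasurable
      have hI' : ∫⁻ t, (decayWeight N (t - x) ^ (1 / q)) ^ q = I := by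
        simp only [← ENNReal.rpow_mul, one_div_mul_cancel hpq.symm.ne_zero, ENNReal.rpow_one]
        exact lintegral_sub_right_eq_self (decayWeight N) x
      rw [hI'] at hH
      refine le_trans (le_of_eq ?_) (hH.trans (le_of_eq ?_))
      · congr 1; ext t
        simp only [Pi.mul_apply]
        rw [mul_assoc, ← ENNReal.rpow_add_of_nonneg _ _
          (by have := hpq.pos; positivity) (by have := hpq.symm.pos; positivity), one_div, one_div,
          hpq.inv_add_inv_eq_one, ENNReal.rpow_one]
      · congr 3; ext t
        rw [ENNReal.mul_rpow_of_nonneg _ _ hp.le, ← ENNReal.rpow_mul,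
          one_div_mul_cancel hp.ne', ENNReal.rpow_one]
    rw [min_eq_right hp1.le]
    simp only [ENNReal.rpow_one]
    calc ‖S b‖ₑ ^ p ≤ (ENNReal.ofReal B * ((∫⁻ t, ‖g t‖ₑ ^ p * decayWeight N (t - x)) ^ (1 / p)
          * I ^ (1 / q))) ^ p :=
          ENNReal.rpow_le_rpow (h1.trans (mul_le_mul_right h2 _)) hp.le
      _ = _ := by
          rw [ENNReal.mul_rpow_of_nonneg _ _ hp.le, ENNReal.mul_rpow_of_nonneg _ _ hp.le,
            ← ENNReal.rpow_mul, ← ENNReal.rpow_mul, one_div_mul_cancel hp.ne', ENNReal.rpow_one]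
          ring

theorem Band.enorm_apply_le_of_bounded {K : Set F} {N : ℕ} {g : F → ℂ} {S : 𝓢'(F, ℂ)}
    (h : Band K g S) {a b : 𝓢(F, ℂ)} {x : F} (hab : ∀ ξ, b ξ = a ξ * eChar x ξ) {B : ℝ}
    (hB : ∀ t, (1 + ‖t‖) ^ N * ‖𝓕 (a : F → ℂ) t‖ ≤ B) {c : ℝ≥0∞} (hc : ∀ t, ‖g t‖ₑ ≤ c) :
    ‖S b‖ₑ ≤ (∫⁻ t : F, decayWeight N t) * ENNReal.ofReal B * c := by
  refine (h.enorm_apply_le hab).trans ?_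
  calc _ ≤ ∫⁻ t, (ENNReal.ofReal B * c) * decayWeight N (t - x) := lintegral_mono fun t => by
        rw [enorm_mul, mul_comm, mul_right_comm]
        gcongr
        · exact enorm_fourier_le_decayWeight hB _
        · exact hc t
    _ = _ := by
        have hm : Measurable fun t : F => decayWeight N (t - x) :=
          (measurable_decayWeight N).comp (measurable_id.sub_const x)
        rw [lintegral_const_mul _ hm,
          lintegral_sub_right_eq_self (decayWeight N) x]
        ring

end LpBound

end

end QuadraticCR

namespace QuadraticCR

noncomputable section

open scoped Pointwise

set_option linter.unusedSectionVars false

/-! ### `L^p` estimates on the product -/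

section LpProd

variable {F : Type*} [NormedAddCommGroup F] [InnerProductSpace ℝ F] [FiniteDimensional ℝ F]
  [MeasurableSpace F] [BorelSpace F]
  {Z : Type*} [TopologicalSpace Z] [SecondCountableTopology Z] [MeasurableSpace Z] [BorelSpace Z]
  (ν : Measure Z) [SFinite ν] [ν.IsOpenPosMeasure]

/-- The set where the bound holds is closed and has full measure, hence is everything. A bound
almost everywhere would not do, since single slices may be null sets. -/
theorem enorm_le_eLpNorm_top {X : Type*} [TopologicalSpace X] [MeasurableSpace X]
    {μ : Measure X} [μ.IsOpenPosMeasure] {f : X → ℂ} (hf : Continuous f) (x : X) :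
    ‖f x‖ₑ ≤ eLpNorm f ⊤ μ := by
  rw [eLpNorm_exponent_top]
  have h := ae_le_eLpNormEssSup (f := f) (μ := μ)
  have hd : Dense {y | ‖f y‖ₑ ≤ eLpNormEssSup f μ} := Measure.dense_of_ae h
  have hcl : IsClosed {y | ‖f y‖ₑ ≤ eLpNormEssSup f μ} :=
    isClosed_le hf.enorm continuous_const
  have : x ∈ closure {y | ‖f y‖ₑ ≤ eLpNormEssSup f μ} := hd x
  rwa [hcl.closure_eq] at this

theorem exists_nat_finrank_lt (p : ℝ) (hp : 0 < p) :
    ∃ N : ℕ, Module.finrank ℝ F < N ∧ (Module.finrank ℝ F : ℝ) < N * min p 1 := by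
  have hs : 0 < min p 1 := lt_min hp one_pos
  obtain ⟨N, hN⟩ := exists_nat_gt ((Module.finrank ℝ F : ℝ) / min p 1)
  rw [div_lt_iff₀ hs] at hN
  refine ⟨N, ?_, hN⟩
  have : (Module.finrank ℝ F : ℝ) < N :=
    hN.trans_le (mul_le_of_le_one_right (Nat.cast_nonneg _) (min_le_right _ _))
  exact_mod_cast this

/-- A substitute for Young's inequality valid for every `p > 0`: integrate the weighted slice
estimate in `x`, where Tonelli leaves only the integral of a power of the weight, and then in `ζ`.
The constants are fixed before `a`, so a `k`-dependent `a` costs only its `B`. -/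
theorem eLpNorm_le_of_band {K K' : Set F} (hK : IsCompact K) (hK' : IsCompact K')
    {p : ℝ≥0∞} (hp : p ≠ 0) :
    ∃ N : ℕ, ∃ W : ℝ≥0∞, W ≠ ⊤ ∧ ∀ (f h : Z × F → ℂ), Continuous f → Continuous h →
      ∀ S : Z → 𝓢'(F, ℂ), (∀ ζ, Band K (fun x => f (ζ, x)) (S ζ)) →
      ∀ (a : 𝓢(F, ℂ)) (A : F → 𝓢(F, ℂ)), tsupport a ⊆ K' →
      (∀ x ξ, A x ξ = a ξ * eChar x ξ) → (∀ ζ x, h (ζ, x) = S ζ (A x)) →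
      ∀ B : ℝ, (∀ t, (1 + ‖t‖) ^ N * ‖𝓕 (a : F → ℂ) t‖ ≤ B) →
      eLpNorm h p (ν.prod volume) ≤ W * ENNReal.ofReal B * eLpNorm f p (ν.prod volume) := by
  by_cases hpt : p = ⊤
  · subst hpt
    refine ⟨Module.finrank ℝ F + 1, ∫⁻ t : F, decayWeight (Module.finrank ℝ F + 1) t,
      lintegral_decayWeight_ne_top (by omega), fun f h hf hh S hS a A ha hA hhS B hB => ?_⟩
    conv_lhs => rw [eLpNorm_exponent_top]
    refine eLpNormEssSup_le_of_ae_enorm_bound (ae_of_all _ fun q => ?_)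
    rw [hhS q.1 q.2]
    exact (hS q.1).enorm_apply_le_of_bounded (hA q.2) hB
      fun t => enorm_le_eLpNorm_top hf (q.1, t)
  · set r := p.toReal
    have hr : 0 < r := ENNReal.toReal_pos hp hpt
    obtain ⟨N, hN, hN'⟩ := exists_nat_finrank_lt (F := F) r hr
    obtain ⟨W, hW, H⟩ := Band.rpow_enorm_apply_le hK hK' hr hN
    have hI : ∫⁻ t : F, decayWeight N t ^ (min r 1) ≠ ⊤ :=
      lintegral_decayWeight_rpow_ne_top (lt_min hr one_pos) hN'
    set I := ∫⁻ t : F, decayWeight N t ^ (min r 1)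
    refine ⟨N, (W * I) ^ (1 / r),
      ENNReal.rpow_ne_top_of_nonneg (by positivity) (ENNReal.mul_ne_top hW hI),
      fun f h hf hh S hS a A ha hA hhS B hB => ?_⟩
    have hBt : ENNReal.ofReal B ^ r ≠ ⊤ :=
      ENNReal.rpow_ne_top_of_nonneg hr.le ENNReal.ofReal_ne_top
    have hfm : Measurable fun q : Z × F => ‖f q‖ₑ ^ r := hf.enorm.measurable.pow_const _
    have hslice : ∀ ζ, ∫⁻ x, ‖h (ζ, x)‖ₑ ^ r ≤
        (W * ENNReal.ofReal B ^ r) * (I * ∫⁻ t, ‖f (ζ, t)‖ₑ ^ r) := by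
      intro ζ
      have hfζ : Measurable fun t => ‖f (ζ, t)‖ₑ ^ r :=
        hfm.comp (measurable_const.prodMk measurable_id)
      calc _ ≤ ∫⁻ x, (W * ENNReal.ofReal B ^ r) *
            ∫⁻ t, ‖f (ζ, t)‖ₑ ^ r * decayWeight N (t - x) ^ (min r 1) :=
            lintegral_mono fun x => by
              rw [hhS]
              exact H _ _ (hS ζ) a (A x) x ha (hA x) B hB
        _ = (W * ENNReal.ofReal B ^ r) *
            ∫⁻ x, ∫⁻ t, ‖f (ζ, t)‖ₑ ^ r * decayWeight N (t - x) ^ (min r 1) :=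
            lintegral_const_mul' _ _ (ENNReal.mul_ne_top hW hBt)
        _ = (W * ENNReal.ofReal B ^ r) *
            ∫⁻ t, ∫⁻ x, ‖f (ζ, t)‖ₑ ^ r * decayWeight N (t - x) ^ (min r 1) := by
            rw [lintegral_lintegral_swap]
            refine Measurable.aemeasurable ?_
            refine (hfζ.comp measurable_snd).mul ?_
            exact ((measurable_decayWeight N).comp
              (measurable_snd.sub measurable_fst)).pow_const _
        _ = (W * ENNReal.ofReal B ^ r) * ∫⁻ t, ‖f (ζ, t)‖ₑ ^ r * I := by
            congr 2; ext t
            have hm : Measurable fun x : F => decayWeight N (t - x) ^ (min r 1) :=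
              ((measurable_decayWeight N).comp (measurable_const.sub measurable_id)).pow_const _
            rw [lintegral_const_mul _ hm,
              lintegral_sub_left_eq_self (fun y : F => decayWeight N y ^ (min r 1)) t]
        _ = _ := by
            rw [lintegral_mul_const _ hfζ, mul_comm I]
    have hmain : ∫⁻ q, ‖h q‖ₑ ^ r ∂(ν.prod volume) ≤
        (W * I) * ENNReal.ofReal B ^ r * ∫⁻ q, ‖f q‖ₑ ^ r ∂(ν.prod volume) := by
      rw [lintegral_prod _ (hh.enorm.measurable.pow_const _).aemeasurable,
        lintegral_prod _ hfm.aemeasurable]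
      refine (lintegral_mono hslice).trans (le_of_eq ?_)
      rw [lintegral_const_mul' _ _ (ENNReal.mul_ne_top hW hBt), lintegral_const_mul' _ _ hI]
      ring
    rw [eLpNorm_eq_lintegral_rpow_enorm_toReal hp hpt,
      eLpNorm_eq_lintegral_rpow_enorm_toReal hp hpt]
    calc _ ≤ ((W * I) * ENNReal.ofReal B ^ r * ∫⁻ q, ‖f q‖ₑ ^ r ∂(ν.prod volume)) ^ (1 / r) :=
          ENNReal.rpow_le_rpow hmain (by positivity)
      _ = _ := by
          rw [ENNReal.mul_rpow_of_nonneg _ _ (by positivity),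
            ENNReal.mul_rpow_of_nonneg _ _ (by positivity), ← ENNReal.rpow_mul (ENNReal.ofReal B),
            mul_one_div_cancel hr.ne', ENNReal.rpow_one]

/-- The slice estimate at `x = 0`, with the weight bounded by `1`, integrated over `O`. It turns a
lower bound for one Fourier pairing, uniform over a set of slices, into a lower bound for the norm
on the product. -/
theorem le_eLpNorm_of_band {K K' : Set F} (hK : IsCompact K) (hK' : IsCompact K')
    {p : ℝ≥0∞} (hp : p ≠ 0) :
    ∃ N : ℕ, ∃ W : ℝ≥0∞, W ≠ ⊤ ∧ ∀ (f : Z × F → ℂ), Continuous f →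
      ∀ S : Z → 𝓢'(F, ℂ), (∀ ζ, Band K (fun x => f (ζ, x)) (S ζ)) →
      ∀ (a : 𝓢(F, ℂ)), tsupport a ⊆ K' →
      ∀ B : ℝ, (∀ t, (1 + ‖t‖) ^ N * ‖𝓕 (a : F → ℂ) t‖ ≤ B) →
      ∀ (O : Set Z) (δ : ℝ≥0∞), MeasurableSet O → O.Nonempty → (∀ ζ ∈ O, δ ≤ ‖S ζ a‖ₑ) →
      δ * ν O ^ (1 / p.toReal) ≤ W * ENNReal.ofReal B * eLpNorm f p (ν.prod volume) := by
  have hax : ∀ a : 𝓢(F, ℂ), ∀ ξ, a ξ = a ξ * eChar 0 ξ := fun a ξ => by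
    rw [eChar_zero, mul_one]
  by_cases hpt : p = ⊤
  · subst hpt
    refine ⟨Module.finrank ℝ F + 1, ∫⁻ t : F, decayWeight (Module.finrank ℝ F + 1) t,
      lintegral_decayWeight_ne_top (by omega), fun f hf S hS a ha B hB O δ hO hOn hδ => ?_⟩
    obtain ⟨ζ, hζ⟩ := hOn
    -- For `p = ⊤` the exponent `1 / p.toReal` is `1 / 0 = 0`, so the measure factor is `1` and a
    -- single point of `O` suffices.
    simp only [ENNReal.toReal_top, div_zero, ENNReal.rpow_zero, mul_one]
    exact (hδ ζ hζ).trans ((hS ζ).enorm_apply_le_of_bounded (hax a) hB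
      fun t => enorm_le_eLpNorm_top hf (ζ, t))
  · set r := p.toReal
    have hr : 0 < r := ENNReal.toReal_pos hp hpt
    obtain ⟨W, hW, H⟩ := Band.rpow_enorm_apply_le hK hK' hr
      (N := Module.finrank ℝ F + 1) (by omega)
    refine ⟨Module.finrank ℝ F + 1, W ^ (1 / r),
      ENNReal.rpow_ne_top_of_nonneg (by positivity) hW,
      fun f hf S hS a ha B hB O δ hO hOn hδ => ?_⟩
    have hBt : ENNReal.ofReal B ^ r ≠ ⊤ :=
      ENNReal.rpow_ne_top_of_nonneg hr.le ENNReal.ofReal_ne_top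
    have hslice : ∀ ζ, ‖S ζ a‖ₑ ^ r ≤
        (W * ENNReal.ofReal B ^ r) * ∫⁻ t, ‖f (ζ, t)‖ₑ ^ r := by
      intro ζ
      refine (H _ _ (hS ζ) a a 0 ha (hax a) B hB).trans
        (mul_le_mul_right (lintegral_mono fun t => ?_) _)
      refine mul_le_of_le_one_right' ?_
      exact ENNReal.rpow_le_one (decayWeight_le_one _ _) (le_min hr.le zero_le_one)
    have hmain : δ ^ r * ν O ≤
        W * ENNReal.ofReal B ^ r * ∫⁻ q, ‖f q‖ₑ ^ r ∂(ν.prod volume) := by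
      rw [lintegral_prod _ (hf.enorm.measurable.pow_const _).aemeasurable,
        ← lintegral_const_mul' _ _ (ENNReal.mul_ne_top hW hBt), ← setLIntegral_const]
      calc ∫⁻ _ in O, δ ^ r ∂ν ≤ ∫⁻ ζ in O,
            ((W * ENNReal.ofReal B ^ r) * ∫⁻ t, ‖f (ζ, t)‖ₑ ^ r) ∂ν :=
            setLIntegral_mono' hO fun ζ hζ =>
              (ENNReal.rpow_le_rpow (hδ ζ hζ) hr.le).trans (hslice ζ)
        _ ≤ _ := setLIntegral_le_lintegral _ _
    rw [eLpNorm_eq_lintegral_rpow_enorm_toReal hp hpt]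
    calc δ * ν O ^ (1 / r) = (δ ^ r * ν O) ^ (1 / r) := by
          rw [ENNReal.mul_rpow_of_nonneg _ _ (by positivity), ← ENNReal.rpow_mul,
            mul_one_div_cancel hr.ne', ENNReal.rpow_one]
      _ ≤ _ := ENNReal.rpow_le_rpow hmain (by positivity)
      _ = _ := by
          rw [ENNReal.mul_rpow_of_nonneg _ _ (by positivity),
            ENNReal.mul_rpow_of_nonneg _ _ (by positivity), ← ENNReal.rpow_mul (ENNReal.ofReal B),
            mul_one_div_cancel hr.ne', ENNReal.rpow_one]

end LpProd

end

end QuadraticCR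

namespace QuadraticCR

noncomputable section

set_option linter.unusedSectionVars false

/-! ### A boundary uniqueness theorem in the half-plane -/

section Uniqueness

/-- A solution of `∂_r A = 2 i r ∂_τ A` on the half-plane `r > 0` is determined by its boundary
value on `r = 0`, provided the latter extends to an entire function. -/
theorem eq_entire_of_boundary {A : ℝ × ℝ → ℂ} {A' : ℝ × ℝ → (ℝ × ℝ →L[ℝ] ℂ)}
    (hA : ∀ q, HasFDerivAt A (A' q) q) (hA' : Continuous A')
    (hcr : ∀ r τ, 0 < r → A' (r, τ) (1, 0) = 2 * Complex.I * r * A' (r, τ) (0, 1))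
    {H : ℂ → ℂ} (hH : Differentiable ℂ H) (h0 : ∀ τ : ℝ, A (0, τ) = H τ)
    {ρ : ℝ} (hρ : 0 ≤ ρ) (τ : ℝ) : A (√ρ, τ) = H (τ + ρ * Complex.I) := by
  have hev : ∀ v, Continuous fun q => A' q v := fun v => hA'.clm_apply continuous_const
  have hcr0 : ∀ r τ, 0 ≤ r → A' (r, τ) (1, 0) = 2 * Complex.I * r * A' (r, τ) (0, 1) := by
    intro r τ hr
    have hcl : r ∈ closure (Set.Ioi (0 : ℝ)) := by simpa using hr
    refine Set.EqOn.closure (s := Set.Ioi (0 : ℝ)) (f := fun r => A' (r, τ) (1, 0))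
      (g := fun r => 2 * Complex.I * r * A' (r, τ) (0, 1)) (fun r hr => hcr r τ hr) ?_ ?_ hcl
    · exact (hev (1, 0)).comp (by fun_prop : Continuous fun r : ℝ => (r, τ))
    · exact (by fun_prop : Continuous fun r : ℝ => 2 * Complex.I * (r : ℂ)).mul
        ((hev (0, 1)).comp (by fun_prop : Continuous fun r : ℝ => (r, τ)))
  have hHd : Continuous (deriv H) := (hH.contDiff (n := 1)).continuous_deriv le_rfl
  -- In the coordinate `z = τ + i r²` the equation becomes the Cauchy–Riemann equation. The function
  -- `c` is the `τ`-derivative of `A - H`, which vanishes at `r = 0` because the boundary values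
  -- agree.
  set c : ℝ × ℝ → ℂ := fun q =>
    A' q (0, 1) - deriv H ((q.2 : ℂ) + ((q.1 ^ 2 : ℝ) : ℂ) * Complex.I) with hc
  have hcc : Continuous c := (hev (0, 1)).sub (hHd.comp (by fun_prop))
  have hc0 : ∀ τ, c (0, τ) = 0 := by
    intro τ
    have h1 : HasDerivAt (fun t : ℝ => A (0, t)) (A' (0, τ) (0, 1)) τ :=
      (hA (0, τ)).comp_hasDerivAt τ ((hasDerivAt_const τ (0 : ℝ)).prodMk (hasDerivAt_id τ))
    have h2 : HasDerivAt (fun t : ℝ => A (0, t)) (deriv H τ) τ := by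
      simp only [h0]
      exact (hH τ).hasDerivAt.comp_ofReal
    simp only [hc]
    rw [h1.unique h2]
    simp
  -- Extension of `A - H` by zero. It turns out to be differentiable across the real line, so it is
  -- entire and vanishes on a half-plane, hence everywhere.
  set D : ℂ → ℂ := fun z => if 0 < z.im then A (√z.im, z.re) - H z else 0 with hD
  -- The `r`-derivative of `A - H` is `2 i r c`, so the difference is at most `2 ε r²`. As `r² = Im
  -- z` and `c` is small near the boundary, this makes the derivative of `D` zero at real points.
  have hBest : ∀ r τ ε : ℝ, 0 ≤ r → (∀ r' ∈ Set.Ico 0 r, ‖c (r', τ)‖ ≤ ε) →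
      ‖A (r, τ) - H ((τ : ℂ) + ((r ^ 2 : ℝ) : ℂ) * Complex.I)‖ ≤ 2 * r * ε * r := by
    intro r τ ε hr hε
    have hder : ∀ s : ℝ, 0 ≤ s → HasDerivAt
        (fun s : ℝ => A (s, τ) - H ((τ : ℂ) + ((s ^ 2 : ℝ) : ℂ) * Complex.I))
        (2 * Complex.I * s * c (s, τ)) s := by
      intro s hs
      have h1 : HasDerivAt (fun t : ℝ => A (t, τ)) (A' (s, τ) (1, 0)) s :=
        (hA (s, τ)).comp_hasDerivAt s ((hasDerivAt_id s).prodMk (hasDerivAt_const s τ))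
      have h2 : HasDerivAt (fun t : ℝ => (τ : ℂ) + ((t ^ 2 : ℝ) : ℂ) * Complex.I)
          (((2 * s : ℝ) : ℂ) * Complex.I) s := by
        have h3 : HasDerivAt (fun t : ℝ => t ^ 2) (2 * s) s := by
          simpa using hasDerivAt_pow 2 s
        exact ((h3.ofReal_comp).mul_const Complex.I).const_add _
      have h4 := (hH ((τ : ℂ) + ((s ^ 2 : ℝ) : ℂ) * Complex.I)).hasDerivAt.comp s h2
      have h5 := h1.sub h4
      refine h5.congr_deriv ?_
      rw [hcr0 s τ hs]
      simp only [hc]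
      push_cast
      ring
    have := norm_image_sub_le_of_norm_deriv_right_le_segment (a := 0) (b := r)
      (C := 2 * r * ε)
      (f := fun s : ℝ => A (s, τ) - H ((τ : ℂ) + ((s ^ 2 : ℝ) : ℂ) * Complex.I))
      (fun s hs => (hder s hs.1).continuousAt.continuousWithinAt)
      (fun s hs => (hder s hs.1).hasDerivWithinAt) (fun s hs => ?_) r ⟨hr, le_rfl⟩
    · simpa [h0] using this
    · rw [norm_mul, norm_mul, norm_mul, Complex.norm_I, Complex.norm_real,
        Real.norm_of_nonneg hs.1]
      have h1 := hε s hs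
      have h2 := hs.1
      have h3 := hs.2.le
      simp only [Complex.norm_ofNat, mul_one]
      gcongr
  have hDdiff : Differentiable ℂ D := by
    intro z
    rcases lt_trichotomy z.im 0 with hz | hz | hz
    · have : D =ᶠ[𝓝 z] fun _ => 0 := by
        filter_upwards [Complex.continuous_im.continuousAt.eventually (gt_mem_nhds hz)] with y hy
        simp [hD, not_lt.2 hy.le]
      exact (differentiableAt_const 0).congr_of_eventuallyEq this
    · have hDz : D z = 0 := by simp [hD, hz]
      have : HasDerivAt D 0 z := by
        rw [hasDerivAt_iff_isLittleO]
        simp only [hDz, smul_zero, sub_zero]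
        rw [Asymptotics.isLittleO_iff]
        intro ε hε
        have hnear : ∀ᶠ q in 𝓝 ((0 : ℝ), z.re), ‖c q‖ ≤ ε / 2 := by
          have := hcc.norm.tendsto (0, z.re)
          rw [hc0, norm_zero] at this
          exact this.eventually (ge_mem_nhds (by positivity))
        obtain ⟨δ, hδ, hball⟩ := Metric.eventually_nhds_iff.1 hnear
        have e1 : ∀ᶠ y : ℂ in 𝓝 z, y.im < δ ^ 2 := by
          refine Complex.continuous_im.continuousAt.eventually (gt_mem_nhds ?_)
          rw [hz]; positivity
        have e2 : ∀ᶠ y : ℂ in 𝓝 z, dist y.re z.re < δ :=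
          Complex.continuous_re.continuousAt.eventually (Metric.ball_mem_nhds _ hδ)
        filter_upwards [e1, e2] with y hy1 hy2
        by_cases hy : 0 < y.im
        · have h1 := hBest (√y.im) y.re (ε / 2) (Real.sqrt_nonneg _) (fun r' hr' => ?_)
          · have h2 : √y.im * √y.im = y.im := Real.mul_self_sqrt hy.le
            have h3 : √y.im ^ 2 = y.im := Real.sq_sqrt hy.le
            rw [h3, Complex.re_add_im] at h1
            simp only [hD, hy, if_true]
            have h4 : y.im ≤ ‖y - z‖ := by
              have := Complex.abs_im_le_norm (y - z)
              rw [Complex.sub_im, hz, sub_zero] at this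
              exact (le_abs_self _).trans this
            calc _ ≤ _ := h1
              _ = ε * (√y.im * √y.im) := by ring
              _ = ε * y.im := by rw [h2]
              _ ≤ _ := by gcongr
          · refine hball ?_
            rw [Prod.dist_eq, max_lt_iff]
            refine ⟨?_, hy2⟩
            rw [Real.dist_0_eq_abs, abs_of_nonneg hr'.1]
            exact hr'.2.trans_le (Real.sqrt_le_iff.2 ⟨hδ.le, hy1.le⟩)
        · simp only [hD, hy, if_false, norm_zero]
          positivity
      exact this.differentiableAt
    · have hev' : D =ᶠ[𝓝 z] fun y => A (√y.im, y.re) - H y := by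
        filter_upwards [Complex.continuous_im.continuousAt.eventually (lt_mem_nhds hz)] with y hy
        simp [hD, hy]
      refine DifferentiableAt.congr_of_eventuallyEq ?_ hev'
      refine DifferentiableAt.sub ?_ (hH z)
      have hq : HasFDerivAt (fun y : ℂ => (√y.im, y.re))
          (((1 / (2 * √z.im)) • Complex.imCLM).prod Complex.reCLM) z :=
        (Complex.imCLM.hasFDerivAt.sqrt hz.ne').prodMk Complex.reCLM.hasFDerivAt
      have h1 := (hA (√z.im, z.re)).comp z hq
      have hs : 0 < √z.im := Real.sqrt_pos.2 hz
      refine (hasFDerivAt_of_restrictScalars ℝ h1 (f' :=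
        ContinuousLinearMap.toSpanSingleton ℂ (A' (√z.im, z.re) (0, 1))) ?_).differentiableAt
      ext v
      simp only [ContinuousLinearMap.coe_restrictScalars', ContinuousLinearMap.comp_apply,
        ContinuousLinearMap.toSpanSingleton_apply, ContinuousLinearMap.prod_apply]
      have hdec : ((((1 / (2 * √z.im)) • Complex.imCLM) v, Complex.reCLM v) : ℝ × ℝ) =
          (1 / (2 * √z.im) * v.im) • ((1, 0) : ℝ × ℝ) + v.re • ((0, 1) : ℝ × ℝ) := by
        simp
      rw [hdec, map_add, map_smul, map_smul, hcr _ _ hs]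
      have hs' : (√z.im : ℂ) ≠ 0 := by exact_mod_cast hs.ne'
      simp only [Complex.real_smul, smul_eq_mul]
      push_cast
      conv_lhs => rw [← Complex.re_add_im v]
      field_simp
      ring
  have hD0 : ∀ z, D z = 0 := by
    have h1 : AnalyticOnNhd ℂ D Set.univ := fun z _ => hDdiff.analyticAt z
    have h2 : AnalyticOnNhd ℂ (fun _ : ℂ => (0 : ℂ)) Set.univ := fun z _ => analyticAt_const
    have h3 : D =ᶠ[𝓝 (-Complex.I)] fun _ => (0 : ℂ) := by
      have : (-Complex.I).im < 0 := by simp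
      filter_upwards [Complex.continuous_im.continuousAt.eventually (gt_mem_nhds this)] with y hy
      simp [hD, not_lt.2 hy.le]
    exact congrFun (h1.eq_of_eventuallyEq h2 h3)
  rcases hρ.eq_or_lt with rfl | hρ
  · simp [h0]
  · have := hD0 ((τ : ℂ) + ρ * Complex.I)
    simp only [hD, Complex.add_im, Complex.ofReal_im, Complex.mul_im, Complex.ofReal_re,
      Complex.I_im, Complex.I_re, mul_one, mul_zero, zero_add, add_zero, hρ, if_true,
      Complex.add_re, Complex.mul_re, sub_zero] at this
    exact sub_eq_zero.1 this

theorem hasFDerivAt_intervalIntegral_of_contDiff {P : Type*} [NormedAddCommGroup P]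
    [NormedSpace ℝ P] [FiniteDimensional ℝ P] {G : P × ℝ → ℂ} (hG : ContDiff ℝ 1 G) (a b : ℝ)
    (q : P) :
    HasFDerivAt (fun q => ∫ θ in a..b, G (q, θ))
      (∫ θ in a..b, (fderiv ℝ G (q, θ)).comp (ContinuousLinearMap.inl ℝ P ℝ)) q := by
  have hc : Continuous fun r : P × ℝ =>
      (fderiv ℝ G r).comp (ContinuousLinearMap.inl ℝ P ℝ) :=
    (hG.continuous_fderiv one_ne_zero).clm_comp continuous_const
  obtain ⟨U, hU, hUq⟩ := exists_compact_mem_nhds q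
  obtain ⟨M, hM⟩ := (hU.prod (isCompact_uIcc (a := a) (b := b))).exists_bound_of_continuousOn
    hc.continuousOn
  refine intervalIntegral.hasFDerivAt_integral_of_dominated_of_fderiv_le (bound := fun _ => M)
    (F := fun q θ => G (q, θ))
    (F' := fun q θ => (fderiv ℝ G (q, θ)).comp (ContinuousLinearMap.inl ℝ P ℝ))
    hUq ?_ ?_ ?_ ?_ ?_ ?_
  · exact Eventually.of_forall fun q =>
      (hG.continuous.comp (by fun_prop : Continuous fun θ : ℝ => (q, θ))).aestronglyMeasurable
  · exact (hG.continuous.comp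
      (by fun_prop : Continuous fun θ : ℝ => (q, θ))).intervalIntegrable _ _
  · exact (hc.comp (by fun_prop : Continuous fun θ : ℝ => (q, θ))).aestronglyMeasurable
  · exact ae_of_all _ fun θ hθ q hq => hM (q, θ) ⟨hq, Set.uIoc_subset_uIcc hθ⟩
  · exact continuous_const.intervalIntegrable _ _
  · refine ae_of_all _ fun θ _ q _ => ?_
    have h1 := ((hG.differentiable one_ne_zero) (q, θ)).hasFDerivAt
    have h2 : HasFDerivAt (fun q : P => (q, θ)) (ContinuousLinearMap.inl ℝ P ℝ) q :=
      hasFDerivAt_prodMk_left q θ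
    exact h1.comp q h2

theorem continuous_intervalIntegral_fderiv {P : Type*} [NormedAddCommGroup P]
    [NormedSpace ℝ P] [FiniteDimensional ℝ P] {G : P × ℝ → ℂ} (hG : ContDiff ℝ 1 G) (a b : ℝ) :
    Continuous fun q => ∫ θ in a..b, (fderiv ℝ G (q, θ)).comp (ContinuousLinearMap.inl ℝ P ℝ) :=
  intervalIntegral.continuous_parametric_intervalIntegral_of_continuous'
    ((hG.continuous_fderiv one_ne_zero).clm_comp continuous_const) a b

end Uniqueness

end

end QuadraticCR

namespace QuadraticCR

noncomputable section

set_option linter.unusedSectionVars false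

/-! ### The mean value property of CR functions on circles -/

section Forms

variable {E F : Type*} [NormedAddCommGroup E] [InnerProductSpace ℂ E] [FiniteDimensional ℂ E]
  [NormedAddCommGroup F] [InnerProductSpace ℝ F] [FiniteDimensional ℝ F]

theorem imPart_I_smul (z : ℂ ⊗[ℝ] F) : imPart (Complex.I • z) = rePart z := by
  induction z using TensorProduct.induction_on with
  | zero => simp
  | tmul a x => simp [rePart, imPart, TensorProduct.smul_tmul']
  | add a b ha hb => rw [smul_add, map_add, map_add, ha, hb]

theorem rePart_ofReal_smul (c : ℝ) (z : ℂ ⊗[ℝ] F) : rePart ((c : ℂ) • z) = c • rePart z := by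
  induction z using TensorProduct.induction_on with
  | zero => simp
  | tmul a x => simp [rePart, TensorProduct.smul_tmul', mul_smul]
  | add a b ha hb => rw [smul_add, map_add, map_add, ha, hb, smul_add]

theorem imPart_ofReal_smul (c : ℝ) (z : ℂ ⊗[ℝ] F) : imPart ((c : ℂ) • z) = c • imPart z := by
  induction z using TensorProduct.induction_on with
  | zero => simp
  | tmul a x => simp [imPart, TensorProduct.smul_tmul', mul_smul]
  | add a b ha hb => rw [smul_add, map_add, map_add, ha, hb, smul_add]

theorem map_real_smul_right (Φ : E →ₗ[ℂ] E →ₗ⋆[ℂ] (ℂ ⊗[ℝ] F)) (c : ℝ) (a b : E) :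
    Φ a (c • b) = (c : ℂ) • Φ a b := by
  rw [← Complex.coe_smul c b, LinearMap.map_smulₛₗ, Complex.conj_ofReal]

theorem map_real_smul_left (Φ : E →ₗ[ℂ] E →ₗ⋆[ℂ] (ℂ ⊗[ℝ] F)) (c : ℝ) (a b : E) :
    Φ (c • a) b = (c : ℂ) • Φ a b := by
  rw [← Complex.coe_smul c a, map_smul, LinearMap.smul_apply]

/-- The real part of a sesquilinear map, as a continuous real bilinear map. -/
def reForm (Φ : E →ₗ[ℂ] E →ₗ⋆[ℂ] (ℂ ⊗[ℝ] F)) : E →L[ℝ] E →L[ℝ] F :=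
  LinearMap.toContinuousBilinearMap <| LinearMap.mk₂ ℝ (fun a b => rePart (Φ a b))
    (fun a a' b => by simp) (fun c a b => by rw [map_real_smul_left, rePart_ofReal_smul])
    (fun a b b' => by simp) (fun c a b => by rw [map_real_smul_right, rePart_ofReal_smul])

/-- The imaginary part of a sesquilinear map, as a continuous real bilinear map. -/
def imForm (Φ : E →ₗ[ℂ] E →ₗ⋆[ℂ] (ℂ ⊗[ℝ] F)) : E →L[ℝ] E →L[ℝ] F :=
  LinearMap.toContinuousBilinearMap <| LinearMap.mk₂ ℝ (fun a b => imPart (Φ a b))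
    (fun a a' b => by simp) (fun c a b => by rw [map_real_smul_left, imPart_ofReal_smul])
    (fun a b b' => by simp) (fun c a b => by rw [map_real_smul_right, imPart_ofReal_smul])

theorem reForm_apply (Φ : E →ₗ[ℂ] E →ₗ⋆[ℂ] (ℂ ⊗[ℝ] F)) (a b : E) :
    reForm Φ a b = rePart (Φ a b) := rfl

theorem imForm_apply (Φ : E →ₗ[ℂ] E →ₗ⋆[ℂ] (ℂ ⊗[ℝ] F)) (a b : E) :
    imForm Φ a b = imPart (Φ a b) := rfl

theorem imForm_I_smul (Φ : E →ₗ[ℂ] E →ₗ⋆[ℂ] (ℂ ⊗[ℝ] F)) (a b : E) :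
    imForm Φ a (Complex.I • b) = -reForm Φ a b := by
  rw [imForm_apply, LinearMap.map_smulₛₗ, Complex.conj_I, neg_smul, map_neg, imPart_I_smul,
    reForm_apply]

theorem IsHermitianMap.imForm_self {Φ : E →ₗ[ℂ] E →ₗ⋆[ℂ] (ℂ ⊗[ℝ] F)} (hΦ : IsHermitianMap Φ)
    (a : E) : imForm Φ a a = 0 := by
  have h := (hΦ a a).2
  rw [imForm_apply]
  have h2 : (2 : ℝ) • imPart (Φ a a) = 0 := by rw [two_smul]; nth_rw 1 [h]; simp
  exact (smul_eq_zero.1 h2).resolve_left two_ne_zero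

theorem reForm_smul_self (Φ : E →ₗ[ℂ] E →ₗ⋆[ℂ] (ℂ ⊗[ℝ] F)) {c : ℂ} (hc : ‖c‖ = 1) (a : E) :
    reForm Φ (c • a) (c • a) = reForm Φ a a := by
  rw [reForm_apply, reForm_apply, LinearMap.map_smul Φ, LinearMap.smul_apply,
    LinearMap.map_smulₛₗ, smul_smul, Complex.mul_conj, Complex.normSq_eq_norm_sq, hc]
  simp

variable {Φ : E →ₗ[ℂ] E →ₗ⋆[ℂ] (ℂ ⊗[ℝ] F)}

/-- On the group-translated circles of radius `r`, shifted by `τ Φ(w, w)`, the CR equation makes the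
mean solve `∂_r A = 2 i r ∂_τ A`. At `r = 0` the circle collapses to a point and the boundary value
is `2π H`, so `eq_entire_of_boundary` evaluates the mean at `r = 1`, `τ = 0`. -/
theorem integral_circle_eq (hΦ : IsHermitianMap Φ) {f : E × F → ℂ} (hf : ContDiff ℝ ∞ f)
    (hcr : IsCR Φ f) (ζ₀ w : E) (x : F) {H : ℂ → ℂ} (hH : Differentiable ℂ H)
    (h0 : ∀ τ : ℝ, f (ζ₀, x + τ • reForm Φ w w) = H τ) :
    ∫ θ in (0 : ℝ)..2 * Real.pi, f (ζ₀ + Complex.exp (θ * Complex.I) • w,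
      x + (2 : ℝ) • imForm Φ ζ₀ (Complex.exp (θ * Complex.I) • w)) =
      2 * Real.pi * H Complex.I := by
  set e : F := reForm Φ w w
  set u : ℝ → E := fun θ => Complex.exp (θ * Complex.I) • w
  have hu : ContDiff ℝ ∞ u := by
    have : ContDiff ℝ ∞ fun θ : ℝ => Complex.exp (θ * Complex.I) :=
      (Complex.ofRealCLM.contDiff.mul contDiff_const).cexp
    exact this.smul contDiff_const
  have hud : ∀ θ, HasDerivAt u (Complex.I • u θ) θ := by
    intro θ
    have h1 : HasDerivAt (fun θ : ℝ => Complex.exp (θ * Complex.I))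
        (Complex.exp (θ * Complex.I) * Complex.I) θ := by
      have h2 : HasDerivAt (fun θ : ℝ => (θ : ℂ) * Complex.I) Complex.I θ := by
        simpa using (Complex.ofRealCLM.hasDerivAt (x := θ)).mul_const Complex.I
      exact h2.cexp
    have h3 := h1.smul_const w
    refine h3.congr_deriv ?_
    simp only [u, smul_smul, mul_comm]
  set Q : (ℝ × ℝ) × ℝ → E × F := fun q =>
    (ζ₀ + q.1.1 • u q.2, x + q.1.2 • e + (2 : ℝ) • imForm Φ ζ₀ (q.1.1 • u q.2)) with hQ
  have hQs : ContDiff ℝ ∞ Q := by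
    have h1 : ContDiff ℝ ∞ fun q : (ℝ × ℝ) × ℝ => q.1.1 • u q.2 :=
      (contDiff_fst.comp contDiff_fst).smul (hu.comp contDiff_snd)
    refine (contDiff_const.add h1).prodMk ?_
    refine (contDiff_const.add ((contDiff_snd.comp contDiff_fst).smul contDiff_const)).add ?_
    exact contDiff_const.smul ((imForm Φ ζ₀).contDiff.comp h1)
  set G : (ℝ × ℝ) × ℝ → ℂ := fun q => f (Q q)
  have hG : ContDiff ℝ ∞ G := hf.comp hQs
  have hG1 : ContDiff ℝ 1 G := hG.of_le (by exact_mod_cast le_top)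
  have hfd : ∀ q, HasFDerivAt f (fderiv ℝ f q) q :=
    fun q => ((hf.differentiable (by simp)) q).hasFDerivAt
  have hGd : ∀ q, HasFDerivAt G (fderiv ℝ G q) q :=
    fun q => ((hG.differentiable (by simp)) q).hasFDerivAt
  have hr : ∀ r τ θ, fderiv ℝ G ((r, τ), θ) ((1, 0), 0) =
      fderiv ℝ f (Q ((r, τ), θ)) (u θ, (2 : ℝ) • imForm Φ ζ₀ (u θ)) := by
    intro r τ θ
    have h1 : HasDerivAt (fun r => G ((r, τ), θ)) (fderiv ℝ G ((r, τ), θ) ((1, 0), 0)) r :=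
      (hGd _).comp_hasDerivAt r
        (((hasDerivAt_id r).prodMk (hasDerivAt_const r τ)).prodMk (hasDerivAt_const r θ))
    refine h1.unique ?_
    have h2 : HasDerivAt (fun r : ℝ => r • u θ) (u θ) r := by
      simpa using (hasDerivAt_id r).smul_const (u θ)
    have h3 : HasDerivAt (fun r : ℝ => imForm Φ ζ₀ (r • u θ)) (imForm Φ ζ₀ (u θ)) r :=
      (imForm Φ ζ₀).hasFDerivAt.comp_hasDerivAt r h2
    have h4 : HasDerivAt (fun r : ℝ => (2 : ℝ) • imForm Φ ζ₀ (r • u θ))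
        ((2 : ℝ) • imForm Φ ζ₀ (u θ)) r := h3.const_smul (2 : ℝ)
    have h5 : HasDerivAt (fun r : ℝ => Q ((r, τ), θ)) (u θ, (2 : ℝ) • imForm Φ ζ₀ (u θ)) r :=
      (h2.const_add ζ₀).prodMk (h4.const_add (x + τ • e))
    exact (hfd _).comp_hasDerivAt r h5
  have hτ : ∀ r τ θ, fderiv ℝ G ((r, τ), θ) ((0, 1), 0) =
      fderiv ℝ f (Q ((r, τ), θ)) (0, e) := by
    intro r τ θ
    have h1 : HasDerivAt (fun τ => G ((r, τ), θ)) (fderiv ℝ G ((r, τ), θ) ((0, 1), 0)) τ :=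
      (hGd _).comp_hasDerivAt τ
        (((hasDerivAt_const τ r).prodMk (hasDerivAt_id τ)).prodMk (hasDerivAt_const τ θ))
    refine h1.unique ?_
    have h2 : HasDerivAt (fun τ : ℝ => τ • e) e τ := by
      simpa using (hasDerivAt_id τ).smul_const e
    have h5 : HasDerivAt (fun τ : ℝ => Q ((r, τ), θ)) (0, e) τ :=
      (hasDerivAt_const τ (ζ₀ + r • u θ)).prodMk
        ((h2.const_add x).add_const ((2 : ℝ) • imForm Φ ζ₀ (r • u θ)))
    exact (hfd _).comp_hasDerivAt τ h5
  have hθ : ∀ r τ θ, HasDerivAt (fun θ => G ((r, τ), θ))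
      (fderiv ℝ f (Q ((r, τ), θ)) (r • Complex.I • u θ, -((2 * r : ℝ) • reForm Φ ζ₀ (u θ)))) θ := by
    intro r τ θ
    have h2 : HasDerivAt (fun θ : ℝ => r • u θ) (r • Complex.I • u θ) θ :=
      (hud θ).const_smul r
    have h3 : HasDerivAt (fun θ : ℝ => imForm Φ ζ₀ (r • u θ))
        (imForm Φ ζ₀ (r • Complex.I • u θ)) θ :=
      (imForm Φ ζ₀).hasFDerivAt.comp_hasDerivAt θ h2
    have h4 : HasDerivAt (fun θ : ℝ => (2 : ℝ) • imForm Φ ζ₀ (r • u θ))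
        (-((2 * r : ℝ) • reForm Φ ζ₀ (u θ))) θ :=
      (h3.const_smul (2 : ℝ)).congr_deriv (by
        rw [map_smul, imForm_I_smul, smul_smul, smul_neg])
    have h5 : HasDerivAt (fun θ : ℝ => Q ((r, τ), θ))
        (r • Complex.I • u θ, -((2 * r : ℝ) • reForm Φ ζ₀ (u θ))) θ :=
      (h2.const_add ζ₀).prodMk (h4.const_add (x + τ • e))
    exact (hfd _).comp_hasDerivAt θ h5
  -- The CR equation in the direction `u θ`, in polar form: `r ∂_r G = 2 i r² ∂_τ G - i ∂_θ G`. The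
  -- last term is an exact `θ`-derivative and disappears over a full period. Hermitian symmetry and
  -- `Φ(u θ, u θ) = Φ(w, w)` identify the coefficients.
  have hid : ∀ r τ θ : ℝ, (r : ℂ) * fderiv ℝ G ((r, τ), θ) ((1, 0), 0) =
      2 * Complex.I * r ^ 2 * fderiv ℝ G ((r, τ), θ) ((0, 1), 0) - Complex.I *
      fderiv ℝ f (Q ((r, τ), θ)) (r • Complex.I • u θ, -((2 * r : ℝ) • reForm Φ ζ₀ (u θ))) := by
    intro r τ θ
    have hc := hcr (u θ) (Q ((r, τ), θ))
    rw [hr, hτ]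
    set L := fderiv ℝ f (Q ((r, τ), θ))
    have hn : ‖Complex.exp (θ * Complex.I)‖ = 1 := Complex.norm_exp_ofReal_mul_I θ
    have e1 : rePart (Φ (u θ) (Q ((r, τ), θ)).1) = reForm Φ ζ₀ (u θ) + r • e := by
      simp only [hQ]
      rw [← reForm_apply, map_add, (reForm Φ (u θ)).map_smul r (u θ), reForm_smul_self Φ hn, reForm_apply, reForm_apply,
        (hΦ ζ₀ (u θ)).1]
      rfl
    have e2 : imPart (Φ (u θ) (Q ((r, τ), θ)).1) = -imForm Φ ζ₀ (u θ) := by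
      simp only [hQ]
      rw [← imForm_apply, map_add, (imForm Φ (u θ)).map_smul r (u θ), hΦ.imForm_self, imForm_apply, imForm_apply,
        (hΦ ζ₀ (u θ)).2]
      simp
    rw [conjZ, e1, e2] at hc
    have s1 : ∀ (a : E) (b : F), L (a, b) = L (a, 0) + L (0, b) := fun a b => by
      rw [← map_add]; simp
    have s2 : ∀ b c : F, L (0, b + c) = L (0, b) + L (0, c) := fun b c => by
      rw [← map_add]; simp
    have s3 : ∀ (t : ℝ) (b : F), L (0, t • b) = t * L (0, b) := fun t b => by
      rw [← Complex.real_smul, ← map_smul]; simp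
    have s4 : ∀ (t : ℝ) (a : E), L (t • a, 0) = t * L (a, 0) := fun t b => by
      rw [← Complex.real_smul, ← map_smul]; simp
    have s5 : ∀ b : F, L (0, -b) = -L (0, b) := fun b => by
      rw [← map_neg]; simp
    rw [s1 (u θ), s1 (r • Complex.I • u θ), s3, s5, s3, s4]
    rw [s2, s3, s5] at hc
    push_cast
    linear_combination (2 * (r : ℂ)) * hc
  have hmain := eq_entire_of_boundary
    (A := fun q => ∫ θ in (0 : ℝ)..2 * Real.pi, G (q, θ))
    (fun q => hasFDerivAt_intervalIntegral_of_contDiff hG1 0 (2 * Real.pi) q)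
    (continuous_intervalIntegral_fderiv hG1 0 (2 * Real.pi)) (fun r τ hr0 => ?_)
    (H := fun z => 2 * Real.pi * H z) (hH.const_mul _) (fun τ => ?_) (zero_le_one) 0
  · simp only [Real.sqrt_one, Complex.ofReal_zero, Complex.ofReal_one, zero_add, one_mul] at hmain
    rw [← hmain]
    simp only [G, hQ, one_smul, zero_smul, add_zero, u]
  · have hci : Continuous fun θ : ℝ =>
        (fderiv ℝ G ((r, τ), θ)).comp (ContinuousLinearMap.inl ℝ (ℝ × ℝ) ℝ) :=
      ((hG1.continuous_fderiv one_ne_zero).clm_comp continuous_const).comp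
        (by fun_prop : Continuous fun θ : ℝ => ((r, τ), θ))
    have hv : ∀ v : ℝ × ℝ, Continuous fun θ : ℝ => fderiv ℝ G ((r, τ), θ) (v, 0) := fun v => by
      exact hci.clm_apply continuous_const
    rw [ContinuousLinearMap.intervalIntegral_apply (hci.intervalIntegrable _ _),
      ContinuousLinearMap.intervalIntegral_apply (hci.intervalIntegrable _ _)]
    simp only [ContinuousLinearMap.comp_apply, ContinuousLinearMap.inl_apply]
    have hr' : (r : ℂ) ≠ 0 := by exact_mod_cast hr0.ne'
    have hLc : Continuous fun θ => fderiv ℝ f (Q ((r, τ), θ))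
        (r • Complex.I • u θ, -((2 * r : ℝ) • reForm Φ ζ₀ (u θ))) := by
      have h1 : Continuous fun θ : ℝ => Q ((r, τ), θ) := hQs.continuous.comp (by fun_prop)
      have h2 := hu.continuous
      refine ((hf.continuous_fderiv (by simp)).comp h1).clm_apply ?_
      have h3 : Continuous fun θ => reForm Φ ζ₀ (u θ) := (reForm Φ ζ₀).continuous.comp h2
      fun_prop
    have hper : ∫ θ in (0 : ℝ)..2 * Real.pi, fderiv ℝ f (Q ((r, τ), θ))
        (r • Complex.I • u θ, -((2 * r : ℝ) • reForm Φ ζ₀ (u θ))) = 0 := by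
      rw [intervalIntegral.integral_eq_sub_of_hasDerivAt (fun θ _ => hθ r τ θ)
        (hLc.intervalIntegrable _ _)]
      have : u (2 * Real.pi) = u 0 := by
        simp only [u]
        congr 1
        push_cast
        rw [Complex.exp_two_pi_mul_I]; simp
      simp only [G, hQ, this, sub_self]
    refine mul_left_cancel₀ hr' ?_
    rw [← intervalIntegral.integral_const_mul]
    simp only [hid]
    rw [intervalIntegral.integral_sub
      (((hv (0, 1)).const_mul _).intervalIntegrable _ _)
      ((hLc.const_mul _).intervalIntegrable _ _), intervalIntegral.integral_const_mul,
      intervalIntegral.integral_const_mul, hper]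
    ring
  · have hc : ∀ θ : ℝ, G ((0, τ), θ) = H τ := fun θ => by
      simp only [G, hQ, zero_smul, map_zero, smul_zero, add_zero, ← h0, e]
    simp only [hc]
    rw [intervalIntegral.integral_const, sub_zero]
    simp

end Forms

end

end QuadraticCR

namespace QuadraticCR

noncomputable section

set_option linter.unusedSectionVars false

/-! ### Uniform seminorm bounds over compact parameter sets -/

section Families

variable {V : Type*} [NormedAddCommGroup V] [NormedSpace ℝ V]

theorem exists_uniform_schwartz_bound {Z : Type*} [TopologicalSpace Z] {A : Z → 𝓢(V, ℂ)}
    (hA : Continuous A) {C : Set Z} (hC : IsCompact C) (N : ℕ) :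
    ∃ B : ℝ, 0 ≤ B ∧ ∀ z ∈ C, ∀ k ≤ N, ∀ l ≤ N, ∀ x,
      (1 + ‖x‖) ^ k * ‖iteratedFDeriv ℝ l (A z) x‖ ≤ B := by
  let s : Finset (ℕ × ℕ) := Finset.Iic (N, N)
  let σ : 𝓢(V, ℂ) → ℝ := fun φ => ∑ m ∈ s, SchwartzMap.seminorm ℂ m.1 m.2 φ
  have hσ : Continuous σ := continuous_finsetSum _ fun m _ =>
    (schwartz_withSeminorms ℂ V ℂ).continuous_seminorm m
  obtain ⟨B, hB⟩ := (hC.image (hσ.comp hA)).bddAbove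
  refine ⟨2 ^ N * max B 0, by positivity, fun z hz k hk l hl x => ?_⟩
  have h1 := SchwartzMap.one_add_le_sup_seminorm_apply (𝕜 := ℂ) (m := (N, N)) hk hl (A z) x
  have h2 := Seminorm.finset_sup_le_sum (fun m : ℕ × ℕ => SchwartzMap.seminorm ℂ (E := V)
    (F := ℂ) m.1 m.2) s (A z)
  have h4 : (∑ m ∈ s, SchwartzMap.seminorm ℂ (E := V) (F := ℂ) m.1 m.2) (A z) = σ (A z) := by
    rw [← FunLike.coeAddMonoidHom_apply, map_sum, Finset.sum_apply]; rfl
  rw [h4] at h2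
  have h3 : σ (A z) ≤ max B 0 := (hB ⟨z, hz, rfl⟩).trans (le_max_left _ _)
  refine h1.trans ?_
  gcongr
  exact h2.trans h3

end Families

/-! ### Parameter integrals and multiplication of the Fourier transform -/

section Param

variable {F : Type*} [NormedAddCommGroup F] [InnerProductSpace ℝ F] [FiniteDimensional ℝ F]
  [MeasurableSpace F] [BorelSpace F]

/-- The entire function `s ↦ (exp s - 1) / s`. -/
def expQuot : ℂ → ℂ := dslope Complex.exp 0

theorem contDiff_expQuot : ContDiff ℝ ∞ expQuot := by
  have h : DifferentiableOn ℂ expQuot Set.univ :=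
    (Complex.differentiableOn_dslope univ_mem).2 Complex.differentiable_exp.differentiableOn
  exact ((differentiableOn_univ.1 h).contDiff (n := ∞)).restrict_scalars ℝ

theorem mul_expQuot (s : ℂ) : s * expQuot s = Complex.exp s - 1 := by
  have := sub_smul_dslope Complex.exp 0 s
  simpa [expQuot] using this

theorem expQuot_zero : expQuot 0 = 1 := by
  simp [expQuot, dslope_same]

/-- The difference quotient at increment `h` is itself a test function `B h`, written with the
entire function `expQuot`. It is therefore smooth through `h = 0`, and convergence in the Schwartz
space is continuity of `B`. -/
theorem hasDerivAt_apply_mul_exp (S : 𝓢'(F, ℂ)) {a : F → ℂ} (ha : ContDiff ℝ ∞ a)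
    (has : HasCompactSupport a) {l : F → ℂ} (hl : ContDiff ℝ ∞ l) {A : ℂ → 𝓢(F, ℂ)}
    (hA : ∀ z ξ, A z ξ = a ξ * Complex.exp (z * l ξ)) (z : ℂ) {A' : 𝓢(F, ℂ)}
    (hA' : ∀ ξ, A' ξ = a ξ * Complex.exp (z * l ξ) * l ξ) :
    HasDerivAt (fun z => S (A z)) (S A') z := by
  let β : ℂ × F → ℂ := fun q => a q.2 * Complex.exp (z * l q.2) * l q.2 * expQuot (q.1 * l q.2)
  have hβ : ContDiff ℝ ∞ β := by
    have h1 : ContDiff ℝ ∞ fun q : ℂ × F => l q.2 := hl.comp contDiff_snd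
    exact (((ha.comp contDiff_snd).mul (contDiff_const.mul h1).cexp).mul h1).mul
      (contDiff_expQuot.comp (contDiff_fst.mul h1))
  let B : ℂ → 𝓢(F, ℂ) := fun h => HasCompactSupport.toSchwartzMap (f := fun ξ => β (h, ξ))
    (has.mul_right.mul_right.mul_right) (hβ.comp (contDiff_const.prodMk contDiff_id))
  have hB : ∀ h ξ, B h ξ = β (h, ξ) := fun _ _ => rfl
  have hBc : Continuous B := continuous_schwartz_of_contDiff hβ has.isCompact (fun h ξ hξ => by
    simp [β, image_eq_zero_of_notMem_tsupport hξ]) hB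
  have hB0 : B 0 = A' := by
    ext ξ; rw [hB, hA']; simp [β, expQuot_zero]
  have hsub : ∀ h, A (z + h) - A z = h • B h := by
    intro h
    ext ξ
    rw [sub_apply, smul_apply, hA, hA, hB, smul_eq_mul]
    have := mul_expQuot (h * l ξ)
    simp only [β]
    rw [add_mul, Complex.exp_add]
    linear_combination (-a ξ * Complex.exp (z * l ξ)) * this
  rw [hasDerivAt_iff_tendsto_slope_zero]
  have h1 : Tendsto (fun h => S (B h)) (𝓝[≠] 0) (𝓝 (S A')) := by
    rw [← hB0]
    exact (((S : 𝓢(F, ℂ) →L[ℂ] ℂ).continuous.comp hBc).tendsto 0).mono_left nhdsWithin_le_nhds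
  refine h1.congr' ?_
  filter_upwards [self_mem_nhdsWithin] with h hh
  have h2 : S (A (z + h)) - S (A z) = h • S (B h) := by rw [← map_sub, hsub, map_smul]
  rw [h2, smul_smul, inv_mul_cancel₀ hh, one_smul]

/-- The integral is a convolution with the constant `1`, evaluated at `0`, so smoothness of
convolutions with a parameter applies. -/
theorem contDiff_integral_of_hasCompactSupport {Z : Type*} [NormedAddCommGroup Z]
    [NormedSpace ℝ Z] [MeasurableSpace Z] [BorelSpace Z] [SecondCountableTopology Z]
    {μ : Measure Z} [IsLocallyFiniteMeasure μ]
    {c : Z → ℂ} (hc : ContDiff ℝ ∞ c) (hcs : HasCompactSupport c) {a : Z × F → ℂ}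
    (ha : ContDiff ℝ ∞ a) : ContDiff ℝ ∞ (fun ξ => ∫ z, c z * a (z, ξ) ∂μ) := by
  have h := contDiffOn_convolution_right_with_param (𝕜 := ℝ) (μ := μ) (n := ⊤) (f := fun _ : Z => (1 : ℂ))
    (ContinuousLinearMap.mul ℝ ℂ) (g := fun (ξ : F) z => c (-z) * a (-z, ξ)) (s := Set.univ)
    (k := -tsupport c) isOpen_univ hcs.isCompact.neg (fun ξ z _ hz => by
      rw [image_eq_zero_of_notMem_tsupport (f := c) (by simpa using hz), zero_mul])
    (locallyIntegrable_const _) (ContDiff.contDiffOn (by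
      exact (hc.comp contDiff_snd.neg).mul (ha.comp (contDiff_snd.neg.prodMk contDiff_fst))))
  rw [Set.univ_prod_univ, contDiffOn_univ] at h
  have h2 := h.comp (contDiff_id.prodMk (contDiff_const (c := (0 : Z))))
  convert h2 using 1
  ext ξ
  simp [convolution]

variable {K : Set F} {g : F → ℂ} {S : 𝓢'(F, ℂ)}

theorem fourier_integral_eq {Z : Type*} [NormedAddCommGroup Z]
    [NormedSpace ℝ Z] [MeasurableSpace Z] [BorelSpace Z] [SecondCountableTopology Z]
    {μ : Measure Z} [IsLocallyFiniteMeasure μ] [SFinite μ]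
    {c : Z → ℂ} (hc : Continuous c) (hcs : HasCompactSupport c) {a : Z × F → ℂ}
    (ha : Continuous a) {C : Set F} (hC : IsCompact C) (has : ∀ z, ∀ ξ ∉ C, a (z, ξ) = 0) (t : F) :
    𝓕 (fun ξ => ∫ z, c z * a (z, ξ) ∂μ) t = ∫ z, c z * 𝓕 (fun ξ => a (z, ξ)) t ∂μ := by
  simp only [fourier_eq_integral_eChar, ← integral_const_mul]
  have h : Continuous (Function.uncurry fun (ξ : F) (z : Z) => eChar (-t) ξ * (c z * a (z, ξ))) := by
    have := (contDiff_eChar (-t)).continuous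
    simp only [Function.uncurry_def]
    fun_prop
  rw [integral_integral_swap_of_hasCompactSupport h]
  · congr 1; ext z; congr 1; ext ξ; ring
  · refine HasCompactSupport.intro (hC.prod hcs.isCompact) fun q hq => ?_
    simp only [Set.mem_prod, not_and_or] at hq
    rcases hq with hq | hq
    · simp [Function.uncurry_def, has _ _ hq]
    · simp [Function.uncurry_def, image_eq_zero_of_notMem_tsupport hq]

/-- `S` passes under the integral by Fubini in its integral formula: `g` grows polynomially, and the
transforms of `A z` decay uniformly for `z` in the support of `c`. -/
theorem Band.apply_integral_eq (hB : Band K g S) {Z : Type*} [NormedAddCommGroup Z]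
    [NormedSpace ℝ Z] [MeasurableSpace Z] [BorelSpace Z] [SecondCountableTopology Z]
    {μ : Measure Z} [IsLocallyFiniteMeasure μ] [SFinite μ]
    {c : Z → ℂ} (hc : Continuous c) (hcs : HasCompactSupport c) {a : Z × F → ℂ}
    (ha : ContDiff ℝ ∞ a) {C : Set F} (hC : IsCompact C) (has : ∀ z, ∀ ξ ∉ C, a (z, ξ) = 0)
    {A : Z → 𝓢(F, ℂ)} (hA : ∀ z ξ, A z ξ = a (z, ξ)) {b : 𝓢(F, ℂ)}
    (hb : ∀ ξ, b ξ = ∫ z, c z * a (z, ξ) ∂μ) : S b = ∫ z, c z * S (A z) ∂μ := by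
  have hAc : Continuous A := continuous_schwartz_of_contDiff ha hC has hA
  let Â : Z → 𝓢(F, ℂ) := fun z => 𝓕 (A z)
  have hÂc : Continuous Â := (FourierTransform.fourierCLM ℂ 𝓢(F, ℂ)).continuous.comp hAc
  have hÂ : ∀ z t, Â z t = 𝓕 (A z : F → ℂ) t := fun z t => by
    rw [← SchwartzMap.fourier_coe]
  obtain ⟨C₁, hC₁, M, hM⟩ := hB.growth
  set N := M + Module.finrank ℝ F + 1 with hN
  obtain ⟨B, hB0, hBd⟩ := exists_uniform_schwartz_bound hÂc hcs.isCompact N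
  obtain ⟨Bc, hBc⟩ := hcs.exists_bound_of_continuous hc
  have hev : Continuous fun q : F × Z => Â q.2 q.1 := by
    have h1 : Continuous fun z => (SchwartzMap.toBoundedContinuousFunctionCLM ℂ F ℂ) (Â z) :=
      (SchwartzMap.toBoundedContinuousFunctionCLM ℂ F ℂ).continuous.comp hÂc
    have h2 : Continuous fun q : F × Z =>
        (SchwartzMap.toBoundedContinuousFunctionCLM ℂ F ℂ) (Â q.2) q.1 :=
      (h1.comp continuous_snd).eval continuous_fst
    exact h2
  rw [hB.pair, show (b : F → ℂ) = fun ξ => ∫ z, c z * a (z, ξ) ∂μ from funext hb]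
  simp only [fourier_integral_eq hc hcs ha.continuous hC has, ← integral_const_mul]
  rw [integral_integral_swap]
  · refine integral_congr_ae (ae_of_all _ fun z => ?_)
    simp only
    rw [hB.pair, ← integral_const_mul]
    congr 1; ext t
    rw [show (A z : F → ℂ) = fun ξ => a (z, ξ) from funext (hA z)]
    ring
  · have h1 : Integrable (fun t : F => (1 + ‖t‖) ^ M * ((1 + ‖t‖) ^ N)⁻¹) := by
      refine (integrable_inv_one_add_norm_pow (F := F) (N := Module.finrank ℝ F + 1)
        (by omega)).congr (ae_of_all _ fun t => ?_)
      have : 0 < 1 + ‖t‖ := by positivity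
      simp only
      rw [hN, add_assoc, pow_add _ M]; field_simp
    have h2 : Integrable (fun z => ‖c z‖) μ := (hc.integrable_of_hasCompactSupport hcs).norm
    refine ((h1.const_mul (C₁ * B)).mul_prod h2).mono' ?_ (ae_of_all _ fun q => ?_)
    · have h3 := hB.cont
      have h4 : (Function.uncurry fun (t : F) (z : Z) =>
          g t * (c z * 𝓕 (fun ξ => a (z, ξ)) t)) = fun q : F × Z => g q.1 * (c q.2 * Â q.2 q.1) := by
        ext q
        rw [hÂ, show (A q.2 : F → ℂ) = fun ξ => a (q.2, ξ) from funext (hA q.2)]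
        rfl
      rw [h4]
      exact ((h3.comp continuous_fst).mul ((hc.comp continuous_snd).mul hev)).aestronglyMeasurable
    · obtain ⟨t, z⟩ := q
      simp only [Function.uncurry_apply_pair, norm_mul]
      by_cases hz : z ∈ tsupport c
      · have h5 := hBd z hz N le_rfl 0 (Nat.zero_le _) t
        rw [norm_iteratedFDeriv_zero, hÂ,
          show (A z : F → ℂ) = fun ξ => a (z, ξ) from funext (hA z)] at h5
        have h6 : ‖𝓕 (fun ξ => a (z, ξ)) t‖ ≤ B * ((1 + ‖t‖) ^ N)⁻¹ := by
          rw [← div_eq_mul_inv, le_div_iff₀ (by positivity), mul_comm]; exact h5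
        calc ‖g t‖ * (‖c z‖ * ‖𝓕 (fun ξ => a (z, ξ)) t‖)
            ≤ (C₁ * (1 + ‖t‖) ^ M) * (‖c z‖ * (B * ((1 + ‖t‖) ^ N)⁻¹)) := by
              gcongr; exact hM t
          _ = _ := by ring
      · simp [image_eq_zero_of_notMem_tsupport hz]

/-- Multiplication of the Fourier transform by a test function. -/
def mulDist (R : 𝓢(F, ℂ)) (S : 𝓢'(F, ℂ)) : 𝓢'(F, ℂ) :=
  TemperedDistribution.smulLeftCLM ℂ (R : F → ℂ) S

theorem mulDist_apply (R : 𝓢(F, ℂ)) {a b : 𝓢(F, ℂ)} (h : ∀ ξ, b ξ = R ξ * a ξ) :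
    mulDist R S a = S b := by
  rw [mulDist, TemperedDistribution.smulLeftCLM_apply_apply]
  congr 1
  ext ξ
  rw [SchwartzMap.smulLeftCLM_apply_apply R.hasTemperateGrowth, h, smul_eq_mul]

theorem fourier_mul_eq_integral (R a : 𝓢(F, ℂ)) (t : F) :
    𝓕 (fun ξ => R ξ * a ξ) t = ∫ s, 𝓕 (a : F → ℂ) s * 𝓕 (R : F → ℂ) (t - s) := by
  have h1 : ∀ s, 𝓕 (R : F → ℂ) (t - s) = ∫ ξ, eChar (-t) ξ * (eChar s ξ * R ξ) := fun s => by
    rw [fourier_eq_integral_eChar]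
    congr 1; ext ξ; rw [← mul_assoc, ← eChar_add]; congr 2; abel
  have h2 : ∀ ξ, a ξ = ∫ s, eChar s ξ * 𝓕 (a : F → ℂ) s := fun ξ => by
    have h3 : 𝓕⁻ (𝓕 (a : F → ℂ)) ξ = a ξ := by
      have := congrArg (fun φ : 𝓢(F, ℂ) => φ ξ) (FourierTransform.fourierInv_fourier_eq (F := 𝓢(F, ℂ)) a)
      simp only [SchwartzMap.fourierInv_coe, SchwartzMap.fourier_coe] at this
      exact this
    rw [← h3, fourierInv_eq_integral_eChar]
    simp only [eChar_comm ξ]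
  have hâ : Integrable (fun s => 𝓕 (a : F → ℂ) s) := by
    rw [← SchwartzMap.fourier_coe]; exact SchwartzMap.integrable _
  have hRi : Integrable (fun ξ => R ξ) := R.integrable
  simp only [h1, ← integral_const_mul]
  rw [integral_integral_swap, fourier_eq_integral_eChar]
  · congr 1; ext ξ
    rw [h2 ξ, ← integral_const_mul, ← integral_const_mul]
    congr 1; ext s; ring
  · refine (hâ.norm.mul_prod hRi.norm).mono' ?_ (ae_of_all _ fun q => ?_)
    · have h4 : Continuous (fun s => 𝓕 (a : F → ℂ) s) := by
        rw [← SchwartzMap.fourier_coe]; exact SchwartzMap.continuous _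
      have h5 := (contDiff_eChar (F := F) (-t)).continuous
      have h6 := continuous_eChar_uncurry (F := F)
      have h7 := R.continuous
      refine Continuous.aestronglyMeasurable ?_
      simp only [Function.uncurry_def]
      fun_prop
    · simp [Function.uncurry_def, norm_eChar]

/-- Fourier multipliers preserve the band. With `R` equal to `P ^ k` near the spectrum this makes
`P(-i∂_F)^k f` eligible for the slice estimates; the integral formula is the convolution theorem
followed by Fubini. -/
theorem Band.mulDist (hB : Band K g S) {R : 𝓢(F, ℂ)} (hR : HasCompactSupport (R : F → ℂ))
    {A : F → 𝓢(F, ℂ)} (hA : ∀ x ξ, A x ξ = R ξ * eChar x ξ) :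
    Band K (fun x => S (A x)) (mulDist R S) := by
  have hAc : Continuous A := by
    refine continuous_schwartz_of_contDiff (a := fun q : F × F => R q.2 * eChar q.1 q.2)
      (((R.smooth ⊤).comp contDiff_snd).mul contDiff_eChar_uncurry) hR.isCompact
      (fun z ξ hξ => ?_) hA
    simp [image_eq_zero_of_notMem_tsupport hξ]
  have hval : ∀ x, S (A x) = ∫ t, g t * 𝓕 (R : F → ℂ) (t - x) := fun x => by
    rw [hB.pair, show (A x : F → ℂ) = _ from funext (hA x)]
    simp only [fourier_mul_eChar]
  obtain ⟨C, hC, M, hgC⟩ := hB.growth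
  refine ⟨(S : 𝓢(F, ℂ) →L[ℂ] ℂ).continuous.comp hAc, ?_, fun a => ?_, fun a ha => ?_,
    fun a x ⟨O, hO, hKO, h⟩ => ?_⟩
  · obtain ⟨C', hC', M', h'⟩ := temperedDistribution_translate_bound (𝓕⁻ S : 𝓢'(F, ℂ)) (𝓕 R)
    refine ⟨C', hC', M', fun x => ?_⟩
    rw [← FourierTransform.fourier_fourierInv_eq (F := 𝓢'(F, ℂ)) S, TemperedDistribution.fourier_apply,
      fourier_translate R (A x) x (hA x)]
    exact h' x
  · let Ra : 𝓢(F, ℂ) := SchwartzMap.smulLeftCLM ℂ (R : F → ℂ) a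
    have hRa : ∀ ξ, Ra ξ = R ξ * a ξ := fun ξ => by
      rw [SchwartzMap.smulLeftCLM_apply_apply R.hasTemperateGrowth, smul_eq_mul]
    rw [mulDist_apply R hRa, hB.pair, show (Ra : F → ℂ) = _ from funext hRa]
    simp only [fourier_mul_eq_integral, hval, ← integral_const_mul, ← integral_mul_const]
    rw [integral_integral_swap]
    · congr 1; ext s; congr 1; ext t; ring
    obtain ⟨B₁, hB₁, hd₁⟩ := schwartz_one_add_decay (𝓕 a) (M + (Module.finrank ℝ F + 1))
    obtain ⟨B₂, hB₂, hd₂⟩ := schwartz_one_add_decay (𝓕 R) (M + (Module.finrank ℝ F + 1))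
    have hi := integrable_inv_one_add_norm_pow (F := F) (N := Module.finrank ℝ F + 1) (by omega)
    have hconv := hi.convolution_integrand (ContinuousLinearMap.mul ℝ ℝ) hi
    have hcg := hB.cont
    have h4 : Continuous (fun s => 𝓕 (a : F → ℂ) s) := by
      rw [← SchwartzMap.fourier_coe]; exact SchwartzMap.continuous _
    have h5 : Continuous (fun s => 𝓕 (R : F → ℂ) s) := by
      rw [← SchwartzMap.fourier_coe]; exact SchwartzMap.continuous _
    refine (hconv.const_mul (C * B₁ * B₂)).mono' ?_ (ae_of_all _ fun q => ?_)
    · refine Continuous.aestronglyMeasurable ?_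
      simp only [Function.uncurry_def]
      fun_prop
    · obtain ⟨t, s⟩ := q
      have e1 := hd₁ s
      have e2 := hd₂ (t - s)
      rw [SchwartzMap.fourier_coe] at e1 e2
      set n := Module.finrank ℝ F + 1
      have e3 : ‖𝓕 (a : F → ℂ) s‖ ≤ B₁ * ((1 + ‖s‖) ^ (M + n))⁻¹ := by
        rw [← div_eq_mul_inv, le_div_iff₀ (by positivity), mul_comm]; exact e1
      have e4 : ‖𝓕 (R : F → ℂ) (t - s)‖ ≤ B₂ * ((1 + ‖t - s‖) ^ (M + n))⁻¹ := by
        rw [← div_eq_mul_inv, le_div_iff₀ (by positivity), mul_comm]; exact e2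
      have e5 : (1 + ‖t‖) ^ M ≤ (1 + ‖s‖) ^ M * (1 + ‖t - s‖) ^ M := by
        rw [← mul_pow]; gcongr; exact one_add_norm_le_mul _ _
      simp only [Function.uncurry_apply_pair, norm_mul, ContinuousLinearMap.mul_apply']
      calc ‖g t‖ * (‖𝓕 (a : F → ℂ) s‖ * ‖𝓕 (R : F → ℂ) (t - s)‖)
          ≤ (C * ((1 + ‖s‖) ^ M * (1 + ‖t - s‖) ^ M)) *
            ((B₁ * ((1 + ‖s‖) ^ (M + n))⁻¹) * (B₂ * ((1 + ‖t - s‖) ^ (M + n))⁻¹)) := by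
            gcongr
            exact (hgC t).trans (by gcongr)
        _ = _ := by
          have : 0 < 1 + ‖t - s‖ := by positivity
          have h6 : ∀ X : ℝ, 0 < X → X ^ M * (X ^ (M + n))⁻¹ = (X ^ n)⁻¹ := fun X hX => by
            rw [pow_add]; field_simp
          rw [← h6 _ this, ← h6 (1 + ‖s‖) (by positivity)]
          ring
  · let Ra : 𝓢(F, ℂ) := SchwartzMap.smulLeftCLM ℂ (R : F → ℂ) a
    have hRa : ∀ ξ, Ra ξ = R ξ * a ξ := fun ξ => by
      rw [SchwartzMap.smulLeftCLM_apply_apply R.hasTemperateGrowth, smul_eq_mul]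
    rw [mulDist_apply R hRa]
    have hsub : Function.support (Ra : F → ℂ) ⊆ Function.support (a : F → ℂ) := fun ξ hξ h0 =>
      hξ (by rw [hRa, h0, mul_zero])
    exact hB.supp _ (ha.mono_left (closure_mono hsub))
  · let Ra : 𝓢(F, ℂ) := SchwartzMap.smulLeftCLM ℂ (R : F → ℂ) a
    have hRa : ∀ ξ, Ra ξ = R ξ * a ξ := fun ξ => by
      rw [SchwartzMap.smulLeftCLM_apply_apply R.hasTemperateGrowth, smul_eq_mul]
    rw [mulDist_apply R hRa]
    exact eq_of_eqOn_nhds hB.supp hO hKO fun ξ hξ => by rw [hA, hRa, h ξ hξ]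

end Param

end

end QuadraticCR

namespace QuadraticCR

noncomputable section

set_option linter.unusedSectionVars false

/-! ### Invariance of Lebesgue measure on `E` -/

section Haar

variable {E : Type*} [NormedAddCommGroup E] [InnerProductSpace ℂ E] [FiniteDimensional ℂ E]
  [MeasurableSpace E] [BorelSpace E]

instance : (lebesgueComplex E).IsAddHaarMeasure := by
  let _ : InnerProductSpace ℝ E := InnerProductSpace.complexToReal
  have : FiniteDimensional ℝ E := FiniteDimensional.complexToReal E
  exact (inferInstance : (volume : Measure E).IsAddHaarMeasure)

instance : SecondCountableTopology E :=
  haveI : ProperSpace E := FiniteDimensional.proper ℂ E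
  inferInstance

theorem measurePreserving_smul_lebesgueComplex {c : ℂ} (hc : ‖c‖ = 1) :
    MeasurePreserving (fun w : E => c • w) (lebesgueComplex E) (lebesgueComplex E) := by
  let _ : InnerProductSpace ℝ E := InnerProductSpace.complexToReal
  have : FiniteDimensional ℝ E := FiniteDimensional.complexToReal E
  have hc0 : c ≠ 0 := fun h => by simp [h] at hc
  let e : E ≃ₗᵢ[ℝ] E :=
    { (LinearEquiv.smulOfNeZero ℂ E c hc0).restrictScalars ℝ with
      norm_map' := fun w => by
        change ‖c • w‖ = ‖w‖
        rw [norm_smul, hc, one_mul] }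
  exact e.measurePreserving

end Haar

/-! ### Group averages as Fourier multipliers -/

section Average

variable {E F : Type*} [NormedAddCommGroup E] [InnerProductSpace ℂ E] [FiniteDimensional ℂ E]
  [MeasurableSpace E] [BorelSpace E]
  [NormedAddCommGroup F] [InnerProductSpace ℝ F] [FiniteDimensional ℝ F]
  [MeasurableSpace F] [BorelSpace F]
  {Φ : E →ₗ[ℂ] E →ₗ⋆[ℂ] (ℂ ⊗[ℝ] F)}

instance : SFinite (lebesgueN E F) := by unfold lebesgueN; infer_instance

instance : (lebesgueN E F).IsAddHaarMeasure := by unfold lebesgueN; infer_instance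

/-- Band limitation supplies the entire extension `z ↦ S (B z)` needed by `integral_circle_eq`. At
`z = i` the oscillating exponential becomes the real factor `exp(-2π ⟨ξ, Φ(w, w)⟩)`. -/
theorem circle_integral_eq_apply (hΦ : IsHermitianMap Φ) {f : E × F → ℂ} (hf : ContDiff ℝ ∞ f)
    (hcr : IsCR Φ f) {ζ : E} {K O : Set F} {S : 𝓢'(F, ℂ)} (hS : Band K (fun x => f (ζ, x)) S)
    {ψ : F → ℂ} (hψ : ContDiff ℝ ∞ ψ) (hψs : HasCompactSupport ψ) (hO : IsOpen O) (hKO : K ⊆ O)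
    (hψ1 : ∀ ξ ∈ O, ψ ξ = 1) (w : E) (x : F) {A : 𝓢(F, ℂ)}
    (hA : ∀ ξ, A ξ = ψ ξ * eChar x ξ *
      Complex.exp (((-(2 * Real.pi * inner ℝ ξ (reForm Φ w w)) : ℝ) : ℂ))) :
    ∫ θ in (0 : ℝ)..2 * Real.pi, f (ζ + Complex.exp (θ * Complex.I) • w,
      x + (2 : ℝ) • imForm Φ ζ (Complex.exp (θ * Complex.I) • w)) = 2 * Real.pi * S A := by
  set e := reForm Φ w w with he
  let l : F → ℂ := fun ξ => ((2 * Real.pi * inner ℝ ξ e : ℝ) : ℂ) * Complex.I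
  have hl : ContDiff ℝ ∞ l := ContDiff.mul
    (Complex.ofRealCLM.contDiff.comp (contDiff_const.mul (contDiff_id.inner ℝ contDiff_const)))
    contDiff_const
  have ha : ContDiff ℝ ∞ fun ξ => ψ ξ * eChar x ξ := hψ.mul (contDiff_eChar x)
  have has : HasCompactSupport fun ξ => ψ ξ * eChar x ξ := hψs.mul_right
  let B : ℂ → 𝓢(F, ℂ) := fun z => HasCompactSupport.toSchwartzMap
    (f := fun ξ => ψ ξ * eChar x ξ * Complex.exp (z * l ξ)) has.mul_right
      (ha.mul (contDiff_const.mul hl).cexp)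
  let B' : ℂ → 𝓢(F, ℂ) := fun z => HasCompactSupport.toSchwartzMap
    (f := fun ξ => ψ ξ * eChar x ξ * Complex.exp (z * l ξ) * l ξ) has.mul_right.mul_right
      ((ha.mul (contDiff_const.mul hl).cexp).mul hl)
  have hB : ∀ z ξ, B z ξ = ψ ξ * eChar x ξ * Complex.exp (z * l ξ) := fun _ _ => rfl
  have hd : Differentiable ℂ fun z => S (B z) := fun z =>
    (hasDerivAt_apply_mul_exp S ha has hl hB z (A' := B' z) fun _ => rfl).differentiableAt
  have hBI : B Complex.I = A := by
    ext ξ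
    rw [hB, hA]
    congr 2
    simp only [l]
    push_cast
    linear_combination (2 * Real.pi * (inner ℝ ξ e : ℂ)) * Complex.I_mul_I
  rw [← hBI]
  refine integral_circle_eq hΦ hf hcr ζ w x hd fun τ => ?_
  refine hS.repr (B τ) (x + τ • e) ⟨O, hO, hKO, fun ξ hξ => ?_⟩
  rw [hB, hψ1 ξ hξ, one_mul, eChar_add]
  congr 1
  simp only [l, eChar, inner_smul_right]
  congr 1; push_cast; ring

/-- The average of `f` over the translates of a neighbourhood of the origin. -/
def groupAverage (Φ : E →ₗ[ℂ] E →ₗ⋆[ℂ] (ℂ ⊗[ℝ] F)) (c : E × F → ℂ) (f : E × F → ℂ)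
    (ζ : E) (x : F) : ℂ :=
  ∫ z, c z * f (ζ + z.1, x + z.2 + (2 : ℝ) • imForm Φ ζ z.1) ∂lebesgueN E F

theorem continuous_groupAverage {c f : E × F → ℂ} (hc : Continuous c) (hcs : HasCompactSupport c)
    (hf : Continuous f) : Continuous fun q : E × F => groupAverage Φ c f q.1 q.2 := by
  have h : ∀ q : E × F, groupAverage Φ c f q.1 q.2 = ∫ z in tsupport c,
      c z * f (q.1 + z.1, q.2 + z.2 + (2 : ℝ) • imForm Φ q.1 z.1) ∂lebesgueN E F := fun q => by
    rw [setIntegral_eq_integral_of_forall_compl_eq_zero fun z hz => by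
      rw [image_eq_zero_of_notMem_tsupport hz, zero_mul]]
    rfl
  simp only [h]
  refine continuous_parametric_integral_of_continuous ?_ hcs.isCompact
  simp only [Function.uncurry_def]
  have h1 : Continuous fun p : (E × F) × (E × F) => imForm Φ p.1.1 p.2.1 :=
    ((imForm Φ).continuous.comp (continuous_fst.comp continuous_fst)).clm_apply
      (continuous_fst.comp continuous_snd)
  fun_prop

theorem integral_mul_comp_smul {c : E × F → ℂ}
    (hrot : ∀ (u : ℂ), ‖u‖ = 1 → ∀ w x, c (u • w, x) = c (w, x)) {f : E × F → ℂ}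
    {u : ℂ} (hu : ‖u‖ = 1) (ζ : E) (x : F) :
    ∫ z, c z * f (ζ + u • z.1, x + z.2 + (2 : ℝ) • imForm Φ ζ (u • z.1)) ∂lebesgueN E F =
      groupAverage Φ c f ζ x := by
  have hmp : MeasurePreserving (Prod.map (fun w : E => u • w) (id : F → F))
      (lebesgueN E F) (lebesgueN E F) :=
    (measurePreserving_smul_lebesgueComplex hu).prod (MeasurePreserving.id _)
  have hu0 : u ≠ 0 := fun h => by simp [h] at hu
  have hme : MeasurableEmbedding (Prod.map (fun w : E => u • w) (id : F → F)) :=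
    ((Homeomorph.smulOfNeZero u hu0).prodCongr (Homeomorph.refl F)).measurableEmbedding
  rw [groupAverage, ← hmp.integral_comp hme
    (fun z => c z * f (ζ + z.1, x + z.2 + (2 : ℝ) • imForm Φ ζ z.1))]
  congr 1; ext z
  rw [show c z = c (z.1, z.2) from rfl, ← hrot u hu]
  rfl

/-- Rotation invariance of `c` allows a further average over the rotations `e^{iθ}`. After Fubini
each `z` contributes a circle mean, that is, a multiplier on `S` not depending on `ζ`. -/
theorem groupAverage_eq_apply (hΦ : IsHermitianMap Φ) {f : E × F → ℂ} (hf : ContDiff ℝ ∞ f)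
    (hcr : IsCR Φ f) {ζ : E} {K O : Set F} {S : 𝓢'(F, ℂ)} (hS : Band K (fun x => f (ζ, x)) S)
    {ψ : F → ℂ} (hψ : ContDiff ℝ ∞ ψ) (hψs : HasCompactSupport ψ) (hO : IsOpen O) (hKO : K ⊆ O)
    (hψ1 : ∀ ξ ∈ O, ψ ξ = 1) {c : E × F → ℂ} (hc : Continuous c) (hcs : HasCompactSupport c)
    (hrot : ∀ (u : ℂ), ‖u‖ = 1 → ∀ w x, c (u • w, x) = c (w, x)) (x : F) {B : 𝓢(F, ℂ)}
    (hB : ∀ ξ, B ξ = ψ ξ * (∫ z, c z * (eChar z.2 ξ *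
      Complex.exp (((-(2 * Real.pi * inner ℝ ξ (reForm Φ z.1 z.1)) : ℝ) : ℂ))) ∂lebesgueN E F) *
      eChar x ξ) :
    groupAverage Φ c f ζ x = S B := by
  let a : (E × F) × F → ℂ := fun q => ψ q.2 * eChar (x + q.1.2) q.2 *
      Complex.exp (((-(2 * Real.pi * inner ℝ q.2 (reForm Φ q.1.1 q.1.1)) : ℝ) : ℂ))
  have hre : ContDiff ℝ ∞ fun q : (E × F) × F => reForm Φ q.1.1 q.1.1 :=
    ((reForm Φ).contDiff.comp (contDiff_fst.comp contDiff_fst)).clm_apply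
      (contDiff_fst.comp contDiff_fst)
  have ha : ContDiff ℝ ∞ a := by
    refine ((hψ.comp contDiff_snd).mul (contDiff_eChar_uncurry.comp
      ((contDiff_const.add (contDiff_snd.comp contDiff_fst)).prodMk contDiff_snd))).mul ?_
    exact (Complex.ofRealCLM.contDiff.comp
      (contDiff_const.mul (contDiff_snd.inner ℝ hre)).neg).cexp
  let A : E × F → 𝓢(F, ℂ) := fun z => HasCompactSupport.toSchwartzMap (f := fun ξ => a (z, ξ))
    (hψs.mul_right.mul_right) (ha.comp (contDiff_const.prodMk contDiff_id))
  have hA : ∀ z ξ, A z ξ = a (z, ξ) := fun _ _ => rfl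
  have hSB : S B = ∫ z, c z * S (A z) ∂lebesgueN E F := by
    refine hS.apply_integral_eq hc hcs ha hψs.isCompact (fun z ξ hξ => ?_) hA fun ξ => ?_
    · simp [a, image_eq_zero_of_notMem_tsupport hξ]
    · rw [hB, mul_right_comm, ← integral_const_mul]
      congr 1; ext z
      simp only [a, eChar_add]
      ring
  have hcirc : ∀ z : E × F, ∫ θ in (0 : ℝ)..2 * Real.pi, f (ζ + Complex.exp (θ * Complex.I) • z.1,
      x + z.2 + (2 : ℝ) • imForm Φ ζ (Complex.exp (θ * Complex.I) • z.1)) =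
      2 * Real.pi * S (A z) := fun z =>
    circle_integral_eq_apply hΦ hf hcr hS hψ hψs hO hKO hψ1 z.1 (x + z.2) (hA z)
  have hpi : (2 * Real.pi : ℂ) ≠ 0 := by
    exact_mod_cast (by positivity : (2 * Real.pi : ℝ) ≠ 0)
  refine mul_left_cancel₀ hpi ?_
  rw [hSB, ← integral_const_mul]
  calc (2 * Real.pi : ℂ) * groupAverage Φ c f ζ x
      = ∫ θ in (0 : ℝ)..2 * Real.pi, groupAverage Φ c f ζ x := by
        rw [intervalIntegral.integral_const, sub_zero, Complex.real_smul]; push_cast; rfl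
    _ = ∫ θ in (0 : ℝ)..2 * Real.pi, ∫ z, c z * f (ζ + Complex.exp (θ * Complex.I) • z.1,
          x + z.2 + (2 : ℝ) • imForm Φ ζ (Complex.exp (θ * Complex.I) • z.1)) ∂lebesgueN E F := by
        congr 1; ext θ
        rw [integral_mul_comp_smul hrot (Complex.norm_exp_ofReal_mul_I θ)]
    _ = ∫ z, (∫ θ in (0 : ℝ)..2 * Real.pi, c z * f (ζ + Complex.exp (θ * Complex.I) • z.1,
          x + z.2 + (2 : ℝ) • imForm Φ ζ (Complex.exp (θ * Complex.I) • z.1))) ∂lebesgueN E F := by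
        simp only [intervalIntegral.integral_of_le (by positivity : (0 : ℝ) ≤ 2 * Real.pi)]
        have hcont : Continuous fun p : ℝ × (E × F) => c p.2 *
            f (ζ + Complex.exp (p.1 * Complex.I) • p.2.1, x + p.2.2 +
              (2 : ℝ) • imForm Φ ζ (Complex.exp (p.1 * Complex.I) • p.2.1)) := by
          have := hf.continuous
          fun_prop
        refine integral_integral_swap ?_
        rw [← Measure.restrict_univ (μ := lebesgueN E F), Measure.prod_restrict]
        have h0 : IntegrableOn (Function.uncurry fun (θ : ℝ) (z : E × F) => c z *
            f (ζ + Complex.exp (θ * Complex.I) • z.1, x + z.2 +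
              (2 : ℝ) • imForm Φ ζ (Complex.exp (θ * Complex.I) • z.1)))
            (Set.Icc 0 (2 * Real.pi) ×ˢ tsupport c) (volume.prod (lebesgueN E F)) :=
          hcont.continuousOn.integrableOn_compact (isCompact_Icc.prod hcs.isCompact)
        have h1 := (integrableOn_iff_integrable_of_support_subset (μ := (volume.restrict
          (Set.Icc 0 (2 * Real.pi))).prod (lebesgueN E F)) (s := Set.univ ×ˢ tsupport c)
          (f := Function.uncurry fun (θ : ℝ) (z : E × F) => c z *
            f (ζ + Complex.exp (θ * Complex.I) • z.1, x + z.2 +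
              (2 : ℝ) • imForm Φ ζ (Complex.exp (θ * Complex.I) • z.1))) (by
            intro q hq
            refine ⟨trivial, subset_tsupport _ fun h => hq ?_⟩
            simp [Function.uncurry_def, h])).1 (by
              rw [← Measure.restrict_univ (μ := lebesgueN E F), Measure.prod_restrict,
                IntegrableOn, Measure.restrict_restrict (MeasurableSet.univ.prod
                  (isClosed_tsupport c).measurableSet)]
              rw [Set.prod_inter_prod, Set.univ_inter, Set.inter_univ]
              exact h0)
        rw [← Measure.restrict_univ (μ := lebesgueN E F), Measure.prod_restrict] at h1
        exact h1.mono_measure (Measure.restrict_mono (Set.prod_mono Set.Ioc_subset_Icc_self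
          le_rfl) le_rfl)
    _ = _ := by
        congr 1; ext z
        rw [intervalIntegral.integral_const_mul, hcirc]
        ring

end Average

end

end QuadraticCR

namespace QuadraticCR

noncomputable section

set_option linter.unusedSectionVars false

/-! ### Continuity in `ζ` of the slicewise Fourier transforms -/

theorem temperedDistribution_uniform_translate_bound {V : Type*} [NormedAddCommGroup V]
    [NormedSpace ℝ V] (T : 𝓢'(V, ℂ)) :
    ∃ C : ℝ, 0 ≤ C ∧ ∃ N : ℕ, ∀ (φ : 𝓢(V, ℂ)) (B : ℝ), 0 ≤ B →
      (∀ k ≤ N, ∀ l ≤ N, ∀ x, (1 + ‖x‖) ^ k * ‖iteratedFDeriv ℝ l φ x‖ ≤ B) →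
      ∀ y, ‖T (φ.compSubConstCLM ℂ y)‖ ≤ C * B * (1 + ‖y‖) ^ N := by
  obtain ⟨C, hC, N, h⟩ := temperedDistribution_bound T
  refine ⟨C, hC, N, fun φ B hB hφ x => ?_⟩
  have := h (φ.compSubConstCLM ℂ x) (B * (1 + ‖x‖) ^ N) (by positivity) ?_
  · linarith
  intro k hk l hl y
  have h1 : (φ.compSubConstCLM ℂ x : V → ℂ) = fun y => φ (y - x) := rfl
  rw [h1, iteratedFDeriv_comp_sub]
  have h3 : ‖y‖ ^ k ≤ (1 + ‖x‖) ^ N * (1 + ‖y - x‖) ^ k := by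
    calc ‖y‖ ^ k ≤ (1 + ‖y‖) ^ k := by gcongr; linarith
      _ ≤ ((1 + ‖x‖) * (1 + ‖y - x‖)) ^ k := by gcongr; exact one_add_norm_le_mul _ _
      _ ≤ _ := by
        rw [mul_pow]; gcongr; linarith [norm_nonneg x]
  calc _ ≤ (1 + ‖x‖) ^ N * (1 + ‖y - x‖) ^ k * ‖iteratedFDeriv ℝ l φ (y - x)‖ := by gcongr
    _ = (1 + ‖x‖) ^ N * ((1 + ‖y - x‖) ^ k * ‖iteratedFDeriv ℝ l φ (y - x)‖) := by ring
    _ ≤ (1 + ‖x‖) ^ N * B := by gcongr; exact hφ k hk l hl _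
    _ = _ := by ring

section Continuity

variable {E F : Type*} [NormedAddCommGroup E] [InnerProductSpace ℂ E] [FiniteDimensional ℂ E]
  [MeasurableSpace E] [BorelSpace E]
  [NormedAddCommGroup F] [InnerProductSpace ℝ F] [FiniteDimensional ℝ F]
  [MeasurableSpace F] [BorelSpace F]
  {Φ : E →ₗ[ℂ] E →ₗ⋆[ℂ] (ℂ ⊗[ℝ] F)}

/-- Group translations preserve Lebesgue measure, so they can be moved onto the bump; the central
variable `x` then acts by ordinary translation. -/
theorem groupAverage_eq_dist {f : E × F → ℂ} (hf : Continuous f) {T : 𝓢'(E × F, ℂ)}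
    (hT : Represents (lebesgueN E F) T f) {c : E × F → ℂ} {ζ : E} {Θ : 𝓢(E × F, ℂ)}
    (hΘs : HasCompactSupport (Θ : E × F → ℂ))
    (hΘ : ∀ v y, Θ (v, y) = c (v - ζ, y - (2 : ℝ) • imForm Φ ζ (v - ζ))) (x : F) :
    groupAverage Φ c f ζ x = T (Θ.compSubConstCLM ℂ (0, x)) := by
  have h1 : ((Θ.compSubConstCLM ℂ (0, x) : 𝓢(E × F, ℂ)) : E × F → ℂ) = fun q => Θ (q - (0, x)) :=
    rfl
  have h2 : HasCompactSupport ((Θ.compSubConstCLM ℂ (0, x) : 𝓢(E × F, ℂ)) : E × F → ℂ) := by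
    rw [h1]
    exact hΘs.comp_homeomorph (Homeomorph.subRight ((0, x) : E × F))
  rw [hT _ h2, h1]
  have hg : Continuous fun p : E × F => x + p.2 + (2 : ℝ) • imForm Φ ζ p.1 := by fun_prop
  have hmp : MeasurePreserving (fun p : E × F =>
      (ζ + p.1, x + p.2 + (2 : ℝ) • imForm Φ ζ p.1)) (lebesgueN E F) (lebesgueN E F) := by
    refine (measurePreserving_add_left (lebesgueComplex E) ζ).skew_product
      (g := fun w s => x + s + (2 : ℝ) • imForm Φ ζ w) hg.measurable (ae_of_all _ fun w => ?_)
    have := (measurePreserving_add_right (volume : Measure F)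
      (x + (2 : ℝ) • imForm Φ ζ w)).map_eq
    have h3 : (fun s => x + s + (2 : ℝ) • imForm Φ ζ w) =
        fun s => s + (x + (2 : ℝ) • imForm Φ ζ w) := by
      ext s; abel
    rw [h3]
    exact this
  have hcont : Continuous fun q : E × F => Θ (q - (0, x)) * f q := by
    have := Θ.continuous
    fun_prop
  conv_rhs => rw [← hmp.map_eq]
  rw [integral_map hmp.measurable.aemeasurable (by
    rw [hmp.map_eq]; exact hcont.aestronglyMeasurable), groupAverage]
  congr 1; ext z
  congr 1
  simp only [Prod.mk_sub_mk, hΘ, add_sub_cancel_left, sub_zero]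
  congr 1
  exact Prod.ext rfl (by simp only; abel)

/-- Temperedness on the whole group is used here: the test functions of `groupAverage_eq_dist` form
a continuous family in `ζ`, so their seminorms are locally bounded, and translation by `(0, x)`
costs a power of `1 + ‖x‖`. -/
theorem groupAverage_growth {f : E × F → ℂ} (hf : Continuous f) {T : 𝓢'(E × F, ℂ)}
    (hT : Represents (lebesgueN E F) T f) {c : E × F → ℂ} (hc : ContDiff ℝ ∞ c)
    (hcs : HasCompactSupport c) (ζ₀ : E) :
    ∃ U ∈ 𝓝 ζ₀, ∃ C : ℝ, 0 ≤ C ∧ ∃ N : ℕ, ∀ ζ ∈ U, ∀ x,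
      ‖groupAverage Φ c f ζ x‖ ≤ C * (1 + ‖x‖) ^ N := by
  have : FiniteDimensional ℝ E := FiniteDimensional.complexToReal E
  -- A cutoff in the parameter `ζ` confines the whole family to one compact set.
  obtain ⟨κ, hκ, hκs, -, ⟨O, hO, hKO, hκ1⟩, -⟩ := exists_smooth_bump (isCompact_singleton (x := ζ₀))
    isOpen_univ (Set.subset_univ _)
  let a : E × (E × F) → ℂ := fun p => (κ p.1 : ℂ) *
    c (p.2.1 - p.1, p.2.2 - (2 : ℝ) • imForm Φ p.1 (p.2.1 - p.1))
  have him : ContDiff ℝ ∞ fun p : E × (E × F) => imForm Φ p.1 (p.2.1 - p.1) :=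
    ((imForm Φ).contDiff.comp contDiff_fst).clm_apply
      ((contDiff_fst.comp contDiff_snd).sub contDiff_fst)
  have ha : ContDiff ℝ ∞ a :=
    (Complex.ofRealCLM.contDiff.comp (hκ.comp contDiff_fst)).mul (hc.comp
      (((contDiff_fst.comp contDiff_snd).sub contDiff_fst).prodMk
        ((contDiff_snd.comp contDiff_snd).sub (contDiff_const.smul him))))
  let k : Set (E × F) := (fun p : E × (E × F) =>
    (p.1 + p.2.1, p.2.2 + (2 : ℝ) • imForm Φ p.1 p.2.1)) '' (tsupport κ ×ˢ tsupport c)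
  have hk : IsCompact k := by
    refine (hκs.isCompact.prod hcs.isCompact).image ?_
    have : Continuous fun p : E × (E × F) => imForm Φ p.1 p.2.1 :=
      ((imForm Φ).continuous.comp continuous_fst).clm_apply (continuous_fst.comp continuous_snd)
    fun_prop
  have hak : ∀ ζ, ∀ q ∉ k, a (ζ, q) = 0 := by
    intro ζ q hq
    by_contra h
    simp only [a, mul_eq_zero, not_or, Complex.ofReal_eq_zero] at h
    refine hq ⟨(ζ, (q.1 - ζ, q.2 - (2 : ℝ) • imForm Φ ζ (q.1 - ζ))),
      ⟨subset_tsupport _ h.1, subset_tsupport _ h.2⟩, ?_⟩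
    simp
  let A : E → 𝓢(E × F, ℂ) := fun ζ => HasCompactSupport.toSchwartzMap (f := fun q => a (ζ, q))
    (HasCompactSupport.intro hk (hak ζ)) (ha.comp (contDiff_const.prodMk contDiff_id))
  have hA : ∀ ζ q, A ζ q = a (ζ, q) := fun _ _ => rfl
  have hAc : Continuous A := continuous_schwartz_of_contDiff ha hk hak hA
  obtain ⟨C, hC, N, hTb⟩ := temperedDistribution_uniform_translate_bound T
  obtain ⟨B, hB, hAb⟩ := exists_uniform_schwartz_bound hAc hκs.isCompact N
  have hmem : O ∈ 𝓝 ζ₀ := hO.mem_nhds (hKO rfl)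
  refine ⟨O, hmem, C * B, by positivity, N, fun ζ hζ x => ?_⟩
  rw [groupAverage_eq_dist hf hT (Θ := A ζ) (HasCompactSupport.intro hk (hak ζ)) (fun v y => by
    rw [hA]; simp [a, hκ1 ζ hζ])]
  have h := hTb (A ζ) B hB (hAb ζ (subset_tsupport _ (by simp [hκ1 ζ hζ]))) (0, x)
  rwa [show ‖((0, x) : E × F)‖ = ‖x‖ by simp [Prod.norm_def]] at h

/-- The exponential factor is positive, so only the oscillation of the character could cancel the
integral. A bump narrow enough in `F` keeps the real part of the character positive for all `ξ` in
`K`. -/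
theorem exists_radial_bump (K : Set F) (hK : IsCompact K) :
    ∃ c : E × F → ℂ, ContDiff ℝ ∞ c ∧ HasCompactSupport c ∧
      (∀ u : ℂ, ‖u‖ = 1 → ∀ w x, c (u • w, x) = c (w, x)) ∧
      ∀ ξ ∈ K, ∫ z, c z * (eChar z.2 ξ *
        Complex.exp (((-(2 * Real.pi * inner ℝ ξ (reForm Φ z.1 z.1)) : ℝ) : ℂ))) ∂lebesgueN E F
        ≠ 0 := by
  have : FiniteDimensional ℝ E := FiniteDimensional.complexToReal E
  have : ProperSpace E := FiniteDimensional.proper ℂ E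
  obtain ⟨ρ, hρ0, hρ⟩ : ∃ ρ : ℝ, 0 < ρ ∧ ∀ ξ ∈ K, ‖ξ‖ ≤ ρ := by
    obtain ⟨r, hr⟩ := hK.isBounded.exists_norm_le
    exact ⟨max r 1, by positivity, fun ξ hξ => (hr ξ hξ).trans (le_max_left _ _)⟩
  -- For `‖ξ‖ ≤ ρ` and `‖x‖ ≤ 1 / (8ρ)` the phase `2π ⟨ξ, x⟩` is at most `π / 4` in absolute value.
  let η : ContDiffBump (0 : F) := ⟨1 / (16 * ρ), 1 / (8 * ρ), by positivity, by
    gcongr; norm_num⟩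
  let β : ContDiffBump (0 : ℝ) := ⟨1, 2, one_pos, one_lt_two⟩
  let c₀ : E × F → ℝ := fun z => β (‖z.1‖ ^ 2) * η z.2
  have hc₀ : ContDiff ℝ ∞ c₀ :=
    (β.contDiff.comp ((contDiff_norm_sq ℂ).comp contDiff_fst)).mul (η.contDiff.comp contDiff_snd)
  have hsupp : ∀ z : E × F, c₀ z ≠ 0 → ‖z.1‖ ^ 2 < 2 ∧ ‖z.2‖ < 1 / (8 * ρ) := by
    intro z hz
    simp only [c₀, mul_ne_zero_iff] at hz
    have h1 : ‖z.1‖ ^ 2 ∈ Function.support β := hz.1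
    have h2 : z.2 ∈ Function.support η := hz.2
    rw [β.support_eq, Metric.mem_ball, dist_zero_right] at h1
    rw [η.support_eq, Metric.mem_ball, dist_zero_right] at h2
    exact ⟨(le_abs_self _).trans_lt h1, h2⟩
  have hc₀s : HasCompactSupport c₀ := by
    refine HasCompactSupport.intro ((isCompact_closedBall (0 : E) 2).prod
      (isCompact_closedBall (0 : F) (1 / (8 * ρ)))) fun z hz => ?_
    by_contra h
    obtain ⟨h1, h2⟩ := hsupp z h
    refine hz ⟨?_, ?_⟩
    · rw [mem_closedBall_zero_iff]
      nlinarith [norm_nonneg z.1]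
    · rw [mem_closedBall_zero_iff]; exact h2.le
  refine ⟨fun z => (c₀ z : ℂ), Complex.ofRealCLM.contDiff.comp hc₀,
    hc₀s.comp_left (g := fun t : ℝ => (t : ℂ)) (by simp), fun u hu w x => ?_, fun ξ hξ h0 => ?_⟩
  · simp only [c₀, norm_smul, hu, one_mul]
  let m : E × F → ℝ := fun z => c₀ z * (Real.cos (2 * Real.pi * inner ℝ ξ z.2) *
    Real.exp (-(2 * Real.pi * inner ℝ ξ (reForm Φ z.1 z.1))))
  have hre : Continuous fun z : E × F => reForm Φ z.1 z.1 :=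
    ((reForm Φ).continuous.comp continuous_fst).clm_apply continuous_fst
  have hin : Continuous fun z : E × F => inner ℝ ξ (reForm Φ z.1 z.1) :=
    continuous_const.inner hre
  have hin2 : Continuous fun z : E × F => inner ℝ ξ z.2 := continuous_const.inner continuous_snd
  have hm : Continuous m := by
    have := hc₀.continuous
    fun_prop
  have hms : HasCompactSupport m := hc₀s.mul_right
  have hcos : ∀ z, c₀ z ≠ 0 → 0 < Real.cos (2 * Real.pi * inner ℝ ξ z.2) := by
    intro z hz
    have h1 : |2 * Real.pi * inner ℝ ξ z.2| < Real.pi / 2 := by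
      rw [abs_mul, abs_of_pos (by positivity : 0 < 2 * Real.pi)]
      have h2 : |inner ℝ ξ z.2| ≤ ρ * (1 / (8 * ρ)) :=
        (abs_real_inner_le_norm _ _).trans (mul_le_mul (hρ ξ hξ) (hsupp z hz).2.le
          (norm_nonneg _) hρ0.le)
      have h3 : ρ * (1 / (8 * ρ)) = 1 / 8 := by field_simp
      rw [h3] at h2
      nlinarith [Real.pi_pos]
    exact Real.cos_pos_of_mem_Ioo ⟨by linarith [(abs_lt.1 h1).1], (abs_lt.1 h1).2⟩
  have hc₀n : ∀ z, 0 ≤ c₀ z := fun z => mul_nonneg β.nonneg η.nonneg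
  have hpos : 0 < ∫ z, m z ∂lebesgueN E F := by
    refine hm.integral_pos_of_hasCompactSupport_nonneg_nonzero hms (fun z => ?_) (x := 0) ?_
    · by_cases hz : c₀ z = 0
      · simp [m, hz]
      · exact mul_nonneg (hc₀n z) (mul_nonneg (hcos z hz).le (Real.exp_pos _).le)
    · have h1 : β 0 = 1 := β.one_of_mem_closedBall (Metric.mem_closedBall_self zero_le_one)
      have h2 : η 0 = 1 := η.one_of_mem_closedBall (Metric.mem_closedBall_self η.rIn_pos.le)
      simp [m, c₀, h1, h2]
  refine hpos.ne' ?_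
  have h2 := congrArg Complex.re h0
  rw [← RCLike.re_eq_complex_re, ← integral_re] at h2
  · rw [map_zero] at h2
    rw [← h2]
    congr 1; ext z
    simp only [m, eChar, RCLike.re_eq_complex_re, Complex.re_ofReal_mul, ← Complex.ofReal_exp,
      Complex.re_mul_ofReal, Complex.exp_ofReal_mul_I_re]
  · refine Continuous.integrable_of_hasCompactSupport ?_
      ((hc₀s.comp_left (g := fun t : ℝ => (t : ℂ)) (by simp)).mul_right)
    have h5 := hc₀.continuous
    have h6 := continuous_eChar_uncurry (F := F)
    fun_prop

/-- The average of `f` has Fourier transform `M · S ζ` with `M` nonvanishing near `K`, so testing `S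
ζ` on `a` amounts to testing the average on `a / M`. The average is continuous and grows locally
uniformly in `ζ`, which permits dominated convergence. -/
theorem continuous_slice_apply (hΦ : IsHermitianMap Φ) {f : E × F → ℂ} (hf : ContDiff ℝ ∞ f)
    (hcr : IsCR Φ f) {T : 𝓢'(E × F, ℂ)} (hT : Represents (lebesgueN E F) T f)
    {K : Set F} (hK : IsCompact K) {S : E → 𝓢'(F, ℂ)}
    (hS : ∀ ζ, Band K (fun x => f (ζ, x)) (S ζ)) (a : 𝓢(F, ℂ)) :
    Continuous fun ζ => S ζ a := by
  have : FiniteDimensional ℝ E := FiniteDimensional.complexToReal E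
  obtain ⟨ψ₁, hψ₁, hψ₁s, -, ⟨O₁, hO₁, hKO₁, hψ₁1⟩, -⟩ :=
    exists_smooth_bump hK isOpen_univ (Set.subset_univ _)
  -- Nested cutoffs: `ψ₁` makes `M` a test function, while `ψ₂`, supported where `ψ₁ = 1`, localizes
  -- the division by `M`.
  obtain ⟨ψ₂, hψ₂, hψ₂s, hψ₂O, ⟨O₂, hO₂, hKO₂, hψ₂1⟩, -⟩ := exists_smooth_bump hK hO₁ hKO₁
  obtain ⟨c, hc, hcs, hrot, hne⟩ :=
    exists_radial_bump (E := E) (Φ := Φ) (tsupport ψ₂) hψ₂s.isCompact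
  set M : F → ℂ := fun ξ => ∫ z, c z * (eChar z.2 ξ *
    Complex.exp (((-(2 * Real.pi * inner ℝ ξ (reForm Φ z.1 z.1)) : ℝ) : ℂ))) ∂lebesgueN E F
  have hM : ContDiff ℝ ∞ M := by
    refine contDiff_integral_of_hasCompactSupport hc hcs (a := fun q : (E × F) × F =>
      eChar q.1.2 q.2 *
        Complex.exp (((-(2 * Real.pi * inner ℝ q.2 (reForm Φ q.1.1 q.1.1)) : ℝ) : ℂ))) ?_
    have hre : ContDiff ℝ ∞ fun q : (E × F) × F => reForm Φ q.1.1 q.1.1 :=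
      ((reForm Φ).contDiff.comp (contDiff_fst.comp contDiff_fst)).clm_apply
        (contDiff_fst.comp contDiff_fst)
    exact (contDiff_eChar_uncurry.comp
      ((contDiff_snd.comp contDiff_fst).prodMk contDiff_snd)).mul (Complex.ofRealCLM.contDiff.comp
      (contDiff_const.mul (contDiff_snd.inner ℝ hre)).neg).cexp
  have hψ₁c : ContDiff ℝ ∞ fun ξ => (ψ₁ ξ : ℂ) := Complex.ofRealCLM.contDiff.comp hψ₁
  have hψ₂c : ContDiff ℝ ∞ fun ξ => (ψ₂ ξ : ℂ) := Complex.ofRealCLM.contDiff.comp hψ₂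
  have hψ₁cs : HasCompactSupport fun ξ => (ψ₁ ξ : ℂ) :=
    hψ₁s.comp_left (g := fun t : ℝ => (t : ℂ)) (by simp)
  have hψ₂cs : HasCompactSupport fun ξ => (ψ₂ ξ : ℂ) :=
    hψ₂s.comp_left (g := fun t : ℝ => (t : ℂ)) (by simp)
  have hRs : HasCompactSupport fun ξ => (ψ₁ ξ : ℂ) * M ξ := hψ₁cs.mul_right
  let R : 𝓢(F, ℂ) := hRs.toSchwartzMap (hψ₁c.mul hM)
  have hR : ∀ ξ, R ξ = (ψ₁ ξ : ℂ) * M ξ := fun _ => rfl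
  let A : F → 𝓢(F, ℂ) := fun x => HasCompactSupport.toSchwartzMap
    (f := fun ξ => R ξ * eChar x ξ) (HasCompactSupport.mul_right hRs)
    ((R.smooth ⊤).mul (contDiff_eChar x))
  have hA : ∀ x ξ, A x ξ = R ξ * eChar x ξ := fun _ _ => rfl
  have hL : ∀ ζ x, groupAverage Φ c f ζ x = S ζ (A x) := fun ζ x =>
    groupAverage_eq_apply hΦ hf hcr (hS ζ) hψ₁c hψ₁cs hO₁ hKO₁ (fun ξ hξ => by simp [hψ₁1 ξ hξ])
      hc.continuous hcs hrot x (fun ξ => hA x ξ)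
  have hdiv : ContDiff ℝ ∞ fun ξ => (ψ₂ ξ : ℂ) * a ξ * (M ξ)⁻¹ := by
    refine contDiff_iff_contDiffAt.2 fun ξ => ?_
    by_cases hξ : ξ ∈ tsupport ψ₂
    · exact ((hψ₂c.mul (a.smooth ⊤)).contDiffAt).mul (hM.contDiffAt.inv (hne ξ hξ))
    · refine contDiffAt_const (c := (0 : ℂ)).congr_of_eventuallyEq ?_
      filter_upwards [(isClosed_tsupport ψ₂).isOpen_compl.mem_nhds hξ] with y hy
      simp [image_eq_zero_of_notMem_tsupport hy]
  let d : 𝓢(F, ℂ) := HasCompactSupport.toSchwartzMap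
    (f := fun ξ => (ψ₂ ξ : ℂ) * a ξ * (M ξ)⁻¹) hψ₂cs.mul_right.mul_right hdiv
  have hd : ∀ ξ, d ξ = (ψ₂ ξ : ℂ) * a ξ * (M ξ)⁻¹ := fun _ => rfl
  have hval : ∀ ζ, S ζ a = ∫ t, groupAverage Φ c f ζ t * 𝓕 (d : F → ℂ) t := by
    intro ζ
    have hb := (hS ζ).mulDist (R := R) hRs hA
    let e : 𝓢(F, ℂ) := HasCompactSupport.toSchwartzMap
      (f := fun ξ => R ξ * d ξ) (HasCompactSupport.mul_right hRs) ((R.smooth ⊤).mul (d.smooth ⊤))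
    have he : ∀ ξ, e ξ = R ξ * d ξ := fun _ => rfl
    simp only [hL]
    rw [← hb.pair d, mulDist_apply R he]
    refine eq_of_eqOn_nhds (hS ζ).supp hO₂ hKO₂ fun ξ hξ => ?_
    have h1 : ξ ∈ tsupport ψ₂ := subset_tsupport _ (by simp [hψ₂1 ξ hξ])
    rw [he, hR, hd, hψ₁1 ξ (hψ₂O h1), hψ₂1 ξ hξ]
    rw [Complex.ofReal_one, one_mul, one_mul, mul_left_comm, mul_inv_cancel₀ (hne ξ h1), mul_one]
  have hLc := continuous_groupAverage (Φ := Φ) hc.continuous hcs hf.continuous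
  have hdc : Continuous fun t => 𝓕 (d : F → ℂ) t := by
    rw [← SchwartzMap.fourier_coe]; exact SchwartzMap.continuous _
  simp only [hval]
  refine continuous_iff_continuousAt.2 fun ζ₀ => ?_
  obtain ⟨U, hU, C, hC, N, hb⟩ := groupAverage_growth (Φ := Φ) hf.continuous hT hc hcs ζ₀
  have hgc : Continuous fun t : F => (((C * (1 + ‖t‖) ^ N : ℝ)) : ℂ) := by fun_prop
  have hint := integrable_mul_schwartz hgc (C := C) (M := N) (fun t => by
    rw [Complex.norm_real, Real.norm_of_nonneg (by positivity)]) (𝓕 d)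
  refine continuousAt_of_dominated (Eventually.of_forall fun ζ => ?_) ?_ hint.norm
    (ae_of_all _ fun t => ?_)
  · exact (Continuous.mul (hLc.comp (continuous_const.prodMk continuous_id))
      hdc).aestronglyMeasurable
  · filter_upwards [hU] with ζ hζ
    refine ae_of_all _ fun t => ?_
    rw [norm_mul, norm_mul, Complex.norm_real, Real.norm_of_nonneg (by positivity),
      SchwartzMap.fourier_coe]
    gcongr
    exact hb ζ hζ t
  · exact ((hLc.comp (continuous_id.prodMk continuous_const)).mul continuous_const).continuousAt

end Continuity

end

end QuadraticCR

namespace QuadraticCR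

noncomputable section

set_option linter.unusedSectionVars false

/-! ### Differential operators as Fourier multipliers -/

section Symbol

variable {E F : Type*} [NormedAddCommGroup E] [InnerProductSpace ℂ E]
  [NormedAddCommGroup F] [InnerProductSpace ℝ F] [FiniteDimensional ℝ F]
  [MeasurableSpace F] [BorelSpace F] {S : E → 𝓢'(F, ℂ)} {ψ : F → ℂ}

/-- `h` is the smooth function obtained from the distributions `S ζ` by means of the
Fourier multiplier `q`, localized by `ψ`. -/
structure HasSymbol (S : E → 𝓢'(F, ℂ)) (ψ : F → ℂ) (h : E × F → ℂ) (q : F → ℂ) : Prop where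
  smooth : ContDiff ℝ ∞ h
  smooth_symbol : ContDiff ℝ ∞ q
  apply : ∀ ζ x, ∀ A : 𝓢(F, ℂ), (∀ ξ, A ξ = ψ ξ * q ξ * eChar x ξ) → h (ζ, x) = S ζ A

/-- Moving `x` along `b` multiplies the test function by `exp(2π i τ ⟨ξ, b⟩)`. Differentiating at `τ
= 0` brings down `2π i ⟨ξ, b⟩`, and `-i` removes the `i`. -/
theorem HasSymbol.neg_I_mul_fderiv {h : E × F → ℂ} {q : F → ℂ} (hh : HasSymbol S ψ h q)
    (hψ : ContDiff ℝ ∞ ψ) (hψs : HasCompactSupport ψ) (b : F) :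
    HasSymbol S ψ (fun r => -Complex.I * fderiv ℝ h r (0, b))
      (fun ξ => q ξ * ((2 * Real.pi * inner ℝ ξ b : ℝ) : ℂ)) := by
  have hm : ContDiff ℝ ∞ fun ξ : F => ((2 * Real.pi * inner ℝ ξ b : ℝ) : ℂ) :=
    Complex.ofRealCLM.contDiff.comp (contDiff_const.mul (contDiff_id.inner ℝ contDiff_const))
  refine ⟨contDiff_const.mul ((hh.smooth.fderiv_right (m := ∞) (by simp)).clm_apply contDiff_const),
    hh.smooth_symbol.mul hm, fun ζ x A hA => ?_⟩
  let l : F → ℂ := fun ξ => ((2 * Real.pi * inner ℝ ξ b : ℝ) : ℂ) * Complex.I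
  have hl : ContDiff ℝ ∞ l := hm.mul contDiff_const
  have ha : ContDiff ℝ ∞ fun ξ => ψ ξ * q ξ * eChar x ξ :=
    (hψ.mul hh.smooth_symbol).mul (contDiff_eChar x)
  have has : HasCompactSupport fun ξ => ψ ξ * q ξ * eChar x ξ := hψs.mul_right.mul_right
  let B : ℂ → 𝓢(F, ℂ) := fun z => HasCompactSupport.toSchwartzMap
    (f := fun ξ => ψ ξ * q ξ * eChar x ξ * Complex.exp (z * l ξ)) has.mul_right
      (ha.mul (contDiff_const.mul hl).cexp)
  have hB : ∀ z ξ, B z ξ = ψ ξ * q ξ * eChar x ξ * Complex.exp (z * l ξ) := fun _ _ => rfl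
  have hd := hasDerivAt_apply_mul_exp (S ζ) ha has hl hB 0 (A' := Complex.I • A) (fun ξ => by
    rw [smul_apply, hA]; simp only [l, zero_mul, Complex.exp_zero, smul_eq_mul]; ring)
  have h1 : HasDerivAt (fun τ : ℝ => S ζ (B τ)) (S ζ (Complex.I • A)) 0 := by
    have := hd.comp_ofReal (z := 0)
    simpa using this
  have h2 : HasDerivAt (fun τ : ℝ => h (ζ, x + τ • b)) (fderiv ℝ h (ζ, x) (0, b)) 0 := by
    have h3 : HasDerivAt (fun τ : ℝ => (ζ, x + τ • b)) ((0 : E), b) 0 := by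
      have h4 : HasDerivAt (fun τ : ℝ => τ • b) b 0 := by
        simpa using (hasDerivAt_id (0 : ℝ)).smul_const b
      exact (hasDerivAt_const 0 ζ).prodMk (h4.const_add x)
    have h5 : HasFDerivAt h (fderiv ℝ h (ζ, x)) ((fun τ : ℝ => (ζ, x + τ • b)) 0) := by
      simpa using ((hh.smooth.differentiable (by simp)) (ζ, x)).hasFDerivAt
    exact h5.comp_hasDerivAt 0 h3
  have h6 : (fun τ : ℝ => h (ζ, x + τ • b)) = fun τ : ℝ => S ζ (B τ) := by
    ext τ
    refine hh.apply ζ _ _ fun ξ => ?_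
    have h7 : Complex.exp ((τ : ℂ) * l ξ) = eChar (τ • b) ξ := by
      simp only [l, eChar, inner_smul_right]
      congr 1; push_cast; ring
    rw [hB, eChar_add, h7]
    ring
  rw [h6] at h2
  rw [h2.unique h1, map_smul, smul_eq_mul]
  linear_combination (-S ζ A) * Complex.I_mul_I

theorem HasSymbol.const_mul {h : E × F → ℂ} {q : F → ℂ} (hh : HasSymbol S ψ h q)
    (hψ : ContDiff ℝ ∞ ψ) (hψs : HasCompactSupport ψ) (c : ℂ) :
    HasSymbol S ψ (fun r => c * h r) (fun ξ => c * q ξ) := by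
  refine ⟨contDiff_const.mul hh.smooth, contDiff_const.mul hh.smooth_symbol, fun ζ x A hA => ?_⟩
  let B : 𝓢(F, ℂ) := HasCompactSupport.toSchwartzMap
    (f := fun ξ => ψ ξ * q ξ * eChar x ξ) hψs.mul_right.mul_right
      ((hψ.mul hh.smooth_symbol).mul (contDiff_eChar x))
  have hB : ∀ ξ, B ξ = ψ ξ * q ξ * eChar x ξ := fun _ => rfl
  have : A = c • B := by
    ext ξ
    rw [hA, smul_apply, hB, smul_eq_mul]; ring
  rw [this, map_smul, hh.apply ζ x B hB, smul_eq_mul]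

theorem HasSymbol.sum {ι : Type*} {s : Finset ι} {h : ι → E × F → ℂ} {q : ι → F → ℂ}
    (hh : ∀ i ∈ s, HasSymbol S ψ (h i) (q i))
    (hψ : ContDiff ℝ ∞ ψ) (hψs : HasCompactSupport ψ) :
    HasSymbol S ψ (fun r => ∑ i ∈ s, h i r) (fun ξ => ∑ i ∈ s, q i ξ) := by
  classical
  induction s using Finset.induction_on with
  | empty =>
    refine ⟨by simpa using contDiff_const, by simpa using contDiff_const, fun ζ x A hA => ?_⟩
    have : A = 0 := by ext ξ; rw [hA]; simp
    rw [this, map_zero]; simp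
  | insert i s hi ih =>
    have h1 := hh i (Finset.mem_insert_self _ _)
    have h2 := ih fun j hj => hh j (Finset.mem_insert_of_mem hj)
    simp only [Finset.sum_insert hi]
    refine ⟨h1.smooth.add h2.smooth, h1.smooth_symbol.add h2.smooth_symbol, fun ζ x A hA => ?_⟩
    let B : 𝓢(F, ℂ) := HasCompactSupport.toSchwartzMap
      (f := fun ξ => ψ ξ * q i ξ * eChar x ξ) hψs.mul_right.mul_right
        ((hψ.mul h1.smooth_symbol).mul (contDiff_eChar x))
    let C : 𝓢(F, ℂ) := HasCompactSupport.toSchwartzMap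
      (f := fun ξ => ψ ξ * (∑ j ∈ s, q j ξ) * eChar x ξ) hψs.mul_right.mul_right
        ((hψ.mul h2.smooth_symbol).mul (contDiff_eChar x))
    have hB : ∀ ξ, B ξ = ψ ξ * q i ξ * eChar x ξ := fun _ => rfl
    have hC : ∀ ξ, C ξ = ψ ξ * (∑ j ∈ s, q j ξ) * eChar x ξ := fun _ => rfl
    have : A = B + C := by
      ext ξ
      rw [hA, add_apply, hB, hC]; ring
    rw [this, map_add, ← h1.apply ζ x B hB, ← h2.apply ζ x C hC]

theorem HasSymbol.iterate {D : (E × F → ℂ) → E × F → ℂ} {m : F → ℂ}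
    (hD : ∀ h q, HasSymbol S ψ h q → HasSymbol S ψ (D h) (fun ξ => q ξ * m ξ))
    {h : E × F → ℂ} {q : F → ℂ} (hh : HasSymbol S ψ h q) (n : ℕ) :
    HasSymbol S ψ (D^[n] h) (fun ξ => q ξ * m ξ ^ n) := by
  induction n with
  | zero => simpa using hh
  | succ n ih =>
    rw [Function.iterate_succ_apply']
    have := hD _ _ ih
    simpa only [mul_assoc, ← pow_succ] using this

/-- The value of the polynomial `P` at the point of `F'` that corresponds to the frequency `ξ`. -/
def freqEval {m : ℕ} (b : Module.Basis (Fin m) ℝ F) (P : MvPolynomial (Fin m) ℂ) (ξ : F) : ℂ :=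
  polyEval b P (InnerProductSpace.toDual ℝ F ((2 * Real.pi) • ξ))

theorem freqEval_eq {m : ℕ} (b : Module.Basis (Fin m) ℝ F) (P : MvPolynomial (Fin m) ℂ) (ξ : F) :
    freqEval b P ξ = ∑ α ∈ P.support, P.coeff α *
      ∏ j, ((2 * Real.pi * inner ℝ ξ (b j) : ℝ) : ℂ) ^ α j := by
  rw [freqEval, polyEval, MvPolynomial.eval_eq']
  simp only [InnerProductSpace.toDual_apply_apply, inner_smul_left, conj_trivial]

theorem HasSymbol.polyDiffOp {m : ℕ} (b : Module.Basis (Fin m) ℝ F)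
    (P : MvPolynomial (Fin m) ℂ) (hψ : ContDiff ℝ ∞ ψ) (hψs : HasCompactSupport ψ)
    {h : E × F → ℂ} {q : F → ℂ} (hh : HasSymbol S ψ h q) :
    HasSymbol S ψ (polyDiffOp b P h) (fun ξ => q ξ * freqEval b P ξ) := by
  have hfold : ∀ (α : Fin m →₀ ℕ) (L : List (Fin m)), HasSymbol S ψ
      (L.foldr (fun j g => (fun (h : E × F → ℂ) (r : E × F) =>
        -Complex.I * fderiv ℝ h r (0, b j))^[α j] g) h)
      (fun ξ => q ξ * (L.map fun j => ((2 * Real.pi * inner ℝ ξ (b j) : ℝ) : ℂ) ^ α j).prod) := by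
    intro α L
    induction L with
    | nil => simpa using hh
    | cons j L ih =>
      rw [List.foldr_cons]
      have := HasSymbol.iterate (S := S) (ψ := ψ)
        (D := fun (h : E × F → ℂ) (r : E × F) => -Complex.I * fderiv ℝ h r (0, b j))
        (m := fun ξ => ((2 * Real.pi * inner ℝ ξ (b j) : ℝ) : ℂ))
        (fun h q hh => hh.neg_I_mul_fderiv hψ hψs (b j)) ih (α j)
      simp only [List.map_cons, List.prod_cons]
      convert this using 2 with ξ
      ring
  have hsum := HasSymbol.sum (s := P.support) (fun α _ =>
    (hfold α (List.finRange m)).const_mul hψ hψs (P.coeff α)) hψ hψs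
  suffices hq : (fun ξ => q ξ * freqEval b P ξ) = fun ξ => ∑ α ∈ P.support, P.coeff α *
      (q ξ * ((List.finRange m).map fun j =>
        ((2 * Real.pi * inner ℝ ξ (b j) : ℝ) : ℂ) ^ α j).prod) by
    rw [hq]; exact hsum
  ext ξ
  rw [freqEval_eq, Finset.mul_sum]
  refine Finset.sum_congr rfl fun α _ => ?_
  rw [Fin.prod_univ_def]
  ring

theorem contDiff_freqEval {m : ℕ} (b : Module.Basis (Fin m) ℝ F) (P : MvPolynomial (Fin m) ℂ) :
    ContDiff ℝ ∞ (freqEval b P) := by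
  rw [funext (freqEval_eq b P)]
  refine ContDiff.sum fun α _ => contDiff_const.mul (contDiff_prod fun j _ => ContDiff.pow ?_ _)
  exact Complex.ofRealCLM.contDiff.comp
    (contDiff_const.mul (contDiff_id.inner ℝ contDiff_const))

theorem hasSymbol_one {f : E × F → ℂ} (hf : ContDiff ℝ ∞ f) {K O : Set F}
    (hS : ∀ ζ, Band K (fun x => f (ζ, x)) (S ζ)) (hO : IsOpen O) (hKO : K ⊆ O)
    (hψ1 : ∀ ξ ∈ O, ψ ξ = 1) : HasSymbol S ψ f fun _ => 1 :=
  ⟨hf, contDiff_const, fun ζ x A hA => (hS ζ).repr A x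
    ⟨O, hO, hKO, fun ξ hξ => by rw [hA, hψ1 ξ hξ]; simp⟩⟩

end Symbol

/-! ### Decay of the kernels of `k`-th powers -/

section Decay

variable {F : Type*} [NormedAddCommGroup F] [InnerProductSpace ℝ F] [FiniteDimensional ℝ F]
  [MeasurableSpace F] [BorelSpace F]

/-- On the compact support of `θ` the weights are bounded, so all dependence on `k` comes from the
derivatives of `R ^ k`. Used with `R = P` for the upper bound and with a localized `1 / P` for the
lower one. -/
theorem fourier_mul_pow_decay {R θ : F → ℂ} (hR : ContDiff ℝ ∞ R)
    (hθ : ContDiff ℝ ∞ θ) (hθs : HasCompactSupport θ) {A : ℝ} (hA : 0 < A)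
    (hRA : ∀ ξ ∈ tsupport θ, ‖R ξ‖ ≤ A) (N : ℕ) :
    ∃ C : ℝ, 0 ≤ C ∧ ∃ L : ℕ, ∀ (k : ℕ) (φ : 𝓢(F, ℂ)), (∀ ξ, φ ξ = θ ξ * R ξ ^ k) →
      ∀ t, (1 + ‖t‖) ^ N * ‖𝓕 (φ : F → ℂ) t‖ ≤ C * ((1 + k) ^ L * A ^ k) := by
  obtain ⟨C, hC, M, hM⟩ := fourier_decay_bound (F := F) N
  choose D hD hDb using norm_iteratedFDeriv_mul_pow_le hR hθ hθs hA hRA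
  obtain ⟨ρ, hρ⟩ : ∃ ρ : ℝ, ∀ ξ ∈ tsupport θ, ‖ξ‖ ≤ ρ := hθs.isCompact.isBounded.exists_norm_le
  set ρ' := max ρ 1
  set D' := ∑ l ∈ Finset.range (M + 1), D l
  have hD' : 0 ≤ D' := Finset.sum_nonneg fun l _ => hD l
  refine ⟨C * (ρ' ^ M * D'), by positivity, M, fun k φ hφ t => ?_⟩
  refine (hM φ (ρ' ^ M * D' * ((1 + k) ^ M * A ^ k)) (by positivity)
    (fun i hi l hl x => ?_) t).trans_eq (by ring)
  rw [show (φ : F → ℂ) = _ from funext hφ]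
  by_cases hx : x ∈ tsupport θ
  · have h1 : ‖x‖ ^ i ≤ ρ' ^ M := by
      calc ‖x‖ ^ i ≤ ρ' ^ i := by gcongr; exact (hρ x hx).trans (le_max_left _ _)
        _ ≤ ρ' ^ M := pow_le_pow_right₀ (le_max_right _ _) hi
    have h2 : D l ≤ D' := Finset.single_le_sum (fun l _ => hD l) (Finset.mem_range.2 (by omega))
    have h3 : ((1 : ℝ) + k) ^ l ≤ (1 + k) ^ M := pow_le_pow_right₀ (by simp) hl
    calc ‖x‖ ^ i * ‖iteratedFDeriv ℝ l (fun ξ => θ ξ * R ξ ^ k) x‖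
        ≤ ρ' ^ M * (D' * (1 + k) ^ M * A ^ k) := by
          gcongr
          refine (hDb l k x).trans ?_
          gcongr
      _ = _ := by ring
  · have h1 : iteratedFDeriv ℝ l (fun ξ => θ ξ * R ξ ^ k) x = 0 := by
      have h2 : x ∉ tsupport (fun ξ => θ ξ * R ξ ^ k) := fun h =>
        hx (closure_mono (Function.support_mul_subset_left _ _) h)
      exact image_eq_zero_of_notMem_tsupport fun h => h2 (tsupport_iteratedFDeriv_subset l h)
    rw [h1, norm_zero, mul_zero]
    positivity

end Decay

end

end QuadraticCR

namespace QuadraticCR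

noncomputable section

set_option linter.unusedSectionVars false

/-! ### Extraction of `k`-th roots -/

section Limits

theorem tendsto_mul_ofReal_pow_mul_pow {C : ℝ≥0∞} (hC : C ≠ ⊤) (L : ℕ) {r : ℝ} (h0 : 0 ≤ r)
    (h1 : r < 1) :
    Tendsto (fun k : ℕ => C * ENNReal.ofReal ((1 + k) ^ L * r ^ k)) atTop (𝓝 0) := by
  have h2 : Tendsto (fun k : ℕ => (1 + (k : ℝ)) ^ L * r ^ k) atTop (𝓝 0) := by
    have h3 : Tendsto (fun k : ℕ => (2 : ℝ) ^ L * ((k : ℝ) ^ L * r ^ k)) atTop (𝓝 0) := by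
      simpa using (tendsto_pow_const_mul_const_pow_of_lt_one L h0 h1).const_mul ((2 : ℝ) ^ L)
    refine squeeze_zero' (Eventually.of_forall fun k => by positivity) ?_ h3
    filter_upwards [eventually_ge_atTop 1] with k hk
    have hk' : (1 : ℝ) ≤ k := by exact_mod_cast hk
    rw [← mul_assoc, ← mul_pow]
    gcongr
    linarith
  have h4 := ENNReal.tendsto_ofReal h2
  rw [ENNReal.ofReal_zero] at h4
  simpa using ENNReal.Tendsto.const_mul h4 (Or.inr hC)

theorem rpow_one_div_lt_iff {x a : ℝ≥0∞} {k : ℕ} (hk : 1 ≤ k) :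
    x ^ (1 / (k : ℝ)) < a ↔ x < a ^ k := by
  have hk' : (0 : ℝ) < k := by exact_mod_cast hk
  rw [one_div, ENNReal.rpow_inv_lt_iff hk', ENNReal.rpow_natCast]

theorem lt_rpow_one_div_iff {x a : ℝ≥0∞} {k : ℕ} (hk : 1 ≤ k) :
    a < x ^ (1 / (k : ℝ)) ↔ a ^ k < x := by
  have hk' : (0 : ℝ) < k := by exact_mod_cast hk
  rw [one_div, ENNReal.lt_rpow_inv_iff hk', ENNReal.rpow_natCast]

/-- For `A < a' < a` the quotient of the bound by `a' ^ k` tends to `0`, since `(A / a') ^ k` beats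
the polynomial. -/
theorem eventually_rpow_one_div_lt {e : ℕ → ℝ≥0∞} {C : ℝ≥0∞} (hC : C ≠ ⊤) {L : ℕ} {A : ℝ}
    (hA : 0 < A) (h : ∀ k : ℕ, e k ≤ C * ENNReal.ofReal ((1 + k) ^ L * A ^ k)) {a : ℝ≥0∞}
    (ha : ENNReal.ofReal A < a) : ∀ᶠ k : ℕ in atTop, e k ^ (1 / (k : ℝ)) < a := by
  obtain ⟨a', h1, h2⟩ := exists_between ha
  lift a' to NNReal using (h2.trans_le le_top).ne
  have hAa : A < a' := by
    rw [← ENNReal.ofReal_coe_nnreal] at h1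
    exact (ENNReal.ofReal_lt_ofReal_iff_of_nonneg hA.le).1 h1
  have ha0 : (0 : ℝ) < a' := hA.trans hAa
  have ht := tendsto_mul_ofReal_pow_mul_pow hC L (div_nonneg hA.le ha0.le)
    ((div_lt_one ha0).2 hAa)
  filter_upwards [ht.eventually_lt_const zero_lt_one, eventually_ge_atTop 1] with k hk hk1
  refine lt_of_lt_of_le ((rpow_one_div_lt_iff hk1).2 ((h k).trans_lt ?_)) h2.le
  have h3 : C * ENNReal.ofReal ((1 + k) ^ L * A ^ k) =
      C * ENNReal.ofReal ((1 + k) ^ L * (A / a') ^ k) * (a' : ℝ≥0∞) ^ k := by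
    rw [← ENNReal.ofReal_coe_nnreal, ← ENNReal.ofReal_pow ha0.le, mul_assoc,
      ← ENNReal.ofReal_mul (by positivity), div_pow, mul_assoc, div_mul_cancel₀ _ (by positivity)]
  rw [h3]
  have h4 : (a' : ℝ≥0∞) ^ k ≠ 0 := pow_ne_zero _ (by exact_mod_cast ha0.ne')
  have h5 : (a' : ℝ≥0∞) ^ k ≠ ⊤ := ENNReal.pow_ne_top ENNReal.coe_ne_top
  calc _ < 1 * (a' : ℝ≥0∞) ^ k := ENNReal.mul_lt_mul_left h4 h5 hk
    _ = _ := one_mul _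

/-- If `e k ≤ a ^ k`, the fixed positive `δ` is at most `C (1 + k)^L (a / B)^k`, which is impossible
for large `k`. -/
theorem eventually_lt_rpow_one_div {e : ℕ → ℝ≥0∞} {C δ : ℝ≥0∞} (hC : C ≠ ⊤) (hδ : δ ≠ 0) {L : ℕ}
    {B : ℝ} (hB : 0 < B) (h : ∀ k : ℕ, δ ≤ C * ENNReal.ofReal ((1 + k) ^ L * B⁻¹ ^ k) * e k)
    {a : ℝ≥0∞} (ha : a < ENNReal.ofReal B) : ∀ᶠ k : ℕ in atTop, a < e k ^ (1 / (k : ℝ)) := by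
  lift a to NNReal using (ha.trans_le le_top).ne
  have hAa : (a : ℝ) < B := by
    rw [← ENNReal.ofReal_coe_nnreal] at ha
    exact (ENNReal.ofReal_lt_ofReal_iff hB).1 ha
  have ht := tendsto_mul_ofReal_pow_mul_pow hC L (div_nonneg a.coe_nonneg hB.le)
    ((div_lt_one hB).2 hAa)
  filter_upwards [ht.eventually_lt_const (pos_iff_ne_zero.2 hδ), eventually_ge_atTop 1]
    with k hk hk1
  refine (lt_rpow_one_div_iff hk1).2 (lt_of_not_ge fun h1 => ?_)
  refine hk.not_ge ((h k).trans ?_)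
  calc C * ENNReal.ofReal ((1 + k) ^ L * B⁻¹ ^ k) * e k
      ≤ C * ENNReal.ofReal ((1 + k) ^ L * B⁻¹ ^ k) * (a : ℝ≥0∞) ^ k := by gcongr
    _ = _ := by
      rw [← ENNReal.ofReal_coe_nnreal, ← ENNReal.ofReal_pow a.coe_nonneg, mul_assoc,
        ← ENNReal.ofReal_mul (by positivity), div_eq_mul_inv, mul_pow, mul_assoc,
        mul_comm (B⁻¹ ^ k)]

end Limits

/-! ### The spectrum and the two norm estimates -/

section Spectrum

variable {E F : Type*} [NormedAddCommGroup E] [InnerProductSpace ℂ E] [FiniteDimensional ℂ E]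
  [MeasurableSpace E] [BorelSpace E]
  [NormedAddCommGroup F] [InnerProductSpace ℝ F] [FiniteDimensional ℝ F]
  [MeasurableSpace F] [BorelSpace F]
  {Φ : E →ₗ[ℂ] E →ₗ⋆[ℂ] (ℂ ⊗[ℝ] F)}

theorem Represents.unique {V : Type*} [NormedAddCommGroup V] [NormedSpace ℝ V]
    [FiniteDimensional ℝ V] [MeasurableSpace V]
    {μ : Measure V} {T T' : 𝓢'(V, ℂ)} {g : V → ℂ} (h : Represents μ T g)
    (h' : Represents μ T' g) : T = T' := by
  ext φ
  obtain ⟨A, h1, -, -, -, h5⟩ := exists_tendsto_cutoff φ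
  have h6 : Tendsto (fun n => T (A n)) atTop (𝓝 (T φ)) :=
    ((T : 𝓢(V, ℂ) →L[ℂ] ℂ).continuous.tendsto φ).comp h5
  have h7 : Tendsto (fun n => T' (A n)) atTop (𝓝 (T' φ)) :=
    ((T' : 𝓢(V, ℂ) →L[ℂ] ℂ).continuous.tendsto φ).comp h5
  refine tendsto_nhds_unique h6 (h7.congr fun n => ?_)
  rw [h _ (h1 n), h' _ (h1 n)]

/-- The homeomorphism from frequencies to the dual space. -/
def freqHomeo (F : Type*) [NormedAddCommGroup F] [InnerProductSpace ℝ F] [FiniteDimensional ℝ F] :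
    F ≃ₜ StrongDual ℝ F :=
  (Homeomorph.smulOfNeZero (2 * Real.pi) (by positivity : (2 * Real.pi) ≠ 0)).trans
    (InnerProductSpace.toDual ℝ F).toHomeomorph

theorem freqHomeo_apply (ξ : F) :
    freqHomeo F ξ = InnerProductSpace.toDual ℝ F ((2 * Real.pi) • ξ) := rfl

theorem fourierSupport_subset_iff (u : 𝓢'(F, ℂ)) (K : Set (StrongDual ℝ F)) :
    fourierSupport u ⊆ K ↔ Distribution.dsupport (𝓕 u : 𝓢'(F, ℂ)) ⊆ freqHomeo F ⁻¹' K :=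
  Set.image_subset_iff

theorem isCompact_sp {f : E × F → ℂ} (h : HasBoundedSpectrum Φ f) : IsCompact (Sp Φ f) := by
  obtain ⟨K, hK, hf⟩ := h
  exact hK.of_isClosed_subset (isClosed_sInter fun K hK => hK.1.isClosed)
    (Set.sInter_subset_of_mem ⟨hK, hf⟩)

/-- The distribution representing a slice is unique, so every admissible `K` constrains the same
Fourier support, which therefore lies in the intersection. -/
theorem memO_sp {f : E × F → ℂ} (h : HasBoundedSpectrum Φ f) : MemO Φ (Sp Φ f) f := by
  obtain ⟨K, hK, hf⟩ := h
  refine ⟨hf.smooth, hf.tempered, hf.cr, fun ζ => ?_⟩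
  obtain ⟨u, hu, -⟩ := hf.slice ζ
  refine ⟨u, hu, Set.subset_sInter fun K' hK' => ?_⟩
  obtain ⟨u', hu', hs⟩ := hK'.2.slice ζ
  rwa [hu.unique hu']

/-- The frequencies that correspond to the spectrum of `f`. -/
def freqSp (Φ : E →ₗ[ℂ] E →ₗ⋆[ℂ] (ℂ ⊗[ℝ] F)) (f : E × F → ℂ) : Set F :=
  freqHomeo F ⁻¹' Sp Φ f

theorem isCompact_freqSp {f : E × F → ℂ} (h : HasBoundedSpectrum Φ f) :
    IsCompact (freqSp Φ f) :=
  (freqHomeo F).isCompact_preimage.2 (isCompact_sp h)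

/-- The second clause is minimality of the spectrum: if every slice were invisible on `V`, removing
`V` would leave a smaller admissible compact set still required to contain `ξ₀`. -/
theorem exists_band {f : E × F → ℂ} (h : HasBoundedSpectrum Φ f) :
    ∃ S : E → 𝓢'(F, ℂ), (∀ ζ, Band (freqSp Φ f) (fun x => f (ζ, x)) (S ζ)) ∧
      ∀ ξ₀ ∈ freqSp Φ f, ∀ V : Set F, IsOpen V → ξ₀ ∈ V →
        ∃ ζ, ∃ θ : 𝓢(F, ℂ), tsupport θ ⊆ V ∧ HasCompactSupport (θ : F → ℂ) ∧ S ζ θ ≠ 0 := by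
  have hm := memO_sp h
  choose u hu hus using hm.slice
  have hc : ∀ ζ, Continuous fun x => f (ζ, x) := fun ζ =>
    hm.smooth.continuous.comp (by fun_prop)
  refine ⟨fun ζ => 𝓕 (u ζ), fun ζ => (band_of_represents (hc ζ) (hu ζ) (isCompact_freqSp h)
    ((fourierSupport_subset_iff _ _).1 (hus ζ))).1, fun ξ₀ hξ₀ V hV hξV => ?_⟩
  by_contra! hcon
  have hvan : ∀ ζ, Disjoint (Distribution.dsupport (𝓕 (u ζ) : 𝓢'(F, ℂ))) V := by
    refine fun ζ => Set.disjoint_left.2 fun ξ hξ hξV => ?_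
    revert hξ
    rw [imp_false, Distribution.notMem_dsupport_iff]
    obtain ⟨ε, hε, hb⟩ := Metric.isOpen_iff.1 hV ξ hξV
    refine ⟨Metric.ball ξ ε, fun θ hθ => hcon ζ θ (hθ.trans hb) ?_, Metric.isOpen_ball,
      Metric.mem_ball_self hε⟩
    exact (isCompact_closedBall ξ ε).of_isClosed_subset (isClosed_tsupport _)
      (hθ.trans Metric.ball_subset_closedBall)
  have hcpt : IsCompact (freqHomeo F '' (freqSp Φ f \ V)) :=
    ((isCompact_freqSp h).diff hV).image (freqHomeo F).continuous
  have hmem : MemO Φ (freqHomeo F '' (freqSp Φ f \ V)) f := by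
    refine ⟨hm.smooth, hm.tempered, hm.cr, fun ζ => ⟨u ζ, hu ζ, ?_⟩⟩
    have h2 : Distribution.dsupport (𝓕 (u ζ) : 𝓢'(F, ℂ)) ⊆ freqSp Φ f \ V := fun ξ hξ =>
      ⟨(fourierSupport_subset_iff _ _).1 (hus ζ) hξ, Set.disjoint_left.1 (hvan ζ) hξ⟩
    exact Set.image_mono h2
  have h1 : freqHomeo F ξ₀ ∈ freqHomeo F '' (freqSp Φ f \ V) :=
    Set.mem_sInter.1 (show freqHomeo F ξ₀ ∈ Sp Φ f from hξ₀) _ ⟨hcpt, hmem⟩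
  obtain ⟨ξ, hξ, he⟩ := h1
  rw [(freqHomeo F).injective he] at hξ
  exact hξ.2 hξV

theorem sp_nonempty {f : E × F → ℂ} (h : HasBoundedSpectrum Φ f) (hf : f ≠ 0) :
    (Sp Φ f).Nonempty := by
  by_contra hne
  rw [Set.not_nonempty_iff_eq_empty] at hne
  obtain ⟨S, hS, -⟩ := exists_band h
  refine hf (funext fun q => ?_)
  -- With empty spectrum, `0` counts as agreeing with every character near it, so every value of `f`
  -- is `S 0 = 0`.
  have := (hS q.1).repr 0 q.2 ⟨∅, isOpen_empty, by simp [freqSp, hne], by simp⟩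
  simpa using this

theorem exists_isGreatest {m : ℕ} (b : Module.Basis (Fin m) ℝ F) (P : MvPolynomial (Fin m) ℂ)
    {f : E × F → ℂ} (h : HasBoundedSpectrum Φ f) (hf : f ≠ 0) :
    ∃ M : ℝ, IsGreatest ((fun l => ‖polyEval b P l‖) '' Sp Φ f) M := by
  refine ((isCompact_sp h).image_of_continuousOn (Continuous.continuousOn ?_)).exists_isGreatest
    ((sp_nonempty h hf).image _)
  have h1 : (fun l => ‖polyEval b P l‖) = fun l => ‖freqEval b P ((freqHomeo F).symm l)‖ := by
    ext l
    rw [freqEval, ← freqHomeo_apply, Homeomorph.apply_symm_apply]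
  rw [h1]
  exact ((contDiff_freqEval b P).continuous.comp (freqHomeo F).symm.continuous).norm

theorem exists_complex_bump {K U : Set F} (hK : IsCompact K) (hU : IsOpen U) (hKU : K ⊆ U) :
    ∃ ψ : F → ℂ, ContDiff ℝ ∞ ψ ∧ HasCompactSupport ψ ∧ tsupport ψ ⊆ U ∧
      ∃ O, IsOpen O ∧ K ⊆ O ∧ ∀ x ∈ O, ψ x = 1 := by
  obtain ⟨ψ, h1, h2, h3, ⟨O, h4, h5, h6⟩, -⟩ := exists_smooth_bump hK hU hKU
  refine ⟨fun x => (ψ x : ℂ), Complex.ofRealCLM.contDiff.comp h1,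
    h2.comp_left (g := fun t : ℝ => (t : ℂ)) (by simp), ?_, O, h4, h5, fun x hx => by simp [h6 x hx]⟩
  have h7 : Function.support (fun x => (ψ x : ℂ)) ⊆ Function.support ψ := fun x hx h =>
    hx (by simp [h])
  exact (closure_mono h7).trans h3

variable {m : ℕ} (b : Module.Basis (Fin m) ℝ F) (P : MvPolynomial (Fin m) ℂ) {p : ℝ≥0∞}
  {f : E × F → ℂ}

theorem hasSymbol_iterate {K O : Set F} {S : E → 𝓢'(F, ℂ)} (hf : ContDiff ℝ ∞ f)
    (hS : ∀ ζ, Band K (fun x => f (ζ, x)) (S ζ)) {ψ : F → ℂ} (hψ : ContDiff ℝ ∞ ψ)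
    (hψs : HasCompactSupport ψ) (hO : IsOpen O) (hKO : K ⊆ O) (hψ1 : ∀ ξ ∈ O, ψ ξ = 1) (k : ℕ) :
    HasSymbol S ψ ((polyDiffOp b P)^[k] f) (fun ξ => freqEval b P ξ ^ k) := by
  have := HasSymbol.iterate (fun h q hh => HasSymbol.polyDiffOp b P hψ hψs hh)
    (hasSymbol_one hf hS hO hKO hψ1) k
  simpa using this

/-- The cutoff is supported where `|P| < A`, not merely on a neighbourhood of `K`; that is what
gives its product with `P ^ k` the rate `A ^ k`. -/
theorem eLpNorm_iterate_le {K : Set F} (hK : IsCompact K) {S : E → 𝓢'(F, ℂ)}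
    (hf : ContDiff ℝ ∞ f) (hS : ∀ ζ, Band K (fun x => f (ζ, x)) (S ζ)) (hp : p ≠ 0)
    (hfp : eLpNorm f p (lebesgueN E F) ≠ ⊤) {A : ℝ} (hA : 0 < A)
    (hPA : ∀ ξ ∈ K, ‖freqEval b P ξ‖ < A) :
    ∃ C : ℝ≥0∞, C ≠ ⊤ ∧ ∃ L : ℕ, ∀ k : ℕ,
      eLpNorm ((polyDiffOp b P)^[k] f) p (lebesgueN E F) ≤
        C * ENNReal.ofReal ((1 + k) ^ L * A ^ k) := by
  have hQ := contDiff_freqEval b P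
  obtain ⟨ψ, hψ, hψs, hψU, O, hO, hKO, hψ1⟩ := exists_complex_bump hK
    (isOpen_lt hQ.continuous.norm continuous_const) hPA
  obtain ⟨N, W, hW, hmain⟩ := eLpNorm_le_of_band (lebesgueComplex E) hK hψs.isCompact hp
  obtain ⟨C, hC, L, hdec⟩ := fourier_mul_pow_decay hQ hψ hψs hA (fun ξ hξ => (hψU hξ).le) N
  refine ⟨W * ENNReal.ofReal C * eLpNorm f p (lebesgueN E F),
    ENNReal.mul_ne_top (ENNReal.mul_ne_top hW ENNReal.ofReal_ne_top) hfp, L, fun k => ?_⟩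
  have hs := hasSymbol_iterate b P hf hS hψ hψs hO hKO hψ1 k
  let a : 𝓢(F, ℂ) := HasCompactSupport.toSchwartzMap (f := fun ξ => ψ ξ * freqEval b P ξ ^ k)
    hψs.mul_right (hψ.mul (hQ.pow k))
  have ha : ∀ ξ, a ξ = ψ ξ * freqEval b P ξ ^ k := fun _ => rfl
  let B : F → 𝓢(F, ℂ) := fun x => HasCompactSupport.toSchwartzMap
    (f := fun ξ => ψ ξ * freqEval b P ξ ^ k * eChar x ξ) hψs.mul_right.mul_right
    ((hψ.mul (hQ.pow k)).mul (contDiff_eChar x))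
  have hB : ∀ x ξ, B x ξ = ψ ξ * freqEval b P ξ ^ k * eChar x ξ := fun _ _ => rfl
  have h1 := hmain f _ hf.continuous hs.smooth.continuous S hS a B
    (closure_mono (Function.support_mul_subset_left _ _))
    (fun x ξ => by rw [hB, ha]) (fun ζ x => hs.apply ζ x (B x) (hB x)) _ (hdec k a ha)
  refine h1.trans_eq ?_
  rw [ENNReal.ofReal_mul hC]
  change W * _ * eLpNorm f p (lebesgueN E F) = _
  ring

/-- The fixed pairing `S ζ θ` is recovered from `P(-i∂_F)^k f` by testing on `θ / P ^ k`, whose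
kernel has rate `B⁻¹ ^ k` because `|P| > B` on the support of `θ`. -/
theorem le_eLpNorm_iterate (hΦ : IsHermitianMap Φ) (h : HasBoundedSpectrum Φ f) (hp : p ≠ 0)
    {ξ₀ : F} (hξ₀ : ξ₀ ∈ freqSp Φ f) {B : ℝ} (hB : 0 < B) (hPB : B < ‖freqEval b P ξ₀‖) :
    ∃ C δ : ℝ≥0∞, C ≠ ⊤ ∧ δ ≠ 0 ∧ ∃ L : ℕ, ∀ k : ℕ,
      δ ≤ C * ENNReal.ofReal ((1 + k) ^ L * B⁻¹ ^ k) *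
        eLpNorm ((polyDiffOp b P)^[k] f) p (lebesgueN E F) := by
  have hQ := contDiff_freqEval b P
  obtain ⟨S, hS, hne⟩ := exists_band h
  have hm := memO_sp h
  have hK := isCompact_freqSp h
  have hf := hm.smooth
  obtain ⟨T, hT⟩ := hm.tempered
  have hVo : IsOpen {ξ | B < ‖freqEval b P ξ‖} := isOpen_lt continuous_const hQ.continuous.norm
  obtain ⟨ζ₀, θ, hθV, hθs, hθ0⟩ := hne ξ₀ hξ₀ _ hVo hPB
  obtain ⟨ψ, hψ, hψs, -, O, hO, hKO, hψ1⟩ := exists_complex_bump hK isOpen_univ (Set.subset_univ _)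
  obtain ⟨χ, hχ, hχs, hχV, O', hO', hKO', hχ1⟩ := exists_complex_bump hθs.isCompact hVo hθV
  -- A globally smooth stand-in for `1 / P`: the cutoff `χ` is `1` near the support of `θ` and
  -- supported where `P` does not vanish.
  let R : F → ℂ := fun ξ => χ ξ * (freqEval b P ξ)⁻¹
  have hR : ContDiff ℝ ∞ R := by
    refine contDiff_iff_contDiffAt.2 fun ξ => ?_
    by_cases hξ : ξ ∈ tsupport χ
    · exact hχ.contDiffAt.mul (hQ.contDiffAt.inv (norm_pos_iff.1 (hB.trans (hχV hξ))))
    · refine contDiffAt_const (c := (0 : ℂ)).congr_of_eventuallyEq ?_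
      filter_upwards [(isClosed_tsupport χ).isOpen_compl.mem_nhds hξ] with y hy
      simp [R, image_eq_zero_of_notMem_tsupport hy]
  have hRB : ∀ ξ ∈ tsupport θ, ‖R ξ‖ ≤ B⁻¹ := fun ξ hξ => by
    simp only [R, hχ1 ξ (hKO' hξ), one_mul, norm_inv]
    exact inv_anti₀ hB (hθV hξ).le
  have hRQ : ∀ ξ k, θ ξ * (R ξ ^ k * freqEval b P ξ ^ k) = θ ξ := fun ξ k => by
    by_cases hξ : ξ ∈ tsupport θ
    · have h1 : freqEval b P ξ ≠ 0 := norm_pos_iff.1 (hB.trans (hθV hξ))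
      simp only [R, hχ1 ξ (hKO' hξ), one_mul]
      rw [← mul_pow, inv_mul_cancel₀ h1, one_pow, mul_one]
    · rw [image_eq_zero_of_notMem_tsupport hξ, zero_mul]
  obtain ⟨N, W, hW, hmain⟩ := le_eLpNorm_of_band (lebesgueComplex E) hK hθs.isCompact hp
  obtain ⟨C, hC, L, hdec⟩ := fourier_mul_pow_decay hR (θ.smooth ⊤) hθs (inv_pos.2 hB) hRB N
  have hcont := continuous_slice_apply hΦ hf hm.cr hT hK hS θ
  set ε : ℝ≥0∞ := ‖S ζ₀ θ‖ₑ / 2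
  have hε0 : ‖S ζ₀ θ‖ₑ ≠ 0 := by simpa using hθ0
  -- Continuity in `ζ` turns nonvanishing at `ζ₀` into a lower bound on a nonempty open set, hence
  -- one of positive measure.
  have hU : IsOpen {ζ | ε < ‖S ζ θ‖ₑ} := isOpen_lt continuous_const hcont.enorm
  have hUn : {ζ | ε < ‖S ζ θ‖ₑ}.Nonempty := ⟨ζ₀, ENNReal.half_lt_self hε0 enorm_ne_top⟩
  refine ⟨W * ENNReal.ofReal C, ε * lebesgueComplex E {ζ | ε < ‖S ζ θ‖ₑ} ^ (1 / p.toReal),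
    ENNReal.mul_ne_top hW ENNReal.ofReal_ne_top, mul_ne_zero ?_ ?_, L, fun k => ?_⟩
  · exact (ENNReal.half_pos hε0).ne'
  · have h1 := (hU.measure_pos (lebesgueComplex E) hUn).ne'
    intro h2
    rcases ENNReal.rpow_eq_zero_iff.1 h2 with h3 | h3
    · exact h1 h3.1
    · have : 0 ≤ 1 / p.toReal := by positivity
      exact absurd h3.2 (not_lt.2 this)
  have hs := hasSymbol_iterate b P hf hS hψ hψs hO hKO hψ1 k
  have hcs : HasCompactSupport fun ξ => ψ ξ * freqEval b P ξ ^ k := hψs.mul_right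
  let M : 𝓢(F, ℂ) := hcs.toSchwartzMap (hψ.mul (hQ.pow k))
  have hM : ∀ ξ, M ξ = ψ ξ * freqEval b P ξ ^ k := fun _ => rfl
  let A : F → 𝓢(F, ℂ) := fun x => HasCompactSupport.toSchwartzMap
    (f := fun ξ => M ξ * eChar x ξ) (HasCompactSupport.mul_right hcs)
    ((M.smooth ⊤).mul (contDiff_eChar x))
  have hA : ∀ x ξ, A x ξ = M ξ * eChar x ξ := fun _ _ => rfl
  have hband : ∀ ζ, Band (freqSp Φ f) (fun x => (polyDiffOp b P)^[k] f (ζ, x))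
      (mulDist M (S ζ)) := fun ζ => by
    have h1 := (hS ζ).mulDist (R := M) hcs hA
    rwa [show (fun x => (polyDiffOp b P)^[k] f (ζ, x)) = fun x => S ζ (A x) from
      funext fun x => hs.apply ζ x (A x) (hA x)]
  let a : 𝓢(F, ℂ) := HasCompactSupport.toSchwartzMap (f := fun ξ => θ ξ * R ξ ^ k)
    (HasCompactSupport.mul_right hθs) ((θ.smooth ⊤).mul (hR.pow k))
  have ha : ∀ ξ, a ξ = θ ξ * R ξ ^ k := fun _ => rfl
  let e : 𝓢(F, ℂ) := HasCompactSupport.toSchwartzMap (f := fun ξ => M ξ * a ξ)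
    (HasCompactSupport.mul_right hcs) ((M.smooth ⊤).mul (a.smooth ⊤))
  have he : ∀ ξ, e ξ = M ξ * a ξ := fun _ => rfl
  have hval : ∀ ζ, mulDist M (S ζ) a = S ζ θ := fun ζ => by
    rw [mulDist_apply M he]
    refine eq_of_eqOn_nhds (hS ζ).supp hO hKO fun ξ hξ => ?_
    rw [he, hM, ha, hψ1 ξ hξ, one_mul, mul_comm, mul_assoc, hRQ]
  have h1 := hmain _ hs.smooth.continuous _ hband a
    (closure_mono (Function.support_mul_subset_left _ _)) _ (hdec k a ha) {ζ | ε < ‖S ζ θ‖ₑ} ε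
    hU.measurableSet hUn (fun ζ hζ => by rw [hval]; exact le_of_lt hζ)
  refine h1.trans_eq ?_
  rw [ENNReal.ofReal_mul hC, ← mul_assoc]
  rfl

end Spectrum

end

end QuadraticCR

/-! ### The real Paley–Wiener theorem -/

theorem proposition1p15
    {E F : Type*} [NormedAddCommGroup E] [InnerProductSpace ℂ E] [FiniteDimensional ℂ E]
    [MeasurableSpace E] [BorelSpace E]
    [NormedAddCommGroup F] [InnerProductSpace ℝ F] [FiniteDimensional ℝ F]
    [MeasurableSpace F] [BorelSpace F]
    (Φ : E →ₗ[ℂ] E →ₗ⋆[ℂ] (ℂ ⊗[ℝ] F)) (hΦ : QuadraticCR.IsHermitianMap Φ)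
    {m : ℕ} (b : Module.Basis (Fin m) ℝ F) (P : MvPolynomial (Fin m) ℂ)
    (p : ℝ≥0∞) (hp : p ≠ 0) (f : E × F → ℂ)
    (hf : MemLp f p (QuadraticCR.lebesgueN E F))
    (hfs : QuadraticCR.HasBoundedSpectrum Φ f) :
    (f ≠ 0 → ∃ M : ℝ,
      IsGreatest ((fun l => ‖QuadraticCR.polyEval b P l‖) '' QuadraticCR.Sp Φ f) M) ∧
    Tendsto
      (fun k : ℕ =>
        eLpNorm ((QuadraticCR.polyDiffOp b P)^[k] f) p (QuadraticCR.lebesgueN E F) ^ (1 / (k : ℝ)))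
      atTop
      (𝓝 (⨆ l ∈ QuadraticCR.Sp Φ f, ENNReal.ofReal ‖QuadraticCR.polyEval b P l‖)) := by
  open QuadraticCR in
  refine ⟨exists_isGreatest b P hfs, tendsto_order.2 ⟨fun a ha => ?_, fun a ha => ?_⟩⟩
  · obtain ⟨l, hl, hal⟩ : ∃ l ∈ Sp Φ f, a < ENNReal.ofReal ‖polyEval b P l‖ := by
      simpa only [lt_iSup_iff, exists_prop] using ha
    obtain ⟨B, hB1, hB2⟩ := exists_between hal
    lift B to NNReal using (hB2.trans_le le_top).ne
    have hB0 : (0 : ℝ) < B := by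
      exact_mod_cast (ENNReal.coe_pos.1 (lt_of_le_of_lt zero_le hB1))
    rw [← ENNReal.ofReal_coe_nnreal] at hB1 hB2
    have hl' : (freqHomeo F).symm l ∈ freqSp Φ f := by
      simpa only [freqSp, Set.mem_preimage, Homeomorph.apply_symm_apply] using hl
    obtain ⟨C, δ, hC, hδ, L, h⟩ := le_eLpNorm_iterate b P hΦ hfs hp hl' hB0 (by
      rw [freqEval, ← freqHomeo_apply, Homeomorph.apply_symm_apply]
      exact (ENNReal.ofReal_lt_ofReal_iff_of_nonneg hB0.le).1 hB2)
    exact eventually_lt_rpow_one_div hC hδ hB0 h hB1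
  -- Taking `A` strictly above the supremum makes `A` positive even when the supremum is `0`, which
  -- also covers an empty spectrum.
  · obtain ⟨A, hA1, hA2⟩ := exists_between ha
    lift A to NNReal using (hA2.trans_le le_top).ne
    have hA0 : (0 : ℝ) < A := by
      exact_mod_cast (ENNReal.coe_pos.1 (lt_of_le_of_lt zero_le hA1))
    rw [← ENNReal.ofReal_coe_nnreal] at hA1 hA2
    obtain ⟨S, hS, -⟩ := exists_band hfs
    obtain ⟨C, hC, L, h⟩ := eLpNorm_iterate_le b P (isCompact_freqSp hfs) (memO_sp hfs).smooth hS
      hp hf.eLpNorm_ne_top hA0 (fun ξ hξ => by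
        have h1 : ENNReal.ofReal ‖polyEval b P (freqHomeo F ξ)‖ < ENNReal.ofReal A :=
          lt_of_le_of_lt (le_iSup₂_of_le (freqHomeo F ξ) hξ le_rfl) hA1
        exact (ENNReal.ofReal_lt_ofReal_iff hA0).1 h1)
    exact eventually_rpow_one_div_lt hC hA0 h hA2
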